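/- Fix an integer $d>6$ and a compact metric space $\mathcal D$. A decorated triangulation $T$ is a connected triangulated surface without boundary (an abstract simplicial complex) of genus $0$, all of whose vertices have degree at most $d$, together with a decoration in $\mathcal D$ of every directed edge. Let $S(T)$ be the set of directed edges $x=(x_1,x_2)$ of $T$, with the metric $d(x,y)=\max(d(x_1,y_1),d(x_2,y_2))$ coming from the graph metric on vertices. Let $\hat G_0$ (resp. $\hat G$) be the set of decorated triangulations with one (resp. two) marked elements of $S(T)$, up to decoration-preserving simplicial isomorphism; write $[x]$ and $[(x,y)]$ for their elements. A (twice-)marked patch $A$ is a finite connected two-dimensional simplicial complex with one (two) marked directed edges and a Borel set $\Omega_A$ of permissible decorations of its directed edges; $\hat G_0^A\subset\hat G_0$ (resp. $\hat G^A\subset\hat G$) is the set of those marked triangulations for which there is a simplicial embedding $A\to T$ that matches the marked edges and pulls the decoration of $T$ back into $\Omega_A$. These sets generate the $\sigma$-algebras of $\hat G_0$ and $\hat G$. For a measure $\nu$ on $\hat G_0$ give $\hat G$ the measure $S\mapsto\int \#\{y\in S(T):[(x,y)]\in S\}\,d\nu([x])$; $\nu$ is a transverse measure if the latter is invariant under $(x,y)\mapsto(y,x)$.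 Measures $\nu'_n$ converge to $\nu$ if $\nu'_n(\hat G_0^A)\to\nu(\hat G_0^A)$ for every marked patch $A$. Let $W^*(\hat G)$ be the set of bounded operators on $L^2(\hat G)$ that are weak limits of sequences of bounded convolution operators $\pi(f)\varphi(x,z)=\sum_{y\in S(T)} f(x,y)\varphi(y,z)$ with $f\in L^1(\hat G)$. Let $D$ be the indicator function of the diagonal $\{[(x,x)]\}$. For $K\in W^*(\hat G)$ put $K(\delta_x)(x):=(KD)(x,x)$ and $\tau(K)=\int K(\delta_x)(x)\,d\nu(x)$. Let $\nu$ be a finite transverse measure, and let $\nu'_n$ be finite measures on $\hat G_0$ that converge to $\nu$. Let $H\in W^*(\hat G)$ be self-adjoint, acting along the leaves by bounded self-adjoint operators $H_T$ on $\ell^2(S(T))$, given for every decorated triangulation $T$, whose matrix entries $H_T(\delta_y)(x)$ are a measurable function $h$ of $[(x,y)]\in\hat G$; that is, $H=\pi(h)$. Suppose that $H$ has finite hopping range: there is $r$ such that, for all $T$ and all $x\in S(T)$, $H_T(\delta_x)$ is supported in the ball $B_r(x)$, and every isomorphism $B_r(x)\cong B_r(y)$ of balls (of marked decorated complexes, $x\in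 S(T)$, $y\in S(U)$) carries $H_T(\delta_x)$ to $H_U(\delta_y)$. Then, for every continuous, compactly supported $\phi:\mathbb R\to\mathbb R$, the functions $x\mapsto\phi(H)(\delta_x)(x)$ and $x\mapsto \phi(H_T)(\delta_x)(x)$ are integrable with respect to $\nu$ and to every $\nu'_n$, respectively, and the density of states $\kappa_H(\phi)=\tau(\phi(H))$ satisfies \[ \kappa_H(\phi)=\lim_{n\to\infty}\int_{\hat G_0}\phi(H_T)(\delta_x)(x)\,d\nu'_n([x]). \] -/

import Mathlib

open MeasureTheory Filter Topology
open scoped ENNReal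

noncomputable section

namespace TriangulationSpace

/-! ### Simplicial complexes and triangulated surfaces -/

/-- The `1`-skeleton of an abstract simplicial complex, as a graph on the vertices. -/
def skeleton {V : Type*} (K : AbstractSimplicialComplex V) : SimpleGraph V where
  Adj u v := u ≠ v ∧ ∃ s ∈ K.faces, ∀ w, w ∈ s ↔ w = u ∨ w = v
  symm := ⟨fun _ _ h => ⟨h.1.symm, h.2.imp fun _ hs => ⟨hs.1, fun w => (hs.2 w).trans or_comm⟩⟩⟩
  loopless := ⟨fun _ h => h.1 rfl⟩

/-- A discrete tangent vector: an ordered edge `(x₁, x₂)`; the tail is `x.fst`, the head `x.snd`. -/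
abbrev TangentVector {V : Type*} (K : AbstractSimplicialComplex V) : Type _ := (skeleton K).Dart

/-- The complex has dimension exactly `2`. -/
def IsTwoDimensional {V : Type*} (K : AbstractSimplicialComplex V) : Prop :=
  (∀ s ∈ K.faces, s.card ≤ 3) ∧ ∃ s ∈ K.faces, s.card = 3

/-- The link of a vertex `v` of a two-dimensional complex: the graph on the neighbours of `v`
in which `u` and `w` are joined if `{v, u, w}` is a face. -/
def link {V : Type*} (K : AbstractSimplicialComplex V) (v : V) :
    SimpleGraph {u : V // (skeleton K).Adj v u} where
  Adj u w := u ≠ w ∧ ∃ s ∈ K.faces, ∀ z, z ∈ s ↔ z = v ∨ z = u.1 ∨ z = w.1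
  symm := ⟨fun _ _ h => ⟨h.1.symm, h.2.imp fun _ hs =>
    ⟨hs.1, fun z => (hs.2 z).trans (or_congr_right or_comm)⟩⟩⟩
  loopless := ⟨fun _ h => h.1 rfl⟩

/-- The two-dimensional complex is a (combinatorial) surface without boundary: the link of every
vertex is a cycle, i.e. a finite connected graph in which every vertex has exactly two
neighbours. -/
def IsSurface {V : Type*} (K : AbstractSimplicialComplex V) : Prop :=
  ∀ v : V, ((skeleton K).neighborSet v).Finite ∧ (link K v).Connected ∧
    ∀ u, ((link K v).neighborSet u).ncard = 2

/-- The geometric realization in barycentric coordinates, with the topology of pointwise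
convergence of the coordinates (for the locally finite complexes considered here this is the
topology of the piecewise Euclidean path metric). -/
def Realization {V : Type*} (K : AbstractSimplicialComplex V) : Type _ :=
  {f : V → ℝ // (∀ v, 0 ≤ f v) ∧ ∃ s ∈ K.faces, (∀ v, v ∉ s → f v = 0) ∧ ∑ v ∈ s, f v = 1}

instance {V : Type*} (K : AbstractSimplicialComplex V) : TopologicalSpace (Realization K) :=
  inferInstanceAs (TopologicalSpace {_f : V → ℝ // _})

/-- Genus zero: every simple closed curve in the geometric realization separates it. -/
def IsGenusZero {V : Type*} (K : AbstractSimplicialComplex V) : Prop :=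
  ∀ γ : Circle → Realization K, Continuous γ → Function.Injective γ →
    ¬ IsPreconnected (Set.range γ)ᶜ

/-- A decorated triangulation: a connected triangulated surface of genus zero with all vertex
degrees at most `d`, together with a decoration in `𝒟` of every directed edge.
Such a complex is countable, so its vertices may be taken to be natural numbers. -/
structure DecoratedTriangulation (d : ℕ) (𝒟 : Type*) where
  /-- the vertex set -/
  verts : Set ℕ
  /-- the underlying complex -/
  K : AbstractSimplicialComplex verts
  dim_two : IsTwoDimensional K
  connected : (skeleton K).Connected
  surface : IsSurface K
  genus_zero : IsGenusZero K
  degree_le : ∀ v, ((skeleton K).neighborSet v).encard ≤ d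
  /-- the decoration -/
  dec : TangentVector K → 𝒟

/-- The discrete sphere bundle `S(T)`. -/
abbrev DecoratedTriangulation.S {d : ℕ} {𝒟 : Type*} (T : DecoratedTriangulation d 𝒟) : Type :=
  TangentVector T.K

/-- A simplicial embedding: an injective map of vertices that maps faces to faces. -/
structure SimplicialEmbedding {V W : Type*} (K : AbstractSimplicialComplex V)
    (L : AbstractSimplicialComplex W) where
  /-- the map on vertices -/
  toEmb : V ↪ W
  map_faces : ∀ s ∈ K.faces, s.map toEmb ∈ L.faces

/-- The map induced on discrete tangent vectors. -/
def SimplicialEmbedding.mapS {V W : Type*} {K : AbstractSimplicialComplex V}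
    {L : AbstractSimplicialComplex W} (g : SimplicialEmbedding K L) (x : TangentVector K) :
    TangentVector L where
  fst := g.toEmb x.fst
  snd := g.toEmb x.snd
  adj := ⟨fun h => x.adj.1 (g.toEmb.injective h), by
    obtain ⟨s, hs, h⟩ := x.adj.2
    refine ⟨s.map g.toEmb, g.map_faces s hs, fun w => ?_⟩
    simp only [Finset.mem_map, h]
    constructor
    · rintro ⟨a, rfl | rfl, rfl⟩ <;> simp
    · rintro (rfl | rfl)
      · exact ⟨_, Or.inl rfl, rfl⟩
      · exact ⟨_, Or.inr rfl, rfl⟩⟩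

/-- A simplicial embedding of `T` into `U` given by a bijection of vertices whose inverse is also
simplicial and that preserves decorations: an isomorphism of decorated triangulations. -/
structure Iso {d : ℕ} {𝒟 : Type*} (T U : DecoratedTriangulation d 𝒟) where
  /-- the simplicial map -/
  hom : SimplicialEmbedding T.K U.K
  /-- the inverse simplicial map -/
  inv : SimplicialEmbedding U.K T.K
  inv_hom : ∀ v, inv.toEmb (hom.toEmb v) = v
  hom_inv : ∀ v, hom.toEmb (inv.toEmb v) = v
  dec_hom : ∀ x : T.S, U.dec (hom.mapS x) = T.dec x

section IsoBasics

variable {d : ℕ} {𝒟 : Type*} {T U W : DecoratedTriangulation d 𝒟}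

theorem Iso.mapS_inv_hom (e : Iso T U) (x : T.S) : e.inv.mapS (e.hom.mapS x) = x :=
  SimpleGraph.Dart.ext _ _ (Prod.ext (e.inv_hom _) (e.inv_hom _))

theorem Iso.mapS_hom_inv (e : Iso T U) (x : U.S) : e.hom.mapS (e.inv.mapS x) = x :=
  SimpleGraph.Dart.ext _ _ (Prod.ext (e.hom_inv _) (e.hom_inv _))

/-- The bijection of discrete tangent vectors induced by an isomorphism. -/
def Iso.equivS (e : Iso T U) : T.S ≃ U.S :=
  ⟨e.hom.mapS, e.inv.mapS, e.mapS_inv_hom, e.mapS_hom_inv⟩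

/-- The identity. -/
def Iso.refl (T : DecoratedTriangulation d 𝒟) : Iso T T where
  hom := ⟨Function.Embedding.refl _, fun s hs => by simpa using hs⟩
  inv := ⟨Function.Embedding.refl _, fun s hs => by simpa using hs⟩
  inv_hom _ := rfl
  hom_inv _ := rfl
  dec_hom _ := rfl

/-- The inverse. -/
def Iso.symm (e : Iso T U) : Iso U T where
  hom := e.inv
  inv := e.hom
  inv_hom := e.hom_inv
  hom_inv := e.inv_hom
  dec_hom x := by rw [← e.dec_hom, e.mapS_hom_inv]

/-- The composition. -/
def Iso.trans (e : Iso T U) (f : Iso U W) : Iso T W where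
  hom := ⟨e.hom.toEmb.trans f.hom.toEmb, fun s hs => by
    rw [← Finset.map_map]; exact f.hom.map_faces _ (e.hom.map_faces _ hs)⟩
  inv := ⟨f.inv.toEmb.trans e.inv.toEmb, fun s hs => by
    rw [← Finset.map_map]; exact e.inv.map_faces _ (f.inv.map_faces _ hs)⟩
  inv_hom v := by simp [f.inv_hom, e.inv_hom]
  hom_inv v := by simp [f.hom_inv, e.hom_inv]
  dec_hom x := by
    rw [← e.dec_hom, ← f.dec_hom]; rfl

end IsoBasics

/-! ### The discrete holonomy groupoid and its unit space -/

/-- Triangulations with a marked discrete tangent vector, up to isomorphism. -/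
def markedSetoid (d : ℕ) (𝒟 : Type*) : Setoid (Σ T : DecoratedTriangulation d 𝒟, T.S) where
  r p q := ∃ e : Iso p.1 q.1, e.equivS p.2 = q.2
  iseqv :=
    { refl := fun p => ⟨Iso.refl p.1, rfl⟩
      symm := fun {p q} ⟨e, he⟩ => ⟨e.symm, by rw [← he]; exact e.mapS_inv_hom _⟩
      trans := fun {p q s} ⟨e, he⟩ ⟨f, hf⟩ => ⟨e.trans f, by rw [← hf, ← he]; rfl⟩ }

/-- Triangulations with two marked discrete tangent vectors, up to isomorphism. -/
def twiceMarkedSetoid (d : ℕ) (𝒟 : Type*) :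
    Setoid (Σ T : DecoratedTriangulation d 𝒟, T.S × T.S) where
  r p q := ∃ e : Iso p.1 q.1, e.equivS p.2.1 = q.2.1 ∧ e.equivS p.2.2 = q.2.2
  iseqv :=
    { refl := fun p => ⟨Iso.refl p.1, rfl, rfl⟩
      symm := fun {p q} ⟨e, he, he'⟩ => ⟨e.symm, by rw [← he]; exact e.mapS_inv_hom _,
        by rw [← he']; exact e.mapS_inv_hom _⟩
      trans := fun {p q s} ⟨e, he, he'⟩ ⟨f, hf, hf'⟩ => ⟨e.trans f, by rw [← hf, ← he]; rfl,
        by rw [← hf', ← he']; rfl⟩ }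

/-- The unit space `Ĝ₀` of the discrete holonomy groupoid. -/
def UnitSpace (d : ℕ) (𝒟 : Type*) : Type _ := Quotient (markedSetoid d 𝒟)

/-- The discrete holonomy groupoid `Ĝ`. -/
def Groupoid (d : ℕ) (𝒟 : Type*) : Type _ := Quotient (twiceMarkedSetoid d 𝒟)

section Points

variable {d : ℕ} {𝒟 : Type*}

/-- The point `(T, [x])` of `Ĝ₀`. -/
def UnitSpace.mk (T : DecoratedTriangulation d 𝒟) (x : T.S) : UnitSpace d 𝒟 :=
  Quotient.mk (markedSetoid d 𝒟) ⟨T, x⟩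

/-- The element `[(x, y)]` of `Ĝ`. -/
def Groupoid.mk (T : DecoratedTriangulation d 𝒟) (x y : T.S) : Groupoid d 𝒟 :=
  Quotient.mk (twiceMarkedSetoid d 𝒟) ⟨T, x, y⟩

theorem Groupoid.mk_equivS {T U : DecoratedTriangulation d 𝒟} (e : Iso T U) (x y : T.S) :
    Groupoid.mk U (e.equivS x) (e.equivS y) = Groupoid.mk T x y :=
  (Quotient.sound (s := twiceMarkedSetoid d 𝒟) ⟨e, rfl, rfl⟩).symm

/-- The inclusion of units `x ↦ (x, x)`. -/
def UnitSpace.diag : UnitSpace d 𝒟 → Groupoid d 𝒟 :=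
  Quotient.lift (fun p => Groupoid.mk p.1 p.2 p.2) (by
    rintro ⟨T, x⟩ ⟨U, y⟩ ⟨e, he⟩
    change Iso T U at e
    change e.equivS x = y at he
    subst he
    exact (Groupoid.mk_equivS e x x).symm)

/-- The inversion `(x, y) ↦ (y, x)`. -/
def Groupoid.inv : Groupoid d 𝒟 → Groupoid d 𝒟 :=
  Quotient.lift (fun p => Groupoid.mk p.1 p.2.2 p.2.1) (by
    rintro ⟨T, x, y⟩ ⟨U, x', y'⟩ ⟨e, he, he'⟩
    change Iso T U at e
    change e.equivS x = x' at he
    change e.equivS y = y' at he'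
    subst he he'
    exact (Groupoid.mk_equivS e y x).symm)

end Points

/-! ### Finite patches -/

/-- A decorated discrete finite patch `(A, x_A, Ω)`: a finite connected two-dimensional simplicial
complex with a marked discrete tangent vector and a Borel set of permissible decorations. -/
structure Patch (𝒟 : Type*) [MeasurableSpace 𝒟] where
  /-- the number of vertices -/
  size : ℕ
  /-- the underlying complex -/
  A : AbstractSimplicialComplex (Fin size)
  dim_two : IsTwoDimensional A
  connected : (skeleton A).Connected
  /-- the marked discrete tangent vector -/
  base : TangentVector A
  /-- the permissible decorations -/
  Ω : Set (TangentVector A → 𝒟)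
  measurable_Ω : MeasurableSet Ω

/-- A twice-marked decorated discrete finite patch. -/
structure TwiceMarkedPatch (𝒟 : Type*) [MeasurableSpace 𝒟] extends Patch 𝒟 where
  /-- the second marked discrete tangent vector -/
  base' : TangentVector A

section Cylinders

variable {𝒟 : Type*} [MeasurableSpace 𝒟]

/-- The set `Ĝ₀^A` of marked triangulations that contain the patch `A` at the marked tangent
vector. -/
def Patch.cylinder (P : Patch 𝒟) (d : ℕ) : Set (UnitSpace d 𝒟) :=
  {u | ∃ (T : DecoratedTriangulation d 𝒟) (x : T.S), u = UnitSpace.mk T x ∧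
    ∃ g : SimplicialEmbedding P.A T.K, g.mapS P.base = x ∧ (fun a => T.dec (g.mapS a)) ∈ P.Ω}

/-- The set `Ĝ^A` of twice-marked triangulations that contain the twice-marked patch `A`. -/
def TwiceMarkedPatch.cylinder (P : TwiceMarkedPatch 𝒟) (d : ℕ) : Set (Groupoid d 𝒟) :=
  {u | ∃ (T : DecoratedTriangulation d 𝒟) (x y : T.S), u = Groupoid.mk T x y ∧
    ∃ g : SimplicialEmbedding P.A T.K, g.mapS P.base = x ∧ g.mapS P.base' = y ∧
      (fun a => T.dec (g.mapS a)) ∈ P.Ω}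

/-- The `σ`-algebra of `Ĝ₀` is generated by the sets `Ĝ₀^A`. -/
instance (d : ℕ) : MeasurableSpace (UnitSpace d 𝒟) :=
  MeasurableSpace.generateFrom (Set.range fun P : Patch 𝒟 => P.cylinder d)

/-- The `σ`-algebra of `Ĝ` is generated by the sets `Ĝ^A`. -/
instance (d : ℕ) : MeasurableSpace (Groupoid d 𝒟) :=
  MeasurableSpace.generateFrom (Set.range fun P : TwiceMarkedPatch 𝒟 => P.cylinder d)

/-! ### Transverse measures -/

/-- The measure `λ^x` on the fibre `Ĝ^x = {[(x, y)]}`: counting measure in `y ∈ S(T)`. -/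
def fibreMeasure {d : ℕ} : UnitSpace d 𝒟 → Measure (Groupoid d 𝒟) :=
  Quotient.lift (fun p => Measure.sum fun y : p.1.S => Measure.dirac (Groupoid.mk p.1 p.2 y)) (by
    rintro ⟨T, x⟩ ⟨U, x'⟩ ⟨e, he⟩
    change Iso T U at e
    change e.equivS x = x' at he
    subst he
    change (Measure.sum fun y : T.S => Measure.dirac (Groupoid.mk T x y)) =
      Measure.sum fun y : U.S => Measure.dirac (Groupoid.mk U (e.equivS x) y)
    rw [← Measure.sum_comp_equiv e.equivS]
    simp only [Function.comp_def, Groupoid.mk_equivS])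

/-- The measure on `Ĝ` given by `∫ λ^x dν(x)`. -/
def groupoidMeasure {d : ℕ} (ν : Measure (UnitSpace d 𝒟)) : Measure (Groupoid d 𝒟) :=
  ν.bind fibreMeasure

/-- A measure on `Ĝ₀` is a transverse measure if it is invariant: the measures on `Ĝ` obtained by
integrating counting measure along the range fibres and along the source fibres coincide. -/
def IsTransverse {d : ℕ} (ν : Measure (UnitSpace d 𝒟)) : Prop :=
  (groupoidMeasure ν).map Groupoid.inv = groupoidMeasure ν

/-- Convergence `ν'_n → ν`: convergence on `Ĝ₀^A` for every decorated finite patch `A`. -/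
def PatchConverges {d : ℕ} (ν' : ℕ → Measure (UnitSpace d 𝒟)) (ν : Measure (UnitSpace d 𝒟)) :
    Prop :=
  ∀ P : Patch 𝒟, Tendsto (fun n => ν' n (P.cylinder d)) atTop (𝓝 (ν (P.cylinder d)))

/-! ### The von Neumann algebra -/

/-- Leafwise convolution `(f * φ)(x, z) = ∑_y f(x, y) φ(y, z)`. -/
def conv {d : ℕ} (f φ : Groupoid d 𝒟 → ℂ) : Groupoid d 𝒟 → ℂ :=
  Quotient.lift
    (fun p => ∑' y : p.1.S, f (Groupoid.mk p.1 p.2.1 y) * φ (Groupoid.mk p.1 y p.2.2)) (by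
    rintro ⟨T, x, z⟩ ⟨U, x', z'⟩ ⟨e, he, he'⟩
    change Iso T U at e
    change e.equivS x = x' at he
    change e.equivS z = z' at he'
    subst he he'
    change ∑' y : T.S, f (Groupoid.mk T x y) * φ (Groupoid.mk T y z) =
      ∑' y : U.S, f (Groupoid.mk U (e.equivS x) y) * φ (Groupoid.mk U y (e.equivS z))
    rw [← e.equivS.tsum_eq]
    simp only [Groupoid.mk_equivS])

/-- The Hilbert space `L²(Ĝ)`. -/
abbrev L2 {d : ℕ} (ν : Measure (UnitSpace d 𝒟)) : Type _ := Lp ℂ 2 (groupoidMeasure ν)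

/-- The bounded operator `H` on `L²(Ĝ)` is `π(f)`, i.e. left convolution by `f`. -/
def IsConvolution {d : ℕ} (ν : Measure (UnitSpace d 𝒟)) (f : Groupoid d 𝒟 → ℂ)
    (H : L2 ν →L[ℂ] L2 ν) : Prop :=
  ∀ φ : L2 ν, H φ =ᵐ[groupoidMeasure ν] conv f φ

/-- `W*(Ĝ)`: the operators on `L²(Ĝ)` that are weak limits of a sequence of (bounded) convolution
operators `π(f_n)` with `f_n ∈ L¹(Ĝ)`. -/
def WStar {d : ℕ} (ν : Measure (UnitSpace d 𝒟)) : Set (L2 ν →L[ℂ] L2 ν) :=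
  {H | ∃ (f : ℕ → Groupoid d 𝒟 → ℂ) (K : ℕ → L2 ν →L[ℂ] L2 ν),
    (∀ n, Integrable (f n) (groupoidMeasure ν) ∧ IsConvolution ν (f n) (K n)) ∧
    ∀ φ η : L2 ν, Tendsto (fun n => inner ℂ η (K n φ)) atTop (𝓝 (inner ℂ η (H φ)))}

/-- The diagonal `{(x, x)}` of `Ĝ`. -/
def diagonal (d : ℕ) (𝒟 : Type*) : Set (Groupoid d 𝒟) := Set.range UnitSpace.diag

/-- The diagonal function `D`, the indicator function of the units. -/
def diagFun {d : ℕ} : Groupoid d 𝒟 → ℂ := (diagonal d 𝒟).indicator 1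

/-- For `H ∈ W*(Ĝ)` the function `(x, y) ↦ H(δ_y)(x)` is `H(D)`, and its value at `(x, x)` is
`H(δ_x)(x)`. (Here `D` is an element of `L²(Ĝ)` for every finite measure `ν`.) -/
def diagonalEntry {d : ℕ} (ν : Measure (UnitSpace d 𝒟)) (H : L2 ν →L[ℂ] L2 ν)
    (u : UnitSpace d 𝒟) : ℂ :=
  open Classical in
  if h : MemLp (diagFun (d := d) (𝒟 := 𝒟)) 2 (groupoidMeasure ν) then H (h.toLp diagFun) u.diag
  else 0

/-- The trace `τ(H) = ∫ H(δ_x)(x) dν(x)`. -/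
def trace {d : ℕ} (ν : Measure (UnitSpace d 𝒟)) (H : L2 ν →L[ℂ] L2 ν) : ℂ :=
  ∫ u, diagonalEntry ν H u ∂ν

/-- `φ(H)` for a bounded self-adjoint operator `H` on a Hilbert space, by the continuous
functional calculus. -/
def applyFun {E : Type*} [NormedAddCommGroup E] [InnerProductSpace ℂ E] [CompleteSpace E]
    (φ : ℝ → ℝ) (H : E →L[ℂ] E) : E →L[ℂ] E := cfc φ H

/-- The density of states `κ_H(φ) = τ(φ(H))`. -/
def densityOfStates {d : ℕ} (ν : Measure (UnitSpace d 𝒟)) (H : L2 ν →L[ℂ] L2 ν) (φ : ℝ → ℝ) : ℂ :=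
  trace ν (applyFun φ H)

/-! ### Leafwise operators and finite hopping range -/

/-- The Hilbert space `ℓ²(S(T))` of the leaf of `T`. -/
abbrev LeafSpace {d : ℕ} (T : DecoratedTriangulation d 𝒟) : Type :=
  lp (fun _ : T.S => ℂ) 2

/-- The unit vector `δ_x`. -/
def delta {d : ℕ} {T : DecoratedTriangulation d 𝒟} (x : T.S) : LeafSpace T :=
  open Classical in lp.single 2 x 1

/-- The matrix entry `L(δ_y)(x)`. -/
def entry {d : ℕ} {T : DecoratedTriangulation d 𝒟} (L : LeafSpace T →L[ℂ] LeafSpace T)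
    (x y : T.S) : ℂ :=
  L (delta y) x

/-- A measurable equivariant family `(H_T)` of bounded operators on the leaves: the matrix entries
`H_T(δ_y)(x)` form a measurable function of `[(x, y)] ∈ Ĝ`. -/
structure LeafwiseOperator (d : ℕ) (𝒟 : Type*) [MeasurableSpace 𝒟] where
  /-- the operator on the leaf of `T` -/
  op : ∀ T : DecoratedTriangulation d 𝒟, LeafSpace T →L[ℂ] LeafSpace T
  /-- the matrix entries -/
  kernel : Groupoid d 𝒟 → ℂ
  kernel_mk : ∀ (T : DecoratedTriangulation d 𝒟) (x y : T.S),
    kernel (Groupoid.mk T x y) = entry (op T) x y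
  measurable_kernel : Measurable kernel

/-- The operator `H` on `L²(Ĝ)` acts along the leaves by the family `F`, i.e. `F.op T` is the
restriction of `H` to the leaf of `T`: `(Hφ)(x, z) = ∑_y F_T(δ_y)(x) φ(y, z)`. -/
def IsLeafwise {d : ℕ} (ν : Measure (UnitSpace d 𝒟)) (H : L2 ν →L[ℂ] L2 ν)
    (F : LeafwiseOperator d 𝒟) : Prop :=
  IsConvolution ν F.kernel H

/-- The ball `B_r(x)` of `S(T)` for the metric `max (d(x₁, y₁)) (d(x₂, y₂))`. -/
def ball {d : ℕ} {T : DecoratedTriangulation d 𝒟} (x : T.S) (r : ℕ) : Set T.S :=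
  {y | (skeleton T.K).edist x.fst y.fst ≤ r ∧ (skeleton T.K).edist x.snd y.snd ≤ r}

/-- The vertices of the elements of `B_r(x)`. -/
def ballVerts {d : ℕ} {T : DecoratedTriangulation d 𝒟} (x : T.S) (r : ℕ) : Set T.verts :=
  {v | ∃ y ∈ ball x r, v = y.fst ∨ v = y.snd}

/-- The map `g` restricts to an isomorphism `B_r(x) ≅ B_r(y)` of marked decorated complexes: it maps
the full subcomplex of `T` spanned by `B_r(x)` isomorphically to the full subcomplex of `U` spanned
by `B_r(y)`, takes `x` to `y` and preserves decorations. -/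
structure IsBallIso {d : ℕ} {T U : DecoratedTriangulation d 𝒟} (x : T.S) (y : U.S) (r : ℕ)
    (g : T.verts → U.verts) : Prop where
  bijOn : Set.BijOn g (ballVerts x r) (ballVerts y r)
  faces_iff : ∀ s : Finset T.verts, (s : Set T.verts) ⊆ ballVerts x r →
    (s.image g ∈ U.K.faces ↔ s ∈ T.K.faces)
  map_fst : g x.fst = y.fst
  map_snd : g x.snd = y.snd
  dec_eq : ∀ (a : T.S) (b : U.S), a.fst ∈ ballVerts x r → a.snd ∈ ballVerts x r →
    b.fst = g a.fst → b.snd = g a.snd → U.dec b = T.dec a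

/-- Hopping range `r`: for every `x`, `H(δ_x)` is supported in `B_r(x)`, and `H(δ_x) = H(δ_y)`,
under the identification of `B_r(x)` with `B_r(y)`, whenever these balls are isomorphic. -/
structure LeafwiseOperator.HasHoppingRange {d : ℕ} (F : LeafwiseOperator d 𝒟) (r : ℕ) : Prop where
  support : ∀ (T : DecoratedTriangulation d 𝒟) (x w : T.S), w ∉ ball x r → entry (F.op T) w x = 0
  local_eq : ∀ (T U : DecoratedTriangulation d 𝒟) (x : T.S) (y : U.S) (g : T.verts → U.verts),
    IsBallIso x y r g → ∀ w ∈ ball x r, ∀ w' ∈ ball y r, w'.fst = g w.fst → w'.snd = g w.snd →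
      entry (F.op U) w' y = entry (F.op T) w x

/-- The local leafwise trace `φ(H_T)(δ_x)(x)` at the marked tangent vector. The value does not
depend on the representative `(T, x)` of the point of `Ĝ₀`. -/
def LeafwiseOperator.localTrace {d : ℕ} (F : LeafwiseOperator d 𝒟) (φ : ℝ → ℝ)
    (u : UnitSpace d 𝒟) : ℂ :=
  entry (applyFun φ (F.op (Quotient.out u).1)) (Quotient.out u).2 (Quotient.out u).2

end Cylinders

end TriangulationSpace

end

noncomputable section

set_option linter.unusedSectionVars false

namespace TriangulationSpace

/-! ### Balls in graphs -/

section VertexBall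

variable {V : Type*} {G : SimpleGraph V}

/-! By finite hopping range, the diagonal entry at `x` of a polynomial in `F.op T` depends only on a
decorated ball around `x`. Such a local function sees finitely many combinatorial types of balls,
since degrees are at most `d`, and for each type it imposes a Borel condition on the decoration. So
its level sets are finite disjoint unions of patch cylinders (`IsLocal.exists_patches`). A cylinder
only asks for an embedding of the patch, but links in a surface are cycles, so an embedding of the
closed stars of a ball is automatically an isomorphism onto the corresponding stars
(`IsStarEmb.linkMap_surjective`). Hence the measures of level sets converge, and by the layer-cake
formula so do the integrals of bounded local functions (`IsLocal.tendsto_integral`).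

On the side of `ν`, transversality shows that `H ^ n` applied to the diagonal function is almost
everywhere the `n`-th convolution power of the kernel (`IsLeafwise.pow_diagVec`). The measure of the
groupoid restricts to `ν` on the diagonal (`restrict_diagonal`), so diagonal values of `L²`
functions make sense almost everywhere, and for polynomials of `H` they are the leafwise ones.

For general `φ`, a Weierstrass approximation on one interval is not enough: no bound on `‖F.op T‖`
uniform in `T` is given, and `ν' n` may charge leaves where it exceeds `‖H‖`. Instead `|φ - p| ≤ ε +
ε (t / C) ^ (2N)` is arranged on the whole line, with `2‖H‖ ≤ C` and `N` as large as desired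
(`exists_polynomial_approx`). By functional calculus the local traces of `φ` and `p` differ by at
most `2ε` on the set `G` where the moment of order `2N` is at most `C ^ (2N)`. Markov's inequality
gives `ν(Gᶜ) ≤ 2 ^ (-2N) ν(univ)`, and `ν' n (Gᶜ)` converges to `ν(Gᶜ)` because the moment is local.
Off `G` the bound on `φ` suffices for `ν' n`, and Cauchy–Schwarz for `ν`. -/

/-- The closed ball of radius `n` around the vertex `c` of a graph. -/
def vball (G : SimpleGraph V) (c : V) (n : ℕ) : Set V := {u | G.edist c u ≤ n}

theorem mem_vball_self (c : V) (n : ℕ) : c ∈ vball G c n := by simp [vball]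

theorem vball_mono (c : V) {m n : ℕ} (h : m ≤ n) : vball G c m ⊆ vball G c n :=
  fun _ hu => le_trans (Set.mem_ofPred.1 hu) (by exact_mod_cast h)

theorem mem_vball_comm {c u : V} {n : ℕ} : u ∈ vball G c n ↔ c ∈ vball G u n := by
  simp [vball, SimpleGraph.edist_comm]

theorem mem_vball_zero {c u : V} : u ∈ vball G c 0 ↔ u = c := by
  change G.edist c u ≤ ((0 : ℕ) : ℕ∞) ↔ _
  rw [Nat.cast_zero, nonpos_iff_eq_zero, SimpleGraph.edist_eq_zero_iff]
  exact eq_comm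

theorem mem_vball_trans {c v u : V} {m n : ℕ} (hv : v ∈ vball G c m) (hu : u ∈ vball G v n) :
    u ∈ vball G c (m + n) := by
  refine le_trans SimpleGraph.edist_triangle (le_trans (add_le_add hv hu) ?_)
  push_cast; exact le_rfl

theorem mem_vball_one_of_adj {v u : V} (h : G.Adj v u) : u ∈ vball G v 1 := by
  simpa [vball, SimpleGraph.edist_le_one_iff_adj_or_eq] using Or.inl h

theorem mem_vball_succ {c u : V} {n : ℕ} :
    u ∈ vball G c (n + 1) ↔ ∃ w ∈ vball G c n, w = u ∨ G.Adj w u := by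
  constructor
  · intro h
    by_cases h' : u ∈ vball G c n
    · exact ⟨u, h', Or.inl rfl⟩
    rw [mem_vball_comm] at h
    have hne : G.edist u c ≠ ⊤ := ne_top_of_le_ne_top (ENat.natCast_ne_top _) h
    obtain ⟨p, hp⟩ := SimpleGraph.exists_walk_of_edist_ne_top hne
    have hlen : p.length ≤ n + 1 := by
      have : (p.length : ℕ∞) ≤ ((n + 1 : ℕ) : ℕ∞) := hp ▸ h
      exact_mod_cast this
    cases p with
    | nil => exact absurd (mem_vball_self _ _) h'
    | @cons _ w _ hadj q =>
      refine ⟨w, ?_, Or.inr hadj.symm⟩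
      rw [mem_vball_comm]
      refine le_trans (SimpleGraph.edist_le q) ?_
      rw [SimpleGraph.Walk.length_cons] at hlen
      exact_mod_cast (by omega : q.length ≤ n)
  · rintro ⟨w, hw, rfl | h⟩
    · exact vball_mono _ (Nat.le_succ n) hw
    · exact mem_vball_trans hw (mem_vball_one_of_adj h)

theorem mem_vball_of_adj {c w u : V} {n : ℕ} (hw : w ∈ vball G c n) (h : G.Adj w u) :
    u ∈ vball G c (n + 1) :=
  mem_vball_succ.2 ⟨w, hw, Or.inr h⟩

/-- The bound depends on `d` and `n` alone; this is what later leaves only finitely many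
combinatorial types of balls. -/
theorem encard_vball_le {d : ℕ} (hd : ∀ v, (G.neighborSet v).encard ≤ d) (c : V) (n : ℕ) :
    (vball G c n).encard ≤ ((d + 1) ^ n : ℕ) := by
  induction n with
  | zero =>
    have : vball G c 0 = {c} := by ext u; simp [mem_vball_zero]
    simp [this]
  | succ n ih =>
    have hfin : (vball G c n).Finite :=
      Set.finite_of_encard_le_coe ih
    have hsub : vball G c (n + 1) ⊆ ⋃ w ∈ hfin.toFinset, insert w (G.neighborSet w) := by
      intro u hu
      obtain ⟨w, hw, h⟩ := mem_vball_succ.1 hu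
      simp only [Set.mem_iUnion]
      exact ⟨w, by simpa using hw, h.imp Eq.symm id⟩
    refine (Set.encard_le_encard hsub).trans ?_
    have key : ∀ s : Finset V, (⋃ w ∈ s, insert w (G.neighborSet w)).encard ≤
        ((s.card * (d + 1) : ℕ) : ℕ∞) := by
      classical
      intro s
      induction s using Finset.induction_on with
      | empty => simp
      | insert a s ha ihs =>
        rw [Finset.set_biUnion_insert, Finset.card_insert_of_notMem ha]
        refine (Set.encard_union_le _ _).trans ?_
        have h1 : (insert a (G.neighborSet a)).encard ≤ ((d + 1 : ℕ) : ℕ∞) := by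
          refine (Set.encard_insert_le _ _).trans ?_
          push_cast
          exact add_le_add (hd a) le_rfl
        refine (add_le_add h1 ihs).trans ?_
        rw [← Nat.cast_add]
        exact_mod_cast (by nlinarith : d + 1 + s.card * (d + 1) ≤ (s.card + 1) * (d + 1))
    refine (key _).trans ?_
    have hc : hfin.toFinset.card ≤ (d + 1) ^ n := by
      rw [hfin.encard_eq_coe_toFinset_card] at ih
      exact_mod_cast ih
    rw [pow_succ]
    exact_mod_cast Nat.mul_le_mul_right _ hc

end VertexBall

/-! ### Faces of surfaces -/

section Faces

variable {V : Type*} [DecidableEq V] {K : AbstractSimplicialComplex V}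

theorem face_mono {s t : Finset V} (hs : s ∈ K.faces) (hts : t ⊆ s) (ht : t.Nonempty) :
    t ∈ K.faces :=
  (K.isRelLowerSet_faces hs).2 hts ht

theorem face_nonempty {s : Finset V} (hs : s ∈ K.faces) : s.Nonempty :=
  (K.isRelLowerSet_faces hs).1

theorem skeleton_adj_iff {u v : V} :
    (skeleton K).Adj u v ↔ u ≠ v ∧ ({u, v} : Finset V) ∈ K.faces := by
  refine and_congr_right fun _ => ⟨?_, fun h => ⟨_, h, by simp⟩⟩
  rintro ⟨s, hs, h⟩
  convert hs using 1
  ext w; simp [h]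

theorem link_adj_iff {v : V} {u w : {u : V // (skeleton K).Adj v u}} :
    (link K v).Adj u w ↔ u ≠ w ∧ ({v, u.1, w.1} : Finset V) ∈ K.faces := by
  refine and_congr_right fun _ => ⟨?_, fun h => ⟨_, h, by simp⟩⟩
  rintro ⟨s, hs, h⟩
  convert hs using 1
  ext z; simp [h]

theorem skeleton_adj_of_mem {s : Finset V} (hs : s ∈ K.faces) {u v : V} (hu : u ∈ s) (hv : v ∈ s)
    (h : u ≠ v) : (skeleton K).Adj u v :=
  skeleton_adj_iff.2 ⟨h, face_mono hs (by simp [Finset.insert_subset_iff, hu, hv]) (by simp)⟩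

/-- A vertex of a link has two neighbours, hence at least one. This makes the complexes built from
stars two-dimensional, as patches must be. -/
theorem IsSurface.exists_triangle (hK : IsSurface K) {v u : V} (h : (skeleton K).Adj v u) :
    ∃ w, u ≠ w ∧ v ≠ w ∧ ({v, u, w} : Finset V) ∈ K.faces := by
  have h2 := (hK v).2.2 ⟨u, h⟩
  obtain ⟨w, hw⟩ : ((link K v).neighborSet ⟨u, h⟩).Nonempty := by
    apply Set.nonempty_of_ncard_ne_zero; omega
  have hw' := link_adj_iff.1 hw
  exact ⟨w.1, fun h => hw'.1 (Subtype.ext h), w.2.1, hw'.2⟩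

theorem IsSurface.exists_adj (hK : IsSurface K) (v : V) : ∃ u, (skeleton K).Adj v u := by
  obtain ⟨u⟩ := (hK v).2.1.nonempty
  exact ⟨u.1, u.2⟩

end Faces

/-! ### Embeddings of stars of balls -/

/-- The vertex map `g` embeds the union of the closed stars of the vertices at distance at most `ρ`
from `c`. -/
structure IsStarEmb {V W : Type*} [DecidableEq W] (K : AbstractSimplicialComplex V)
    (L : AbstractSimplicialComplex W) (c : V) (ρ : ℕ) (g : V → W) : Prop where
  injOn : Set.InjOn g (vball (skeleton K) c (ρ + 1))
  map_faces : ∀ s ∈ K.faces, ∀ v ∈ s, v ∈ vball (skeleton K) c ρ → s.image g ∈ L.faces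

section StarEmb

variable {V W : Type*} [DecidableEq V] [DecidableEq W] {K : AbstractSimplicialComplex V}
  {L : AbstractSimplicialComplex W} {c : V} {ρ : ℕ} {g : V → W}

theorem face_subset_vball {s : Finset V} (hs : s ∈ K.faces) {v : V} (hv : v ∈ s) {n : ℕ}
    (h : v ∈ vball (skeleton K) c n) : (s : Set V) ⊆ vball (skeleton K) c (n + 1) := by
  intro u hu
  by_cases huv : v = u
  · exact huv ▸ vball_mono _ (Nat.le_succ n) h
  · exact mem_vball_of_adj h (skeleton_adj_of_mem hs hv hu huv)

theorem IsStarEmb.mono (h : IsStarEmb K L c ρ g) {ρ' : ℕ} (hρ : ρ' ≤ ρ) :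
    IsStarEmb K L c ρ' g where
  injOn := h.injOn.mono (vball_mono _ (by omega))
  map_faces s hs v hv hvc := h.map_faces s hs v hv (vball_mono _ hρ hvc)

theorem IsStarEmb.recenter (h : IsStarEmb K L c ρ g) {v : V} {j k : ℕ}
    (hv : v ∈ vball (skeleton K) c k) (hkj : k + j ≤ ρ) : IsStarEmb K L v j g where
  injOn := h.injOn.mono fun _ hu => vball_mono _ (by omega) (mem_vball_trans hv hu)
  map_faces s hs u hu huc := h.map_faces s hs u hu (vball_mono _ hkj (mem_vball_trans hv huc))

theorem IsStarEmb.map_adj (h : IsStarEmb K L c ρ g) {v u : V} (hv : v ∈ vball (skeleton K) c ρ)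
    (hvu : (skeleton K).Adj v u) : (skeleton L).Adj (g v) (g u) := by
  have h1 := skeleton_adj_iff.1 hvu
  refine skeleton_adj_iff.2 ⟨fun he => h1.1 (h.injOn (vball_mono _ (Nat.le_succ ρ) hv)
    (mem_vball_of_adj hv hvu) he), ?_⟩
  have := h.map_faces _ h1.2 v (by simp) hv
  simpa [Finset.image_insert] using this

/-- The map of links induced by a star embedding. -/
def IsStarEmb.linkMap (h : IsStarEmb K L c ρ g) {v : V} (hv : v ∈ vball (skeleton K) c ρ)
    (u : {u : V // (skeleton K).Adj v u}) : {u : W // (skeleton L).Adj (g v) u} :=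
  ⟨g u.1, h.map_adj hv u.2⟩

theorem IsStarEmb.linkMap_injective (h : IsStarEmb K L c ρ g) {v : V}
    (hv : v ∈ vball (skeleton K) c ρ) : Function.Injective (h.linkMap hv) := fun u w he =>
  Subtype.ext (h.injOn (mem_vball_of_adj hv u.2) (mem_vball_of_adj hv w.2) (congrArg Subtype.val he))

theorem IsStarEmb.linkMap_adj (h : IsStarEmb K L c ρ g) {v : V}
    (hv : v ∈ vball (skeleton K) c ρ) {u w : {u : V // (skeleton K).Adj v u}}
    (huw : (link K v).Adj u w) : (link L (g v)).Adj (h.linkMap hv u) (h.linkMap hv w) := by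
  have h1 := link_adj_iff.1 huw
  refine link_adj_iff.2 ⟨fun he => h1.1 (h.linkMap_injective hv he), ?_⟩
  have := h.map_faces _ h1.2 v (by simp) hv
  simpa [Finset.image_insert, linkMap] using this

/-- Both links are 2-regular, so injectivity alone forces the two neighbours of `u` onto the two
neighbours of its image. -/
theorem IsStarEmb.linkMap_neighborSet (hK : IsSurface K) (hL : IsSurface L)
    (h : IsStarEmb K L c ρ g) {v : V} (hv : v ∈ vball (skeleton K) c ρ)
    (u : {u : V // (skeleton K).Adj v u}) :
    h.linkMap hv '' (link K v).neighborSet u = (link L (g v)).neighborSet (h.linkMap hv u) := by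
  have h2 := (hL (g v)).2.2 (h.linkMap hv u)
  refine Set.eq_of_subset_of_ncard_le ?_ ?_ (Set.finite_of_ncard_ne_zero (by omega))
  · rintro _ ⟨w, hw, rfl⟩
    exact h.linkMap_adj hv hw
  · rw [h2, Set.ncard_image_of_injective _ (h.linkMap_injective hv), (hK v).2.2 u]

/-- The range is closed under adjacency by `linkMap_neighborSet`, and the target link is connected.
The absence of a boundary enters here: an injective simplicial map of a closed star into a surface
fills the closed star of the image vertex. -/
theorem IsStarEmb.linkMap_surjective (hK : IsSurface K) (hL : IsSurface L)
    (h : IsStarEmb K L c ρ g) {v : V} (hv : v ∈ vball (skeleton K) c ρ) :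
    Function.Surjective (h.linkMap hv) := by
  obtain ⟨u₀⟩ := (hK v).2.1.nonempty
  intro w
  obtain ⟨p⟩ := (hL (g v)).2.1.preconnected w (h.linkMap hv u₀)
  have key : ∀ {a b} (p : (link L (g v)).Walk a b), b ∈ Set.range (h.linkMap hv) →
      a ∈ Set.range (h.linkMap hv) := by
    intro a b p
    induction p with
    | nil => exact id
    | cons hadj _ ih =>
      intro hb
      obtain ⟨u, rfl⟩ := ih hb
      have : _ ∈ (link L (g v)).neighborSet (h.linkMap hv u) := hadj.symm
      rw [← h.linkMap_neighborSet hK hL hv u] at this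
      obtain ⟨w, _, rfl⟩ := this
      exact ⟨w, rfl⟩
  exact key p ⟨u₀, rfl⟩

theorem IsStarEmb.exists_adj_lift (hK : IsSurface K) (hL : IsSurface L)
    (h : IsStarEmb K L c ρ g) {v : V} (hv : v ∈ vball (skeleton K) c ρ) {w : W}
    (hw : (skeleton L).Adj (g v) w) : ∃ u, (skeleton K).Adj v u ∧ g u = w := by
  obtain ⟨u, hu⟩ := h.linkMap_surjective hK hL hv ⟨w, hw⟩
  exact ⟨u.1, u.2, congrArg Subtype.val hu⟩

/-- Besides `{g v}`, the faces at `g v` correspond to the vertices and edges of its link. The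
vertices lift by surjectivity of the link map, the edges by the equality of neighbour sets. -/
theorem IsStarEmb.exists_face_lift (hK : IsSurface K) (hL : IsSurface L)
    (hL2 : ∀ s ∈ L.faces, s.card ≤ 3)
    (h : IsStarEmb K L c ρ g) {v : V} (hv : v ∈ vball (skeleton K) c ρ) {t : Finset W}
    (ht : t ∈ L.faces) (hvt : g v ∈ t) : ∃ s ∈ K.faces, v ∈ s ∧ s.image g = t := by
  have hcard := hL2 t ht
  have hc : (t.erase (g v)).card = t.card - 1 := Finset.card_erase_of_mem hvt
  have hins : insert (g v) (t.erase (g v)) = t := Finset.insert_erase hvt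
  have hadj : ∀ w ∈ t.erase (g v), (skeleton L).Adj (g v) w := fun w hw =>
    skeleton_adj_of_mem ht hvt (Finset.mem_of_mem_erase hw) (Finset.ne_of_mem_erase hw).symm
  obtain h0 | h1 | h2 : (t.erase (g v)).card = 0 ∨ (t.erase (g v)).card = 1 ∨
      (t.erase (g v)).card = 2 := by omega
  · rw [Finset.card_eq_zero] at h0
    refine ⟨{v}, K.singleton_mem v, by simp, ?_⟩
    rw [← hins, h0]; simp
  · obtain ⟨w, hw⟩ := Finset.card_eq_one.1 h1
    obtain ⟨u, hu, rfl⟩ := h.exists_adj_lift hK hL hv (hadj w (by simp [hw]))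
    refine ⟨{v, u}, (skeleton_adj_iff.1 hu).2, by simp, ?_⟩
    rw [← hins, hw]; simp [Finset.image_insert]
  · obtain ⟨w, w', hne, hw⟩ := Finset.card_eq_two.1 h2
    obtain ⟨u, hu⟩ := h.linkMap_surjective hK hL hv ⟨w, hadj w (by simp [hw])⟩
    have hl : (link L (g v)).Adj (h.linkMap hv u) ⟨w', hadj w' (by simp [hw])⟩ := by
      rw [hu]
      refine link_adj_iff.2 ⟨fun he => hne (congrArg Subtype.val he), ?_⟩
      rw [← hins, hw] at ht
      exact ht
    have : _ ∈ (link L (g v)).neighborSet (h.linkMap hv u) := hl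
    rw [← h.linkMap_neighborSet hK hL hv u] at this
    obtain ⟨u', huu', hu'⟩ := this
    refine ⟨{v, u.1, u'.1}, (link_adj_iff.1 huu').2, by simp, ?_⟩
    have e1 : g u.1 = w := congrArg Subtype.val hu
    have e2 : g u'.1 = w' := congrArg Subtype.val hu'
    rw [← hins, hw]; simp [Finset.image_insert, e1, e2]

/-- Every edge of `L` leaving the image of a vertex within distance `ρ` of the centre lifts, so no
path of `L` offers a short cut. -/
theorem IsStarEmb.image_vball (hK : IsSurface K) (hL : IsSurface L)
    (h : IsStarEmb K L c ρ g) {j : ℕ} (hj : j ≤ ρ + 1) :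
    g '' vball (skeleton K) c j = vball (skeleton L) (g c) j := by
  induction j with
  | zero => ext w; simp [mem_vball_zero, eq_comm]
  | succ j ih =>
    have ih := ih (by omega)
    ext w
    constructor
    · rintro ⟨u, hu, rfl⟩
      obtain ⟨v, hv, hvu⟩ := mem_vball_succ.1 hu
      refine mem_vball_succ.2 ⟨g v, ih ▸ ⟨v, hv, rfl⟩, ?_⟩
      rcases hvu with rfl | hvu
      · exact Or.inl rfl
      · exact Or.inr (h.map_adj (vball_mono _ (by omega) hv) hvu)
    · intro hw
      obtain ⟨w', hw', hadj⟩ := mem_vball_succ.1 hw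
      rw [← ih] at hw'
      obtain ⟨v, hv, rfl⟩ := hw'
      rcases hadj with rfl | hadj
      · exact ⟨v, vball_mono _ (Nat.le_succ j) hv, rfl⟩
      · obtain ⟨u, hu, rfl⟩ := h.exists_adj_lift hK hL (vball_mono _ (by omega) hv) hadj
        exact ⟨u, mem_vball_of_adj hv hu, rfl⟩

/-- After recentring at `v`, the ball around `g v` is the image of the ball around `v`; injectivity
on the large ball identifies the lift of `g u` with `u` itself. -/
theorem IsStarEmb.mem_vball_iff (hK : IsSurface K) (hL : IsSurface L)
    (h : IsStarEmb K L c ρ g) {j k : ℕ} {v u : V} (hv : v ∈ vball (skeleton K) c k)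
    (hkj : k + j ≤ ρ) (hu : u ∈ vball (skeleton K) c (ρ + 1)) :
    g u ∈ vball (skeleton L) (g v) j ↔ u ∈ vball (skeleton K) v j := by
  rw [← (h.recenter hv hkj).image_vball hK hL (Nat.le_succ j)]
  refine ⟨?_, fun hu' => ⟨u, hu', rfl⟩⟩
  rintro ⟨u', hu', he⟩
  rwa [← h.injOn (vball_mono _ (by omega) (mem_vball_trans hv hu')) hu he]

theorem isStarEmb_id : IsStarEmb K K c ρ id :=
  ⟨Set.injOn_id _, fun s hs _ _ _ => by simpa using hs⟩

theorem IsStarEmb.comp {X : Type*} [DecidableEq X] {M : AbstractSimplicialComplex X} {g' : W → X}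
    (hK : IsSurface K) (hL : IsSurface L) (h' : IsStarEmb L M (g c) ρ g')
    (h : IsStarEmb K L c ρ g) : IsStarEmb K M c ρ (g' ∘ g) where
  injOn := h'.injOn.comp h.injOn fun u hu => by
    rw [← h.image_vball hK hL le_rfl]; exact ⟨u, hu, rfl⟩
  map_faces s hs v hv hvc := by
    rw [← Finset.image_image]
    refine h'.map_faces _ (h.map_faces s hs v hv hvc) (g v) (Finset.mem_image_of_mem _ hv) ?_
    rw [← h.image_vball hK hL (Nat.le_succ ρ)]; exact ⟨v, hvc, rfl⟩

/-- Faces at image vertices lift, so the inverse vertex map is again simplicial on stars. This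
yields the symmetry of local isomorphism. -/
theorem IsStarEmb.inverse [Nonempty V] (hK : IsSurface K) (hL : IsSurface L)
    (hL2 : ∀ s ∈ L.faces, s.card ≤ 3) (h : IsStarEmb K L c ρ g) :
    IsStarEmb L K (g c) ρ (Function.invFunOn g (vball (skeleton K) c (ρ + 1))) where
  injOn := by
    rw [← h.image_vball hK hL le_rfl]
    exact Function.invFunOn_injOn_image g _
  map_faces t ht w hw hwc := by
    rw [← h.image_vball hK hL (Nat.le_succ ρ)] at hwc
    obtain ⟨v, hv, rfl⟩ := hwc
    obtain ⟨s, hs, hvs, rfl⟩ := h.exists_face_lift hK hL hL2 hv ht hw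
    rw [Finset.image_image]
    convert hs
    rw [Finset.image_congr (g := id), Finset.image_id]
    intro u hu
    exact h.injOn.leftInvOn_invFunOn (face_subset_vball hs hvs hv hu)

end StarEmb

/-! ### Local isomorphisms of decorated triangulations -/

section LocalIso

variable {d : ℕ} {𝒟 : Type*} {T U : DecoratedTriangulation d 𝒟}

instance (T : DecoratedTriangulation d 𝒟) : Nonempty T.verts := T.connected.nonempty

theorem ext_tangentVector {V : Type*} {K : AbstractSimplicialComplex V} {a b : TangentVector K}
    (h1 : a.fst = b.fst) (h2 : a.snd = b.snd) : a = b :=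
  SimpleGraph.Dart.ext _ _ (Prod.ext h1 h2)

/-- The map `g` embeds the stars of the ball of radius `ρ` around `x`, takes `x` to `y` and
preserves the decorations of that ball. -/
structure IsLocalIso (x : T.S) (y : U.S) (ρ : ℕ) (g : T.verts → U.verts) : Prop
    extends IsStarEmb T.K U.K x.fst ρ g where
  map_fst : g x.fst = y.fst
  map_snd : g x.snd = y.snd
  dec_eq : ∀ (a : T.S) (b : U.S), a.fst ∈ vball (skeleton T.K) x.fst ρ →
    a.snd ∈ vball (skeleton T.K) x.fst ρ → b.fst = g a.fst → b.snd = g a.snd → U.dec b = T.dec a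

variable {x : T.S} {y : U.S} {ρ : ℕ} {g : T.verts → U.verts}

theorem IsLocalIso.mono (h : IsLocalIso x y ρ g) {ρ' : ℕ} (hρ : ρ' ≤ ρ) :
    IsLocalIso x y ρ' g where
  toIsStarEmb := h.toIsStarEmb.mono hρ
  map_fst := h.map_fst
  map_snd := h.map_snd
  dec_eq a b h1 h2 := h.dec_eq a b (vball_mono _ hρ h1) (vball_mono _ hρ h2)

theorem IsLocalIso.symm (h : IsLocalIso x y ρ g) :
    IsLocalIso y x ρ (Function.invFunOn g (vball (skeleton T.K) x.fst (ρ + 1))) := by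
  have hl := h.injOn.leftInvOn_invFunOn
  have hsnd : x.snd ∈ vball (skeleton T.K) x.fst (ρ + 1) :=
    vball_mono _ (by omega) (mem_vball_one_of_adj x.adj)
  refine { toIsStarEmb := ?_, map_fst := ?_, map_snd := ?_, dec_eq := ?_ }
  · have := h.toIsStarEmb.inverse T.surface U.surface U.dim_two.1
    rwa [h.map_fst] at this
  · rw [← h.map_fst]; exact hl (mem_vball_self _ _)
  · rw [← h.map_snd]; exact hl hsnd
  · intro a b ha1 ha2 hb1 hb2
    rw [← h.map_fst, ← h.image_vball T.surface U.surface (Nat.le_succ ρ)] at ha1 ha2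
    obtain ⟨v1, hv1, e1⟩ := ha1
    obtain ⟨v2, hv2, e2⟩ := ha2
    rw [← e1, hl (vball_mono _ (Nat.le_succ ρ) hv1)] at hb1
    rw [← e2, hl (vball_mono _ (Nat.le_succ ρ) hv2)] at hb2
    exact (h.dec_eq b a (hb1 ▸ hv1) (hb2 ▸ hv2) (by rw [hb1, e1]) (by rw [hb2, e2])).symm

theorem finite_vball (T : DecoratedTriangulation d 𝒟) (v : T.verts) (n : ℕ) :
    (vball (skeleton T.K) v n).Finite :=
  Set.finite_of_encard_le_coe (encard_vball_le T.degree_le v n)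

theorem mem_ball_iff {w a : T.S} {r : ℕ} :
    a ∈ ball w r ↔ a.fst ∈ vball (skeleton T.K) w.fst r ∧ a.snd ∈ vball (skeleton T.K) w.snd r :=
  Iff.rfl

theorem IsLocalIso.mem_ball_iff (h : IsLocalIso x y ρ g) {k r : ℕ} (hk : k + r ≤ ρ)
    {w a : T.S} {w' b : U.S} (hw1 : w.fst ∈ vball (skeleton T.K) x.fst k)
    (hw2 : w.snd ∈ vball (skeleton T.K) x.fst k) (hw1' : w'.fst = g w.fst)
    (hw2' : w'.snd = g w.snd) (ha1 : a.fst ∈ vball (skeleton T.K) x.fst (ρ + 1))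
    (ha2 : a.snd ∈ vball (skeleton T.K) x.fst (ρ + 1)) (hb1 : b.fst = g a.fst)
    (hb2 : b.snd = g a.snd) : b ∈ ball w' r ↔ a ∈ ball w r := by
  rw [TriangulationSpace.mem_ball_iff, TriangulationSpace.mem_ball_iff, hw1', hw2', hb1, hb2,
    h.mem_vball_iff T.surface U.surface hw1 hk ha1, h.mem_vball_iff T.surface U.surface hw2 hk ha2]

theorem IsLocalIso.exists_map (h : IsLocalIso x y ρ g) {a : T.S}
    (ha : a.fst ∈ vball (skeleton T.K) x.fst ρ) : ∃ b : U.S, b.fst = g a.fst ∧ b.snd = g a.snd :=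
  ⟨⟨(g a.fst, g a.snd), h.map_adj ha a.adj⟩, rfl, rfl⟩

theorem IsLocalIso.exists_lift (h : IsLocalIso x y ρ g) {k r : ℕ} (hk : k + r ≤ ρ)
    {w : T.S} {w' b : U.S} (hw1 : w.fst ∈ vball (skeleton T.K) x.fst k)
    (hw2 : w.snd ∈ vball (skeleton T.K) x.fst k) (hw1' : w'.fst = g w.fst)
    (hw2' : w'.snd = g w.snd) (hb : b ∈ ball w' r) :
    ∃ a ∈ ball w r, b.fst = g a.fst ∧ b.snd = g a.snd := by
  have hb1 : b.fst ∈ vball (skeleton U.K) (g w.fst) r := hw1' ▸ hb.1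
  rw [← (h.recenter hw1 hk).image_vball T.surface U.surface (Nat.le_succ r)] at hb1
  obtain ⟨a1, ha1, e1⟩ := hb1
  have ha1x : a1 ∈ vball (skeleton T.K) x.fst ρ := vball_mono _ hk (mem_vball_trans hw1 ha1)
  obtain ⟨a2, ha12, e2⟩ := h.exists_adj_lift T.surface U.surface ha1x (w := b.snd)
    (by rw [e1]; exact b.adj)
  refine ⟨⟨(a1, a2), ha12⟩, ?_, e1.symm, e2.symm⟩
  exact (h.mem_ball_iff hk (w := w) (w' := w') (a := ⟨(a1, a2), ha12⟩) hw1 hw2 hw1' hw2'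
    (vball_mono _ (Nat.le_succ ρ) ha1x) (mem_vball_of_adj ha1x ha12) e1.symm e2.symm).1 hb

theorem ball_subset_vball {c : T.verts} {k r : ℕ} {w : T.S}
    (hw1 : w.fst ∈ vball (skeleton T.K) c k) (hw2 : w.snd ∈ vball (skeleton T.K) c k) {a : T.S}
    (ha : a ∈ ball w r) :
    a.fst ∈ vball (skeleton T.K) c (k + r) ∧ a.snd ∈ vball (skeleton T.K) c (k + r) :=
  ⟨mem_vball_trans hw1 ha.1, mem_vball_trans hw2 ha.2⟩

/-- The hopping hypothesis compares full subcomplexes, whereas a local isomorphism only sends faces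
forward. For the converse, a face `s.image g` lifts to a face at a vertex of `s`, and injectivity
shows that the lift is `s`. -/
theorem IsLocalIso.isBallIso (h : IsLocalIso x y ρ g) {k r : ℕ} (hk : k + r ≤ ρ)
    {w : T.S} {w' : U.S} (hw1 : w.fst ∈ vball (skeleton T.K) x.fst k)
    (hw2 : w.snd ∈ vball (skeleton T.K) x.fst k) (hw1' : w'.fst = g w.fst)
    (hw2' : w'.snd = g w.snd) : IsBallIso w w' r g := by
  have hsub : ballVerts w r ⊆ vball (skeleton T.K) x.fst ρ := by
    rintro v ⟨a, ha, rfl | rfl⟩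
    · exact vball_mono _ hk (ball_subset_vball hw1 hw2 ha).1
    · exact vball_mono _ hk (ball_subset_vball hw1 hw2 ha).2
  have hsub' := hsub.trans (vball_mono _ (Nat.le_succ ρ))
  refine ⟨⟨?_, h.injOn.mono hsub', ?_⟩, ?_, hw1'.symm, hw2'.symm, ?_⟩
  · rintro v ⟨a, ha, hv⟩
    have hav := ball_subset_vball hw1 hw2 ha
    obtain ⟨b, hb1, hb2⟩ := h.exists_map (vball_mono _ hk hav.1)
    refine ⟨b, (h.mem_ball_iff hk hw1 hw2 hw1' hw2' (vball_mono _ (by omega) hav.1)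
      (vball_mono _ (by omega) hav.2) hb1 hb2).2 ha, ?_⟩
    rcases hv with rfl | rfl
    · exact Or.inl hb1.symm
    · exact Or.inr hb2.symm
  · rintro v ⟨b, hb, hv⟩
    obtain ⟨a, ha, h1, h2⟩ := h.exists_lift hk hw1 hw2 hw1' hw2' hb
    rcases hv with rfl | rfl
    · exact ⟨a.fst, ⟨a, ha, Or.inl rfl⟩, h1.symm⟩
    · exact ⟨a.snd, ⟨a, ha, Or.inr rfl⟩, h2.symm⟩
  · intro s hs
    constructor
    · intro hsf
      obtain ⟨v, hv⟩ : s.Nonempty := Finset.image_nonempty.1 (face_nonempty hsf)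
      obtain ⟨s', hs', hvs', he⟩ := h.exists_face_lift T.surface U.surface U.dim_two.1
        (hsub (hs hv)) hsf (Finset.mem_image_of_mem g hv)
      have hs'v := face_subset_vball hs' hvs' (hsub (hs hv))
      have : s' = s := by
        ext u
        constructor
        · intro hu
          obtain ⟨u', hu', e⟩ := Finset.mem_image.1 (he ▸ Finset.mem_image_of_mem g hu)
          rwa [← h.injOn (hsub' (hs hu')) (hs'v hu) e]
        · intro hu
          obtain ⟨u', hu', e⟩ := Finset.mem_image.1 (he.symm ▸ Finset.mem_image_of_mem g hu)
          rwa [← h.injOn (hs'v hu') (hsub' (hs hu)) e]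
      exact this ▸ hs'
    · intro hsf
      obtain ⟨v, hv⟩ := face_nonempty hsf
      exact h.map_faces s hsf v hv (hsub (hs hv))
  · exact fun _ _ ha1 ha2 => h.dec_eq _ _ (hsub ha1) (hsub ha2)

end LocalIso

/-! ### Cylinders -/

section Cylinders

variable {V W X : Type*} {K : AbstractSimplicialComplex V} {L : AbstractSimplicialComplex W}
  {M : AbstractSimplicialComplex X}

/-- The composition of simplicial embeddings. -/
def SimplicialEmbedding.comp (f : SimplicialEmbedding L M) (g : SimplicialEmbedding K L) :
    SimplicialEmbedding K M where
  toEmb := g.toEmb.trans f.toEmb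
  map_faces s hs := by
    rw [← Finset.map_map]; exact f.map_faces _ (g.map_faces _ hs)

theorem SimplicialEmbedding.mapS_injective (g : SimplicialEmbedding K L) :
    Function.Injective g.mapS := fun _ _ h =>
  ext_tangentVector (g.toEmb.injective (congrArg (fun c => c.fst) h))
    (g.toEmb.injective (congrArg (fun c => c.snd) h))

theorem SimplicialEmbedding.ext_toEmb {f g : SimplicialEmbedding K L}
    (h : ∀ v, f.toEmb v = g.toEmb v) : f = g := by
  cases f; cases g
  congr
  exact Function.Embedding.ext h

instance [Finite V] [Countable W] : Countable (SimplicialEmbedding K L) :=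
  Function.Injective.countable (f := fun (g : SimplicialEmbedding K L) (v : V) => g.toEmb v)
    fun _ _ h => SimplicialEmbedding.ext_toEmb fun v => congrFun h v

instance [Countable V] : Countable (TangentVector K) :=
  Function.Injective.countable (f := fun a : TangentVector K => a.toProd)
    fun _ _ h => SimpleGraph.Dart.ext _ _ h

instance [Finite V] : Finite (TangentVector K) :=
  Finite.of_injective (fun a : TangentVector K => a.toProd)
    fun _ _ h => SimpleGraph.Dart.ext _ _ h

instance [Finite V] : Finite (AbstractSimplicialComplex V) :=
  Finite.of_injective (fun K : AbstractSimplicialComplex V => K.faces) (by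
    rintro ⟨⟨f, hf⟩, h⟩ ⟨⟨f', hf'⟩, h'⟩ he
    change f = f' at he
    subst he; rfl)

variable {d : ℕ} {𝒟 : Type*} [MeasurableSpace 𝒟]

theorem UnitSpace.mk_mem_cylinder {P : Patch 𝒟} {T : DecoratedTriangulation d 𝒟} {x : T.S} :
    UnitSpace.mk T x ∈ P.cylinder d ↔ ∃ g : SimplicialEmbedding P.A T.K, g.mapS P.base = x ∧
      (fun a => T.dec (g.mapS a)) ∈ P.Ω := by
  constructor
  · rintro ⟨U, y, he, g, hg, hΩ⟩
    obtain ⟨e, he'⟩ := Quotient.exact (s := markedSetoid d 𝒟) he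
    change Iso T U at e
    change e.equivS x = y at he'
    refine ⟨e.inv.comp g, ?_, ?_⟩
    · change e.inv.mapS (g.mapS P.base) = x
      rw [hg, ← he']
      exact e.mapS_inv_hom x
    · have : ∀ a, T.dec (e.inv.mapS (g.mapS a)) = U.dec (g.mapS a) := fun a => by
        rw [← e.dec_hom, e.mapS_hom_inv]
      change (fun a => T.dec (e.inv.mapS (g.mapS a))) ∈ P.Ω
      simpa only [this] using hΩ
  · rintro ⟨g, hg, hΩ⟩
    exact ⟨T, x, rfl, g, hg, hΩ⟩

theorem Groupoid.mk_mem_cylinder {P : TwiceMarkedPatch 𝒟} {T : DecoratedTriangulation d 𝒟}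
    {x y : T.S} :
    Groupoid.mk T x y ∈ P.cylinder d ↔ ∃ g : SimplicialEmbedding P.A T.K, g.mapS P.base = x ∧
      g.mapS P.base' = y ∧ (fun a => T.dec (g.mapS a)) ∈ P.Ω := by
  constructor
  · rintro ⟨U, x', y', he, g, hg, hg', hΩ⟩
    obtain ⟨e, he', he''⟩ := Quotient.exact (s := twiceMarkedSetoid d 𝒟) he
    change Iso T U at e
    change e.equivS x = x' at he'
    change e.equivS y = y' at he''
    refine ⟨e.inv.comp g, ?_, ?_, ?_⟩
    · change e.inv.mapS (g.mapS P.base) = x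
      rw [hg, ← he']
      exact e.mapS_inv_hom x
    · change e.inv.mapS (g.mapS P.base') = y
      rw [hg', ← he'']
      exact e.mapS_inv_hom y
    · have : ∀ a, T.dec (e.inv.mapS (g.mapS a)) = U.dec (g.mapS a) := fun a => by
        rw [← e.dec_hom, e.mapS_hom_inv]
      change (fun a => T.dec (e.inv.mapS (g.mapS a))) ∈ P.Ω
      simpa only [this] using hΩ
  · rintro ⟨g, hg, hg', hΩ⟩
    exact ⟨T, x, y, rfl, g, hg, hg', hΩ⟩

theorem UnitSpace.exists_mk (u : UnitSpace d 𝒟) : ∃ T x, u = UnitSpace.mk T x := by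
  induction u using Quotient.inductionOn with | h p => exact ⟨p.1, p.2, rfl⟩

theorem Groupoid.exists_mk (u : Groupoid d 𝒟) : ∃ T x y, u = Groupoid.mk T x y := by
  induction u using Quotient.inductionOn with | h p => exact ⟨p.1, p.2.1, p.2.2, rfl⟩

theorem measurableSet_cylinder (P : Patch 𝒟) : MeasurableSet (P.cylinder d) :=
  MeasurableSpace.measurableSet_generateFrom ⟨P, rfl⟩

theorem measurableSet_twiceMarkedCylinder (P : TwiceMarkedPatch 𝒟) :
    MeasurableSet (P.cylinder d) :=
  MeasurableSpace.measurableSet_generateFrom ⟨P, rfl⟩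

/-- The triangulation `T` with another decoration. -/
def DecoratedTriangulation.withDec (T : DecoratedTriangulation d 𝒟) (ω : T.S → 𝒟) :
    DecoratedTriangulation d 𝒟 := { T with dec := ω }

/-- For a fixed complex there are only countably many embeddings of a finite patch, and each imposes
a Borel condition on `ω`. -/
theorem measurable_groupoid_mk_withDec (T : DecoratedTriangulation d 𝒟) (x y : T.S) :
    Measurable fun ω : T.S → 𝒟 => Groupoid.mk (T.withDec ω) x y := by
  refine measurable_generateFrom ?_
  rintro _ ⟨P, rfl⟩
  have : (fun ω : T.S → 𝒟 => Groupoid.mk (T.withDec ω) x y) ⁻¹' P.cylinder d =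
      ⋃ (g : SimplicialEmbedding P.A T.K) (_ : g.mapS P.base = x) (_ : g.mapS P.base' = y),
        (fun (ω : T.S → 𝒟) a => ω (g.mapS a)) ⁻¹' P.Ω := by
    ext ω
    simp only [Set.mem_preimage, Set.mem_iUnion, exists_prop]
    exact Groupoid.mk_mem_cylinder
  rw [this]
  refine MeasurableSet.iUnion fun g => MeasurableSet.iUnion fun _ => MeasurableSet.iUnion fun _ => ?_
  exact measurableSet_preimage (by fun_prop) P.measurable_Ω

end Cylinders

/-! ### The patch formed by the stars of a ball -/

section StarComplex

variable {V : Type*} [DecidableEq V] {K : AbstractSimplicialComplex V} {c : V} {ρ n : ℕ}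

/-- The subcomplex formed by the closed stars of the vertices at distance at most `ρ` from `c`, with
vertices numbered by `e`. -/
def starComplex (K : AbstractSimplicialComplex V) (c : V) (ρ : ℕ) {n : ℕ}
    (e : Fin n ≃ vball (skeleton K) c (ρ + 1)) : AbstractSimplicialComplex (Fin n) where
  faces := {s | s.Nonempty ∧ ∃ t ∈ K.faces, (∃ v ∈ t, v ∈ vball (skeleton K) c ρ) ∧
    ∀ i ∈ s, (e i).1 ∈ t}
  isRelLowerSet_faces := fun _ hs => ⟨hs.1, fun _ hts ht =>
    ⟨ht, hs.2.imp fun _ h => ⟨h.1, h.2.1, fun i hi => h.2.2 i (hts hi)⟩⟩⟩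
  singleton_mem i := by
    refine ⟨by simp, ?_⟩
    obtain ⟨w, hw, h | h⟩ := mem_vball_succ.1 (e i).2
    · exact ⟨{w}, K.singleton_mem w, ⟨w, by simp, hw⟩, by simp [h]⟩
    · exact ⟨_, (skeleton_adj_iff.1 h).2, ⟨w, by simp, hw⟩, by simp⟩

variable {e : Fin n ≃ vball (skeleton K) c (ρ + 1)}

/-- The inclusion of the star complex. -/
def starIncl (K : AbstractSimplicialComplex V) (c : V) (ρ : ℕ) {n : ℕ}
    (e : Fin n ≃ vball (skeleton K) c (ρ + 1)) : SimplicialEmbedding (starComplex K c ρ e) K where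
  toEmb := e.toEmbedding.trans (Function.Embedding.subtype _)
  map_faces s hs := by
    obtain ⟨hne, t, ht, _, h⟩ := hs
    refine face_mono ht ?_ (by simpa using hne)
    intro v hv
    obtain ⟨i, hi, rfl⟩ := Finset.mem_map.1 hv
    exact h i hi

theorem starIncl_apply (i : Fin n) : (starIncl K c ρ e).toEmb i = (e i).1 := rfl

theorem starComplex_adj {i j : Fin n} (hi : (e i).1 ∈ vball (skeleton K) c ρ)
    (h : (skeleton K).Adj (e i).1 (e j).1) : (skeleton (starComplex K c ρ e)).Adj i j := by
  refine skeleton_adj_iff.2 ⟨fun hij => h.1 (hij ▸ rfl), by simp, _, (skeleton_adj_iff.1 h).2,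
    ⟨(e i).1, by simp, hi⟩, by simp⟩

theorem starComplex_connected : (skeleton (starComplex K c ρ e)).Connected := by
  set i₀ : Fin n := e.symm ⟨c, mem_vball_self _ _⟩ with hi₀
  have key : ∀ j ≤ ρ + 1, ∀ i : Fin n, (e i).1 ∈ vball (skeleton K) c j →
      (skeleton (starComplex K c ρ e)).Reachable i₀ i := by
    intro j
    induction j with
    | zero =>
      intro _ i hi
      have : i = i₀ := by
        rw [hi₀, Equiv.eq_symm_apply]; exact Subtype.ext (mem_vball_zero.1 hi)
      rw [this]
    | succ j ih =>
      intro hj i hi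
      obtain ⟨w, hw, h⟩ := mem_vball_succ.1 hi
      have hw' : w ∈ vball (skeleton K) c (ρ + 1) := vball_mono _ (by omega) hw
      have hr := ih (by omega) (e.symm ⟨w, hw'⟩) (by simpa using hw)
      rcases h with h | h
      · have : e.symm ⟨w, hw'⟩ = i := by rw [Equiv.symm_apply_eq]; exact Subtype.ext h
        rwa [this] at hr
      · refine hr.trans (SimpleGraph.Adj.reachable (starComplex_adj ?_ ?_))
        · simpa using vball_mono _ (by omega) hw
        · simpa using h
  have : Nonempty (Fin n) := ⟨i₀⟩
  exact ⟨fun i j => (key _ le_rfl i (e i).2).symm.trans (key _ le_rfl j (e j).2)⟩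

theorem starComplex_twoDimensional (hK : IsSurface K) (h2 : IsTwoDimensional K) :
    IsTwoDimensional (starComplex K c ρ e) := by
  constructor
  · intro s hs
    have := h2.1 _ ((starIncl K c ρ e).map_faces s hs)
    rwa [Finset.card_map] at this
  · obtain ⟨u, hu⟩ := hK.exists_adj c
    obtain ⟨w, huw, hcw, hf⟩ := hK.exists_triangle hu
    have hm : ∀ z ∈ ({c, u, w} : Finset V), z ∈ vball (skeleton K) c (ρ + 1) := fun z hz =>
      face_subset_vball hf (v := c) (by simp) (mem_vball_self c ρ) hz
    refine ⟨{e.symm ⟨c, hm c (by simp)⟩, e.symm ⟨u, hm u (by simp)⟩, e.symm ⟨w, hm w (by simp)⟩},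
      ⟨by simp, {c, u, w}, hf, ⟨c, by simp, mem_vball_self _ _⟩, by simp⟩, ?_⟩
    rw [Finset.card_eq_three]
    refine ⟨_, _, _, ?_, ?_, ?_, rfl⟩ <;> simp [hu.1, hcw, huw]

/-- The discrete tangent vector of the star complex that lies over `a`. -/
def starDart (e : Fin n ≃ vball (skeleton K) c (ρ + 1)) (a : TangentVector K)
    (ha : a.fst ∈ vball (skeleton K) c ρ) : TangentVector (starComplex K c ρ e) where
  fst := e.symm ⟨a.fst, vball_mono _ (Nat.le_succ ρ) ha⟩
  snd := e.symm ⟨a.snd, mem_vball_of_adj ha a.adj⟩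
  adj := starComplex_adj (by simpa using ha) (by simp)

theorem starIncl_starDart (a : TangentVector K) (ha : a.fst ∈ vball (skeleton K) c ρ) :
    (starIncl K c ρ e).mapS (starDart e a ha) = a := by
  refine ext_tangentVector ?_ ?_ <;>
    simp [SimplicialEmbedding.mapS, starDart, starIncl_apply]

variable {W : Type*} [DecidableEq W] {L : AbstractSimplicialComplex W}

/-- The vertex map given by an embedding of the star complex; it is `w` off the star complex. -/
def starExtend (e : Fin n ≃ vball (skeleton K) c (ρ + 1))
    (f : SimplicialEmbedding (starComplex K c ρ e) L) (w : W) (v : V) : W :=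
  open Classical in
  if h : v ∈ vball (skeleton K) c (ρ + 1) then f.toEmb (e.symm ⟨v, h⟩) else w

theorem starExtend_of_mem (f : SimplicialEmbedding (starComplex K c ρ e) L) (w : W) {v : V}
    (h : v ∈ vball (skeleton K) c (ρ + 1)) :
    starExtend e f w v = f.toEmb (e.symm ⟨v, h⟩) := dif_pos h

theorem starExtend_fst (f : SimplicialEmbedding (starComplex K c ρ e) L) (w : W)
    (a : TangentVector K) (ha : a.fst ∈ vball (skeleton K) c ρ) :
    starExtend e f w a.fst = (f.mapS (starDart e a ha)).fst :=
  starExtend_of_mem f w (vball_mono _ (Nat.le_succ ρ) ha)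

theorem starExtend_snd (f : SimplicialEmbedding (starComplex K c ρ e) L) (w : W)
    (a : TangentVector K) (ha : a.fst ∈ vball (skeleton K) c ρ) :
    starExtend e f w a.snd = (f.mapS (starDart e a ha)).snd :=
  starExtend_of_mem f w (mem_vball_of_adj ha a.adj)

theorem isStarEmb_starExtend (f : SimplicialEmbedding (starComplex K c ρ e) L) (w : W) :
    IsStarEmb K L c ρ (starExtend e f w) where
  injOn u hu v hv huv := by
    rw [starExtend_of_mem f w hu, starExtend_of_mem f w hv] at huv
    simpa using huv
  map_faces s hs v hv hvc := by
    have hsub := face_subset_vball hs hv hvc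
    have hf : s.attach.image (fun u => e.symm ⟨u.1, hsub u.2⟩) ∈ (starComplex K c ρ e).faces := by
      refine ⟨by simpa using ⟨v, hv⟩, s, hs, ⟨v, hv, hvc⟩, ?_⟩
      intro i hi
      obtain ⟨u, _, rfl⟩ := Finset.mem_image.1 hi
      simp
    have := f.map_faces _ hf
    convert this using 1
    ext z
    simp only [Finset.mem_image, Finset.mem_map, Finset.mem_attach, true_and, Subtype.exists]
    constructor
    · rintro ⟨u, hu, rfl⟩
      exact ⟨_, ⟨u, hu, rfl⟩, (starExtend_of_mem f w (hsub hu)).symm⟩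
    · rintro ⟨_, ⟨u, hu, rfl⟩, rfl⟩
      exact ⟨u, hu, starExtend_of_mem f w (hsub hu)⟩

/-- The embedding of the star complex given by a star embedding. -/
def IsStarEmb.starMap (e : Fin n ≃ vball (skeleton K) c (ρ + 1)) {g : V → W}
    (h : IsStarEmb K L c ρ g) : SimplicialEmbedding (starComplex K c ρ e) L where
  toEmb := ⟨fun i => g (e i).1, fun i j hij =>
    e.injective (Subtype.ext (h.injOn (e i).2 (e j).2 hij))⟩
  map_faces s hs := by
    obtain ⟨hne, t, ht, ⟨v, hv, hvc⟩, hst⟩ := hs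
    refine face_mono (h.map_faces t ht v hv hvc) ?_ (by simpa using hne)
    intro z hz
    obtain ⟨i, hi, rfl⟩ := Finset.mem_map.1 hz
    exact Finset.mem_image_of_mem g (hst i hi)

end StarComplex

section StarPatch

variable {d : ℕ} {𝒟 : Type*} [MeasurableSpace 𝒟]

/-- The number of vertices within distance `n` of `v`. -/
def vballCard (T : DecoratedTriangulation d 𝒟) (v : T.verts) (n : ℕ) : ℕ :=
  Nat.card (vball (skeleton T.K) v n)

/-- A numbering of the vertices within distance `n` of `v`. -/
def vballEquiv (T : DecoratedTriangulation d 𝒟) (v : T.verts) (n : ℕ) :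
    Fin (vballCard T v n) ≃ vball (skeleton T.K) v n :=
  have := (finite_vball T v n).to_subtype
  (Finite.equivFin _).symm

/-- The star complex of the ball of radius `ρ` around `x`. -/
abbrev ballComplex (T : DecoratedTriangulation d 𝒟) (x : T.S) (ρ : ℕ) :
    AbstractSimplicialComplex (Fin (vballCard T x.fst (ρ + 1))) :=
  starComplex T.K x.fst ρ (vballEquiv T x.fst (ρ + 1))

/-- The inclusion of the star complex of a ball. -/
abbrev ballIncl (T : DecoratedTriangulation d 𝒟) (x : T.S) (ρ : ℕ) :
    SimplicialEmbedding (ballComplex T x ρ) T.K :=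
  starIncl T.K x.fst ρ (vballEquiv T x.fst (ρ + 1))

/-- The patch formed by the stars of the ball of radius `ρ` around `x`. -/
def ballPatch (T : DecoratedTriangulation d 𝒟) (x : T.S) (ρ : ℕ)
    (Ω : Set (TangentVector (ballComplex T x ρ) → 𝒟)) (hΩ : MeasurableSet Ω) : Patch 𝒟 where
  size := vballCard T x.fst (ρ + 1)
  A := ballComplex T x ρ
  dim_two := starComplex_twoDimensional T.surface T.dim_two
  connected := starComplex_connected
  base := starDart _ x (mem_vball_self _ _)
  Ω := Ω
  measurable_Ω := hΩ

/-- The decoration `ω` of the star complex of a ball, extended by the decoration of `T`. -/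
def extendDec (T : DecoratedTriangulation d 𝒟) (x : T.S) (ρ : ℕ)
    (ω : TangentVector (ballComplex T x ρ) → 𝒟) (a : T.S) : 𝒟 :=
  open Classical in
  if h : ∃ b, (ballIncl T x ρ).mapS b = a then ω h.choose else T.dec a

theorem extendDec_mapS (T : DecoratedTriangulation d 𝒟) (x : T.S) (ρ : ℕ)
    (ω : TangentVector (ballComplex T x ρ) → 𝒟) (b : TangentVector (ballComplex T x ρ)) :
    extendDec T x ρ ω ((ballIncl T x ρ).mapS b) = ω b := by
  have h : ∃ b', (ballIncl T x ρ).mapS b' = (ballIncl T x ρ).mapS b := ⟨b, rfl⟩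
  rw [extendDec, dif_pos h]
  exact congrArg ω ((ballIncl T x ρ).mapS_injective h.choose_spec)

theorem measurable_extendDec (T : DecoratedTriangulation d 𝒟) (x : T.S) (ρ : ℕ) :
    Measurable (extendDec T x ρ) := by
  classical
  refine measurable_pi_iff.2 fun a => ?_
  by_cases h : ∃ b, (ballIncl T x ρ).mapS b = a
  · simp only [extendDec, dif_pos h]
    exact measurable_pi_apply _
  · simp only [extendDec, dif_neg h]
    exact measurable_const

theorem dec_eq_extendDec {T U : DecoratedTriangulation d 𝒟} {x : T.S} {ρ : ℕ}
    (f : SimplicialEmbedding (ballComplex T x ρ) U.K) {w : U.verts} {a : T.S} {b : U.S}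
    (ha : a.fst ∈ vball (skeleton T.K) x.fst ρ) (hb1 : b.fst = starExtend _ f w a.fst)
    (hb2 : b.snd = starExtend _ f w a.snd) :
    U.dec b = extendDec T x ρ (fun b => U.dec (f.mapS b)) a := by
  have hb : b = f.mapS (starDart _ a ha) := ext_tangentVector
    (hb1.trans (starExtend_fst f w a ha)) (hb2.trans (starExtend_snd f w a ha))
  have h := extendDec_mapS T x ρ (fun b => U.dec (f.mapS b)) (starDart _ a ha)
  rw [starIncl_starDart] at h
  rw [h, hb]

-- Any embedding of the star complex makes `U` locally isomorphic to `T` with the pulled-back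
-- decoration. A local function can thus be evaluated at `(U, y)` by varying only the decoration of
-- a chosen representative.
set_option maxHeartbeats 400000 in
theorem isLocalIso_starExtend {T U : DecoratedTriangulation d 𝒟} {x : T.S} {y : U.S} {ρ : ℕ}
    (f : SimplicialEmbedding (ballComplex T x ρ) U.K)
    (hf : f.mapS (starDart _ x (mem_vball_self _ _)) = y) :
    IsLocalIso (T := T.withDec (extendDec T x ρ fun b => U.dec (f.mapS b))) x y ρ
      (starExtend _ f y.fst) := by
  have h1 : starExtend _ f y.fst x.fst = y.fst :=
    (starExtend_fst f y.fst x (mem_vball_self _ _)).trans (congrArg (fun a => a.fst) hf)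
  have h2 : starExtend _ f y.fst x.snd = y.snd :=
    (starExtend_snd f y.fst x (mem_vball_self _ _)).trans (congrArg (fun a => a.snd) hf)
  have h3 : IsStarEmb T.K U.K x.fst ρ (starExtend _ f y.fst) := isStarEmb_starExtend f y.fst
  have h4 : ∀ (a : T.S) (b : U.S), a.fst ∈ vball (skeleton T.K) x.fst ρ →
      a.snd ∈ vball (skeleton T.K) x.fst ρ → b.fst = starExtend _ f y.fst a.fst →
      b.snd = starExtend _ f y.fst a.snd →
      U.dec b = extendDec T x ρ (fun b => U.dec (f.mapS b)) a :=
    fun _ _ ha _ hb1 hb2 => dec_eq_extendDec f ha hb1 hb2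
  exact ⟨h3, h1, h2, h4⟩

theorem IsStarEmb.mapS_starMap {T U : DecoratedTriangulation d 𝒟} {x : T.S} {y : U.S} {ρ : ℕ}
    {g : T.verts → U.verts} (h : IsStarEmb T.K U.K x.fst ρ g) (h1 : g x.fst = y.fst)
    (h2 : g x.snd = y.snd) :
    (h.starMap (vballEquiv T x.fst (ρ + 1))).mapS (starDart _ x (mem_vball_self _ _)) = y := by
  refine ext_tangentVector ?_ ?_
  · rw [← h1]
    change g ((vballEquiv T x.fst (ρ + 1)) ((vballEquiv T x.fst (ρ + 1)).symm _)).1 = _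
    rw [Equiv.apply_symm_apply]
  · rw [← h2]
    change g ((vballEquiv T x.fst (ρ + 1)) ((vballEquiv T x.fst (ρ + 1)).symm _)).1 = _
    rw [Equiv.apply_symm_apply]

end StarPatch

/-! ### Local functions on the unit space -/

section LocalFunctions

variable {d : ℕ} {𝒟 : Type*}

/-- Marked triangulations are equivalent if the stars of the balls of radius `ρ` around their marked
tangent vectors are isomorphic, disregarding decorations. -/
def starSetoid (d : ℕ) (𝒟 : Type*) (ρ : ℕ) : Setoid (Σ T : DecoratedTriangulation d 𝒟, T.S) where
  r p q := ∃ g : p.1.verts → q.1.verts, IsStarEmb p.1.K q.1.K p.2.fst ρ g ∧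
    g p.2.fst = q.2.fst ∧ g p.2.snd = q.2.snd
  iseqv :=
    { refl := fun p => ⟨id, isStarEmb_id, rfl, rfl⟩
      symm := fun {p q} ⟨g, h, h1, h2⟩ => by
        have hl := h.injOn.leftInvOn_invFunOn
        have hi := h.inverse p.1.surface q.1.surface q.1.dim_two.1
        rw [h1] at hi
        refine ⟨_, hi, ?_, ?_⟩
        · rw [← h1]; exact hl (mem_vball_self _ _)
        · rw [← h2]; exact hl (mem_vball_of_adj (mem_vball_self _ _) p.2.adj)
      trans := fun {p q s} ⟨g, h, h1, h2⟩ ⟨g', h', h1', h2'⟩ => by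
        rw [← h1] at h'
        exact ⟨g' ∘ g, h'.comp p.1.surface q.1.surface h, by simp [h1, h1'], by simp [h2, h2']⟩ }

theorem exists_injOn_fin (T : DecoratedTriangulation d 𝒟) (v : T.verts) (n : ℕ) :
    ∃ j : T.verts → Fin ((d + 1) ^ n), Set.InjOn j (vball (skeleton T.K) v n) := by
  classical
  have hfin := finite_vball T v n
  have hcard : hfin.toFinset.card ≤ (d + 1) ^ n := by
    have := encard_vball_le T.degree_le v n
    rw [hfin.encard_eq_coe_toFinset_card] at this
    exact_mod_cast this
  have : Nonempty (Fin ((d + 1) ^ n)) := ⟨⟨0, by positivity⟩⟩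
  have h1 : Nonempty (hfin.toFinset ↪ Fin ((d + 1) ^ n)) := by
    refine Function.Embedding.nonempty_of_card_le ?_
    simpa using hcard
  obtain ⟨f⟩ := h1
  refine ⟨fun u => if h : u ∈ hfin.toFinset then f ⟨u, h⟩ else Classical.arbitrary _, ?_⟩
  intro u hu w hw huw
  have hu' : u ∈ hfin.toFinset := by simpa using hu
  have hw' : w ∈ hfin.toFinset := by simpa using hw
  simp only [hu', hw', dif_pos] at huw
  simpa using huw

/-- Numbering the vertices of the ball of radius `ρ + 1` by a fixed finite set turns the faces of
the stars and the two marked vertices into a code from a finite set. Equal codes give isomorphic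
stars. -/
instance (ρ : ℕ) : Finite (Quotient (starSetoid d 𝒟 ρ)) := by
  classical
  choose j hj using fun p : (Σ T : DecoratedTriangulation d 𝒟, T.S) =>
    exists_injOn_fin p.1 p.2.fst (ρ + 1)
  let code : (Σ T : DecoratedTriangulation d 𝒟, T.S) →
      Set (Finset (Fin ((d + 1) ^ (ρ + 1)))) × Fin ((d + 1) ^ (ρ + 1)) × Fin ((d + 1) ^ (ρ + 1)) :=
    fun p => ({t | ∃ s ∈ p.1.K.faces, (∃ v ∈ s, v ∈ vball (skeleton p.1.K) p.2.fst ρ) ∧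
      s.image (j p) = t}, j p p.2.fst, j p p.2.snd)
  have hcode : ∀ p q, code p = code q → (starSetoid d 𝒟 ρ).r p q := by
    intro p q h
    have hl := (hj q).leftInvOn_invFunOn
    have e1 : j p p.2.fst = j q q.2.fst := congrArg (fun c => c.2.1) h
    have e2 : j p p.2.snd = j q q.2.snd := congrArg (fun c => c.2.2) h
    have hface : ∀ s ∈ p.1.K.faces, (∃ v ∈ s, v ∈ vball (skeleton p.1.K) p.2.fst ρ) →
        ∃ s' ∈ q.1.K.faces, (s' : Set q.1.verts) ⊆ vball (skeleton q.1.K) q.2.fst (ρ + 1) ∧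
          s'.image (j q) = s.image (j p) := by
      intro s hs hv
      have hm : s.image (j p) ∈ (code q).1 := h ▸ (⟨s, hs, hv, rfl⟩ : _ ∈ (code p).1)
      obtain ⟨s', hs', ⟨v', hv', hv'c⟩, he⟩ := hm
      exact ⟨s', hs', face_subset_vball hs' hv' hv'c, he⟩
    have hrange : ∀ v ∈ vball (skeleton p.1.K) p.2.fst (ρ + 1),
        ∃ v' ∈ vball (skeleton q.1.K) q.2.fst (ρ + 1), j q v' = j p v := by
      intro v hv
      obtain ⟨s, hs, hvs, hex⟩ : ∃ s ∈ p.1.K.faces, v ∈ s ∧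
          ∃ w ∈ s, w ∈ vball (skeleton p.1.K) p.2.fst ρ := by
        obtain ⟨w, hw, hwv | hwv⟩ := mem_vball_succ.1 hv
        · exact ⟨{w}, p.1.K.singleton_mem w, by simp [hwv], w, by simp, hw⟩
        · exact ⟨{w, v}, (skeleton_adj_iff.1 hwv).2, by simp, w, by simp, hw⟩
      obtain ⟨s', _, hs'v, he⟩ := hface s hs hex
      obtain ⟨v', hv', e⟩ := Finset.mem_image.1 (he ▸ Finset.mem_image_of_mem (j p) hvs)
      exact ⟨v', hs'v hv', e⟩
    -- The isomorphism is the numbering of `p` followed by the inverse of the numbering of `q`;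
    -- `hrange` guarantees that every number used by `p` is used by `q`.
    refine ⟨fun v => Function.invFunOn (j q) (vball (skeleton q.1.K) q.2.fst (ρ + 1)) (j p v),
      ⟨?_, ?_⟩, ?_, ?_⟩
    · intro u hu w hw huw
      obtain ⟨u', hu', eu⟩ := hrange u hu
      obtain ⟨w', hw', ew⟩ := hrange w hw
      change Function.invFunOn (j q) _ (j p u) = Function.invFunOn (j q) _ (j p w) at huw
      rw [← eu, ← ew, hl hu', hl hw'] at huw
      exact hj p hu hw (by rw [← eu, ← ew, huw])
    · intro s hs v hv hvc
      obtain ⟨s', hs', hs'v, he⟩ := hface s hs ⟨v, hv, hvc⟩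
      change s.image (Function.invFunOn (j q) _ ∘ j p) ∈ _
      rw [← Finset.image_image, ← he, Finset.image_image]
      convert hs'
      rw [Finset.image_congr (g := id), Finset.image_id]
      exact fun u hu => hl (hs'v hu)
    · change Function.invFunOn (j q) _ (j p p.2.fst) = _
      rw [e1]; exact hl (mem_vball_self _ _)
    · change Function.invFunOn (j q) _ (j p p.2.snd) = _
      rw [e2]; exact hl (mem_vball_of_adj (mem_vball_self _ _) q.2.adj)
  refine Finite.of_injective (fun q : Quotient (starSetoid d 𝒟 ρ) => code q.out) fun p q h => ?_
  rw [← Quotient.out_eq p, ← Quotient.out_eq q]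
  exact Quotient.sound (hcode _ _ h)

variable [MeasurableSpace 𝒟] {X Y : Type*} [MeasurableSpace X] [MeasurableSpace Y]

/-- A function on the unit space is local if it depends only on the decorated ball of radius `ρ`
around the marked tangent vector, in a Borel way on the decoration. -/
structure IsLocal (ρ : ℕ) (f : UnitSpace d 𝒟 → X) : Prop where
  congr : ∀ (T U : DecoratedTriangulation d 𝒟) (x : T.S) (y : U.S) (g : T.verts → U.verts),
    IsLocalIso x y ρ g → f (UnitSpace.mk T x) = f (UnitSpace.mk U y)
  measurable : ∀ (T : DecoratedTriangulation d 𝒟) (x : T.S),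
    Measurable fun ω : T.S → 𝒟 => f (UnitSpace.mk (T.withDec ω) x)

theorem IsLocal.comp {ρ : ℕ} {f : UnitSpace d 𝒟 → X} (hf : IsLocal ρ f) {F : X → Y}
    (hF : Measurable F) : IsLocal ρ fun u => F (f u) where
  congr T U x y g h := congrArg F (hf.congr T U x y g h)
  measurable T x := hF.comp (hf.measurable T x)

theorem IsLocal.mono {ρ ρ' : ℕ} {f : UnitSpace d 𝒟 → X} (hf : IsLocal ρ f) (h : ρ ≤ ρ') :
    IsLocal ρ' f where
  congr T U x y g hg := hf.congr T U x y g (hg.mono h)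
  measurable := hf.measurable

theorem IsLocal.pi {ι : Type*} {ρ : ℕ} {f : ι → UnitSpace d 𝒟 → X} (hf : ∀ i, IsLocal ρ (f i)) :
    IsLocal ρ fun u i => f i u where
  congr T U x y g hg := funext fun i => (hf i).congr T U x y g hg
  measurable T x := measurable_pi_iff.2 fun i => (hf i).measurable T x

/-- There is one patch per combinatorial type: the stars in a representative, with the decorations
for which `f` lands in `B`. Since every embedding of the stars is a local isomorphism, a point lies
in the cylinder exactly when it has this type and its value is in `B`; different types give disjoint
cylinders. -/
theorem IsLocal.exists_patches {ρ : ℕ} {f : UnitSpace d 𝒟 → X} (hf : IsLocal ρ f) {B : Set X}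
    (hB : MeasurableSet B) : ∃ P : Quotient (starSetoid d 𝒟 ρ) → Patch 𝒟,
      f ⁻¹' B = ⋃ q, (P q).cylinder d ∧
      Pairwise fun q q' => Disjoint ((P q).cylinder d) ((P q').cylinder d) := by
  let P : Quotient (starSetoid d 𝒟 ρ) → Patch 𝒟 := fun q =>
    ballPatch q.out.1 q.out.2 ρ
      ((fun ω => f (UnitSpace.mk (q.out.1.withDec (extendDec q.out.1 q.out.2 ρ ω)) q.out.2)) ⁻¹' B)
      (((hf.measurable q.out.1 q.out.2).comp (measurable_extendDec q.out.1 q.out.2 ρ)) hB)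
  have key : ∀ (q : Quotient (starSetoid d 𝒟 ρ)) (U : DecoratedTriangulation d 𝒟) (y : U.S),
      UnitSpace.mk U y ∈ (P q).cylinder d ↔
        q = Quotient.mk (starSetoid d 𝒟 ρ) ⟨U, y⟩ ∧ f (UnitSpace.mk U y) ∈ B := by
    intro q U y
    rw [UnitSpace.mk_mem_cylinder]
    constructor
    · rintro ⟨g, hg, hΩ⟩
      have hloc := isLocalIso_starExtend (T := q.out.1) (x := q.out.2) g hg
      refine ⟨?_, ?_⟩
      · rw [← Quotient.out_eq q]
        exact Quotient.sound (s := starSetoid d 𝒟 ρ) ⟨_, hloc.toIsStarEmb, hloc.map_fst, hloc.map_snd⟩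
      · rw [← hf.congr _ _ _ _ _ hloc]
        exact hΩ
    · rintro ⟨hq, hB⟩
      obtain ⟨g, hg, h1, h2⟩ : (starSetoid d 𝒟 ρ).r q.out ⟨U, y⟩ :=
        Quotient.exact ((Quotient.out_eq q).trans hq)
      refine ⟨hg.starMap _, hg.mapS_starMap h1 h2, ?_⟩
      have hloc := isLocalIso_starExtend (T := q.out.1) (x := q.out.2) _ (hg.mapS_starMap h1 h2)
      rw [← hf.congr _ _ _ _ _ hloc] at hB
      exact hB
  refine ⟨P, ?_, ?_⟩
  · ext u
    obtain ⟨U, y, rfl⟩ := u.exists_mk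
    simp only [Set.mem_preimage, Set.mem_iUnion, key]
    exact ⟨fun h => ⟨_, rfl, h⟩, fun ⟨_, _, h⟩ => h⟩
  · intro q q' hne
    rw [Set.disjoint_left]
    intro u hu hu'
    obtain ⟨U, y, rfl⟩ := u.exists_mk
    exact hne (((key _ _ _).1 hu).1.trans ((key _ _ _).1 hu').1.symm)

theorem IsLocal.measurable_fun {ρ : ℕ} {f : UnitSpace d 𝒟 → X} (hf : IsLocal ρ f) :
    Measurable f := by
  intro B hB
  obtain ⟨P, hP, -⟩ := hf.exists_patches hB
  rw [hP]
  exact MeasurableSet.iUnion fun q => measurableSet_cylinder _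

theorem IsLocal.tendsto_measure {ρ : ℕ} {f : UnitSpace d 𝒟 → X} (hf : IsLocal ρ f)
    {ν' : ℕ → Measure (UnitSpace d 𝒟)} {ν : Measure (UnitSpace d 𝒟)} (h : PatchConverges ν' ν)
    {B : Set X} (hB : MeasurableSet B) :
    Tendsto (fun n => ν' n (f ⁻¹' B)) atTop (𝓝 (ν (f ⁻¹' B))) := by
  obtain ⟨P, hP, hd⟩ := hf.exists_patches hB
  have := Fintype.ofFinite (Quotient (starSetoid d 𝒟 ρ))
  have hm : ∀ μ : Measure (UnitSpace d 𝒟), μ (f ⁻¹' B) = ∑ q, μ ((P q).cylinder d) := fun μ => by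
    rw [hP, measure_iUnion hd fun q => measurableSet_cylinder _, tsum_fintype]
  simp only [hm]
  exact tendsto_finsetSum _ fun q _ => h (P q)

end LocalFunctions

/-! ### Measurability of the structure maps of the groupoid -/

section StructureMaps

variable {d : ℕ} {𝒟 : Type*} [MeasurableSpace 𝒟]

theorem exists_vball (T : DecoratedTriangulation d 𝒟) (c : T.verts) (F : Finset T.verts) :
    ∃ n, ∀ v ∈ F, v ∈ vball (skeleton T.K) c n := by
  refine ⟨F.sup fun v => (skeleton T.K).dist c v, fun v hv => ?_⟩
  have h := (T.connected.preconnected c v).coe_dist_eq_edist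
  change (skeleton T.K).edist c v ≤ _
  rw [← h]
  exact_mod_cast Finset.le_sup (f := fun v => (skeleton T.K).dist c v) hv

theorem measurable_groupoid_inv : Measurable (Groupoid.inv (d := d) (𝒟 := 𝒟)) := by
  refine measurable_generateFrom ?_
  rintro _ ⟨P, rfl⟩
  let Q : TwiceMarkedPatch 𝒟 := { P with base := P.base', base' := P.base }
  have : Groupoid.inv ⁻¹' P.cylinder d = Q.cylinder d := by
    ext γ
    obtain ⟨T, x, y, rfl⟩ := γ.exists_mk
    change Groupoid.mk T y x ∈ P.cylinder d ↔ _
    rw [Groupoid.mk_mem_cylinder, Groupoid.mk_mem_cylinder]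
    exact exists_congr fun g => and_left_comm
  rw [this]
  exact measurableSet_twiceMarkedCylinder Q

/-- Embeddings are injective on tangent vectors, so a patch with two distinct marks never occurs at
a unit. -/
theorem measurable_diag : Measurable (UnitSpace.diag (d := d) (𝒟 := 𝒟)) := by
  refine measurable_generateFrom ?_
  rintro _ ⟨P, rfl⟩
  by_cases h : P.base = P.base'
  · have : UnitSpace.diag ⁻¹' P.cylinder d = P.toPatch.cylinder d := by
      ext u
      obtain ⟨T, x, rfl⟩ := u.exists_mk
      change Groupoid.mk T x x ∈ P.cylinder d ↔ _
      rw [Groupoid.mk_mem_cylinder, UnitSpace.mk_mem_cylinder, ← h]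
      exact exists_congr fun g => ⟨fun h => h.2, fun h => ⟨h.1, h⟩⟩
    rw [this]
    exact measurableSet_cylinder _
  · have : UnitSpace.diag ⁻¹' P.cylinder d = ∅ := by
      refine Set.eq_empty_iff_forall_notMem.2 fun u hu => ?_
      obtain ⟨T, x, rfl⟩ := u.exists_mk
      obtain ⟨g, hg, hg', -⟩ := Groupoid.mk_mem_cylinder.1 hu
      exact h (g.mapS_injective (hg.trans hg'.symm))
    rw [this]
    exact MeasurableSet.empty

theorem mk_mem_diagonal {T : DecoratedTriangulation d 𝒟} {x y : T.S} :
    Groupoid.mk T x y ∈ diagonal d 𝒟 ↔ x = y := by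
  constructor
  · rintro ⟨u, hu⟩
    obtain ⟨U, z, rfl⟩ := u.exists_mk
    obtain ⟨e, h1, h2⟩ := Quotient.exact (s := twiceMarkedSetoid d 𝒟) hu
    change Iso U T at e
    change e.equivS z = x at h1
    change e.equivS z = y at h2
    exact h1.symm.trans h2
  · rintro rfl
    exact ⟨UnitSpace.mk T x, rfl⟩

/-- There are countably many finite complexes with both marks equal, and the stars of the ball of
radius `0` provide one at every unit. -/
theorem measurableSet_diagonal : MeasurableSet (diagonal d 𝒟) := by
  have : diagonal d 𝒟 = ⋃ (n : ℕ) (A : AbstractSimplicialComplex (Fin n))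
      (h2 : IsTwoDimensional A) (hc : (skeleton A).Connected) (b : TangentVector A),
      TwiceMarkedPatch.cylinder ⟨⟨n, A, h2, hc, b, Set.univ, MeasurableSet.univ⟩, b⟩ d := by
    ext γ
    obtain ⟨T, x, y, rfl⟩ := γ.exists_mk
    simp only [mk_mem_diagonal, Set.mem_iUnion, Groupoid.mk_mem_cylinder]
    constructor
    · rintro rfl
      exact ⟨_, ballComplex T x 0, starComplex_twoDimensional T.surface T.dim_two,
        starComplex_connected, starDart _ x (mem_vball_self _ _), ballIncl T x 0,
        starIncl_starDart _ _, starIncl_starDart _ _, trivial⟩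
    · rintro ⟨n, A, h2, hc, b, g, h, h', -⟩
      exact h.symm.trans h'
  rw [this]
  exact MeasurableSet.iUnion fun n => MeasurableSet.iUnion fun A => MeasurableSet.iUnion fun h2 =>
    MeasurableSet.iUnion fun hc => MeasurableSet.iUnion fun b =>
      measurableSet_twiceMarkedCylinder _

/-- The range map `(x, y) ↦ x`. -/
def Groupoid.range : Groupoid d 𝒟 → UnitSpace d 𝒟 :=
  Quotient.lift (fun p => UnitSpace.mk p.1 p.2.1) (by
    rintro ⟨T, x, y⟩ ⟨U, x', y'⟩ ⟨e, he, -⟩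
    exact Quotient.sound (s := markedSetoid d 𝒟) ⟨e, he⟩)

/-- A simplicial embedding into a ball lifts to the star complex of the ball. -/
def SimplicialEmbedding.liftBall {V : Type*} {A : AbstractSimplicialComplex V}
    {T : DecoratedTriangulation d 𝒟} (g : SimplicialEmbedding A T.K) (x : T.S) (ρ : ℕ)
    (h : ∀ v, g.toEmb v ∈ vball (skeleton T.K) x.fst ρ) :
    SimplicialEmbedding A (ballComplex T x ρ) where
  toEmb := ⟨fun v => (vballEquiv T x.fst (ρ + 1)).symm ⟨_, vball_mono _ (Nat.le_succ ρ) (h v)⟩,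
    fun u v huv => by simpa using huv⟩
  map_faces s hs := by
    have hg := g.map_faces s hs
    obtain ⟨w, hw⟩ := face_nonempty hg
    obtain ⟨v, hv, rfl⟩ := Finset.mem_map.1 hw
    refine ⟨⟨_, Finset.mem_map_of_mem _ hv⟩, _, hg, ⟨_, hw, h v⟩, ?_⟩
    intro i hi
    obtain ⟨u, hu, rfl⟩ := Finset.mem_map.1 hi
    change ((vballEquiv T x.fst (ρ + 1)) ((vballEquiv T x.fst (ρ + 1)).symm _)).1 ∈ _
    rw [Equiv.apply_symm_apply]
    exact Finset.mem_map_of_mem _ hu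

theorem SimplicialEmbedding.mapS_liftBall {V : Type*} {A : AbstractSimplicialComplex V}
    {T : DecoratedTriangulation d 𝒟} (g : SimplicialEmbedding A T.K) (x : T.S) (ρ : ℕ)
    (h : ∀ v, g.toEmb v ∈ vball (skeleton T.K) x.fst ρ) (a : TangentVector A) :
    (ballIncl T x ρ).mapS ((g.liftBall x ρ h).mapS a) = g.mapS a := by
  refine ext_tangentVector ?_ ?_
  · change ((vballEquiv T x.fst (ρ + 1)) ((vballEquiv T x.fst (ρ + 1)).symm _)).1 = _
    rw [Equiv.apply_symm_apply]
    rfl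
  · change ((vballEquiv T x.fst (ρ + 1)) ((vballEquiv T x.fst (ρ + 1)).symm _)).1 = _
    rw [Equiv.apply_symm_apply]
    rfl

/-- Forgetting `y` must be expressed by twice-marked patches. The patch `P` is enlarged to an
arbitrary finite complex with an arbitrary second mark; the stars of a large ball contain both the
copy of `P` and `y`, so countably many such patches exhaust the preimage. -/
theorem measurable_groupoid_range : Measurable (Groupoid.range (d := d) (𝒟 := 𝒟)) := by
  refine measurable_generateFrom ?_
  rintro _ ⟨P, rfl⟩
  have hmeas : ∀ {n : ℕ} {A : AbstractSimplicialComplex (Fin n)} (i : SimplicialEmbedding P.A A),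
      MeasurableSet ((fun (ω : TangentVector A → 𝒟) a => ω (i.mapS a)) ⁻¹' P.Ω) := fun i =>
    measurableSet_preimage (by fun_prop) P.measurable_Ω
  have : Groupoid.range ⁻¹' P.cylinder d = ⋃ (n : ℕ) (A : AbstractSimplicialComplex (Fin n))
      (h2 : IsTwoDimensional A) (hc : (skeleton A).Connected) (i : SimplicialEmbedding P.A A)
      (b : TangentVector A),
      TwiceMarkedPatch.cylinder ⟨⟨n, A, h2, hc, i.mapS P.base, _, hmeas i⟩, b⟩ d := by
    ext γ
    obtain ⟨T, x, y, rfl⟩ := γ.exists_mk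
    change UnitSpace.mk T x ∈ P.cylinder d ↔ _
    simp only [UnitSpace.mk_mem_cylinder, Set.mem_iUnion, Groupoid.mk_mem_cylinder]
    constructor
    · rintro ⟨g, hg, hΩ⟩
      obtain ⟨ρ, hρ⟩ := exists_vball T x.fst (insert y.fst (Finset.univ.map g.toEmb))
      have hy := hρ y.fst (by simp)
      have hgρ : ∀ v, g.toEmb v ∈ vball (skeleton T.K) x.fst ρ := fun v => hρ _ (by simp)
      refine ⟨_, ballComplex T x ρ, starComplex_twoDimensional T.surface T.dim_two,
        starComplex_connected, g.liftBall x ρ hgρ, starDart _ y hy, ballIncl T x ρ,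
        (g.mapS_liftBall x ρ hgρ _).trans hg, starIncl_starDart _ _, ?_⟩
      change (fun a => T.dec ((ballIncl T x ρ).mapS ((g.liftBall x ρ hgρ).mapS a))) ∈ P.Ω
      simpa only [g.mapS_liftBall x ρ hgρ] using hΩ
    · rintro ⟨n, A, h2, hc, i, b, g, h, -, hΩ⟩
      exact ⟨g.comp i, h, hΩ⟩
  rw [this]
  exact MeasurableSet.iUnion fun n => MeasurableSet.iUnion fun A => MeasurableSet.iUnion fun h2 =>
    MeasurableSet.iUnion fun hc => MeasurableSet.iUnion fun i => MeasurableSet.iUnion fun b =>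
      measurableSet_twiceMarkedCylinder _

end StructureMaps

/-! ### Measurability of the fibre measures -/

section FibreMeasure

variable {d : ℕ} {𝒟 : Type*}

/-- A set of groupoid elements is local if it consists of pairs at distance at most `ρ` and is
invariant under isomorphisms of balls of radius `ρ`. -/
structure IsLocalSet (ρ : ℕ) (E : Set (Groupoid d 𝒟)) : Prop where
  bounded : ∀ (T : DecoratedTriangulation d 𝒟) (x y : T.S), Groupoid.mk T x y ∈ E →
    y.fst ∈ vball (skeleton T.K) x.fst ρ ∧ y.snd ∈ vball (skeleton T.K) x.fst ρ
  map_mem : ∀ (T U : DecoratedTriangulation d 𝒟) (x : T.S) (x' : U.S) (g : T.verts → U.verts),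
    IsLocalIso x x' ρ g → ∀ (y : T.S) (y' : U.S), y'.fst = g y.fst → y'.snd = g y.snd →
      Groupoid.mk T x y ∈ E → Groupoid.mk U x' y' ∈ E

theorem IsLocalSet.mono {ρ ρ' : ℕ} {E : Set (Groupoid d 𝒟)} (h : IsLocalSet ρ E) (hρ : ρ ≤ ρ') :
    IsLocalSet ρ' E where
  bounded T x y hy := (h.bounded T x y hy).imp (fun h => vball_mono _ hρ h)
    (fun h => vball_mono _ hρ h)
  map_mem T U x x' g hg := h.map_mem T U x x' g (hg.mono hρ)

theorem IsLocalSet.inter {ρ ρ' : ℕ} {E E' : Set (Groupoid d 𝒟)} (h : IsLocalSet ρ E)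
    (h' : IsLocalSet ρ' E') : IsLocalSet (max ρ ρ') (E ∩ E') where
  bounded T x y hy := (h.mono (le_max_left ρ ρ')).bounded T x y hy.1
  map_mem T U x x' g hg y y' h1 h2 hy :=
    ⟨(h.mono (le_max_left ρ ρ')).map_mem T U x x' g hg y y' h1 h2 hy.1,
      (h'.mono (le_max_right ρ ρ')).map_mem T U x x' g hg y y' h1 h2 hy.2⟩

theorem IsLocalSet.iUnion {ι : Sort*} {ρ : ℕ} {E : ι → Set (Groupoid d 𝒟)}
    (h : ∀ i, IsLocalSet ρ (E i)) : IsLocalSet ρ (⋃ i, E i) where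
  bounded T x y hy := by
    obtain ⟨i, hi⟩ := Set.mem_iUnion.1 hy
    exact (h i).bounded T x y hi
  map_mem T U x x' g hg y y' h1 h2 hy := by
    obtain ⟨i, hi⟩ := Set.mem_iUnion.1 hy
    exact Set.mem_iUnion.2 ⟨i, (h i).map_mem T U x x' g hg y y' h1 h2 hi⟩

theorem SimplicialEmbedding.map_vball {V W : Type*} {K : AbstractSimplicialComplex V}
    {L : AbstractSimplicialComplex W} (f : SimplicialEmbedding K L) {v u : V} {n : ℕ}
    (h : u ∈ vball (skeleton K) v n) : f.toEmb u ∈ vball (skeleton L) (f.toEmb v) n := by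
  induction n generalizing u with
  | zero => rw [mem_vball_zero] at h ⊢; rw [h]
  | succ n ih =>
    obtain ⟨w, hw, rfl | hadj⟩ := mem_vball_succ.1 h
    · exact vball_mono _ (Nat.le_succ n) (ih hw)
    · exact mem_vball_of_adj (ih hw) (f.mapS ⟨(w, u), hadj⟩).adj

variable [MeasurableSpace 𝒟]

theorem Patch.mem_vball (P : Patch 𝒟) (v : Fin P.size) :
    v ∈ vball (skeleton P.A) P.base.fst P.size := by
  obtain ⟨p, hp⟩ := (P.connected.preconnected P.base.fst v).exists_isPath
  refine le_trans (SimpleGraph.edist_le p) ?_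
  have := hp.length_lt
  rw [Fintype.card_fin] at this
  exact_mod_cast this.le

/-- A connected complex has diameter less than its number of vertices, so a copy of `P` marked at
`x` stays in the ball of radius `P.size` and is carried along by any local isomorphism of that
radius. -/
theorem isLocalSet_cylinder (P : TwiceMarkedPatch 𝒟) : IsLocalSet P.size (P.cylinder d) := by
  have hb : ∀ {T : DecoratedTriangulation d 𝒟} {x : T.S} (f : SimplicialEmbedding P.A T.K),
      f.mapS P.base = x → ∀ v, f.toEmb v ∈ vball (skeleton T.K) x.fst P.size := by
    rintro T x f rfl v
    exact f.map_vball (P.mem_vball v)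
  refine ⟨?_, ?_⟩
  · intro T x y hy
    obtain ⟨f, hf, rfl, -⟩ := Groupoid.mk_mem_cylinder.1 hy
    exact ⟨hb f hf _, hb f hf _⟩
  · intro T U x x' g hg y y' h1 h2 hy
    obtain ⟨f, hf, hf', hΩ⟩ := Groupoid.mk_mem_cylinder.1 hy
    have hv := hb f hf
    let f' : SimplicialEmbedding P.A U.K :=
      { toEmb := ⟨fun v => g (f.toEmb v), fun u v huv => f.toEmb.injective
          (hg.injOn (vball_mono _ (Nat.le_succ _) (hv u)) (vball_mono _ (Nat.le_succ _) (hv v)) huv)⟩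
        map_faces := fun s hs => by
          obtain ⟨v, hvs⟩ := face_nonempty hs
          have := hg.map_faces _ (f.map_faces s hs) _ (Finset.mem_map_of_mem _ hvs) (hv v)
          convert this using 1
          ext z
          simp only [Finset.mem_map, Finset.mem_image, exists_exists_and_eq_and]
          rfl }
    refine Groupoid.mk_mem_cylinder.2 ⟨f', ?_, ?_, ?_⟩
    · subst hf
      exact ext_tangentVector hg.map_fst hg.map_snd
    · subst hf'
      exact ext_tangentVector h1.symm h2.symm
    · have : ∀ a, U.dec (f'.mapS a) = T.dec (f.mapS a) := fun a =>
        hg.dec_eq (f.mapS a) (f'.mapS a) (hv _) (hv _) rfl rfl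
      simpa only [this] using hΩ

theorem fibreMeasure_mk_apply (T : DecoratedTriangulation d 𝒟) (x : T.S) {E : Set (Groupoid d 𝒟)}
    (hE : MeasurableSet E) :
    fibreMeasure (UnitSpace.mk T x) E = ∑' y : T.S, E.indicator 1 (Groupoid.mk T x y) := by
  change (Measure.sum fun y : T.S => Measure.dirac (Groupoid.mk T x y)) E = _
  rw [Measure.sum_apply _ hE]
  simp_rw [Measure.dirac_apply' _ hE]

/-- The local isomorphism injects the `y` with `(x, y) ∈ E` into the corresponding set at `x'`; the
inverse local isomorphism later gives equality. -/
theorem fibreMeasure_le_of_isLocalIso {ρ : ℕ} {E : Set (Groupoid d 𝒟)} (hE : MeasurableSet E)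
    (h : IsLocalSet ρ E) {T U : DecoratedTriangulation d 𝒟} {x : T.S} {x' : U.S}
    {g : T.verts → U.verts} (hg : IsLocalIso x x' ρ g) :
    fibreMeasure (UnitSpace.mk T x) E ≤ fibreMeasure (UnitSpace.mk U x') E := by
  rw [fibreMeasure_mk_apply T x hE, fibreMeasure_mk_apply U x' hE]
  have hb := h.bounded T x
  choose i hi1 hi2 using fun y : {y : T.S // Groupoid.mk T x y ∈ E} =>
    hg.exists_map (hb y.1 y.2).1
  have hinj : Function.Injective i := fun a b hab => Subtype.ext <| ext_tangentVector
    (hg.injOn (vball_mono _ (Nat.le_succ ρ) (hb _ a.2).1) (vball_mono _ (Nat.le_succ ρ) (hb _ b.2).1)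
      (by rw [← hi1, ← hi1, hab]))
    (hg.injOn (vball_mono _ (Nat.le_succ ρ) (hb _ a.2).2) (vball_mono _ (Nat.le_succ ρ) (hb _ b.2).2)
      (by rw [← hi2, ← hi2, hab]))
  have hmem : ∀ y, Groupoid.mk U x' (i y) ∈ E := fun y =>
    h.map_mem T U x x' g hg y.1 (i y) (hi1 y) (hi2 y) y.2
  calc ∑' y : T.S, E.indicator (1 : Groupoid d 𝒟 → ℝ≥0∞) (Groupoid.mk T x y)
      = ∑' y : T.S, Set.indicator {y : T.S | Groupoid.mk T x y ∈ E} (1 : T.S → ℝ≥0∞) y := rfl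
    _ = ∑' y : {y : T.S | Groupoid.mk T x y ∈ E}, (1 : T.S → ℝ≥0∞) y := (tsum_subtype _ _).symm
    _ = ∑' y : {y : T.S // Groupoid.mk T x y ∈ E},
          E.indicator (1 : Groupoid d 𝒟 → ℝ≥0∞) (Groupoid.mk U x' (i y)) := by
        refine tsum_congr fun y => ?_
        rw [Set.indicator_of_mem (hmem y)]; rfl
    _ ≤ _ := ENNReal.tsum_comp_le_tsum_of_injective hinj
        fun y => E.indicator 1 (Groupoid.mk U x' y)

theorem isLocal_fibreMeasure {ρ : ℕ} {E : Set (Groupoid d 𝒟)} (hE : MeasurableSet E)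
    (h : IsLocalSet ρ E) : IsLocal ρ fun u : UnitSpace d 𝒟 => fibreMeasure u E where
  congr T U x y g hg := le_antisymm (fibreMeasure_le_of_isLocalIso hE h hg)
    (fibreMeasure_le_of_isLocalIso hE h hg.symm)
  measurable T x := by
    have : (fun ω : T.S → 𝒟 => fibreMeasure (UnitSpace.mk (T.withDec ω) x) E) =
        fun ω => ∑' y : T.S, E.indicator 1 (Groupoid.mk (T.withDec ω) x y) :=
      funext fun ω => fibreMeasure_mk_apply (T.withDec ω) x hE
    rw [this]
    exact Measurable.tsum fun y =>
      (measurable_one.indicator hE).comp (measurable_groupoid_mk_withDec T x y)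

theorem finite_tangentVectors (T : DecoratedTriangulation d 𝒟) (c : T.verts) (n : ℕ) :
    {a : T.S | a.fst ∈ vball (skeleton T.K) c n ∧ a.snd ∈ vball (skeleton T.K) c n}.Finite :=
  Set.Finite.of_finite_image (f := fun a : T.S => a.toProd)
    (((finite_vball T c n).prod (finite_vball T c n)).subset (by
      rintro _ ⟨a, ha, rfl⟩; exact ha))
    (fun _ _ _ _ h => SimpleGraph.Dart.ext _ _ h)

theorem fibreMeasure_lt_top {ρ : ℕ} {E : Set (Groupoid d 𝒟)} (hE : MeasurableSet E)
    (h : IsLocalSet ρ E) (u : UnitSpace d 𝒟) : fibreMeasure u E < ∞ := by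
  obtain ⟨T, x, rfl⟩ := u.exists_mk
  rw [fibreMeasure_mk_apply T x hE,
    tsum_eq_sum (s := (finite_tangentVectors T x.fst ρ).toFinset) ?_]
  · refine ENNReal.sum_lt_top.2 fun y _ => ?_
    refine lt_of_le_of_lt (Set.indicator_le_self' (fun _ _ => zero_le) _) ?_
    simp
  · intro y hy
    refine Set.indicator_of_notMem (fun hyE => hy ?_) _
    rw [Set.Finite.mem_toFinset]
    exact h.bounded T x y hyE

/-- The pairs that are joined by a patch with at most `R` vertices. -/
def joined (d : ℕ) (𝒟 : Type*) [MeasurableSpace 𝒟] (R : ℕ) : Set (Groupoid d 𝒟) :=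
  ⋃ (P : {P : TwiceMarkedPatch 𝒟 // P.size ≤ R ∧ P.Ω = Set.univ}), P.1.cylinder d

theorem isLocalSet_joined (R : ℕ) : IsLocalSet R (joined d 𝒟 R) :=
  IsLocalSet.iUnion fun P => (isLocalSet_cylinder P.1).mono P.2.1

theorem measurableSet_joined (R : ℕ) : MeasurableSet (joined d 𝒟 R) := by
  have : joined d 𝒟 R = ⋃ (n : ℕ) (_ : n ≤ R) (A : AbstractSimplicialComplex (Fin n))
      (h2 : IsTwoDimensional A) (hc : (skeleton A).Connected) (b : TangentVector A)
      (b' : TangentVector A),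
      TwiceMarkedPatch.cylinder ⟨⟨n, A, h2, hc, b, Set.univ, MeasurableSet.univ⟩, b'⟩ d := by
    ext γ
    simp only [joined, Set.mem_iUnion]
    constructor
    · rintro ⟨⟨⟨⟨n, A, h2, hc, b, Ω, hΩ⟩, b'⟩, hn, hu⟩, h⟩
      replace h : γ ∈ TwiceMarkedPatch.cylinder ⟨⟨n, A, h2, hc, b, Ω, hΩ⟩, b'⟩ d := h
      change Ω = Set.univ at hu
      subst hu
      exact ⟨n, hn, A, h2, hc, b, b', h⟩
    · rintro ⟨n, hn, A, h2, hc, b, b', h⟩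
      exact ⟨⟨⟨⟨n, A, h2, hc, b, Set.univ, MeasurableSet.univ⟩, b'⟩, hn, rfl⟩, h⟩
  rw [this]
  exact MeasurableSet.iUnion fun n => MeasurableSet.iUnion fun _ => MeasurableSet.iUnion fun A =>
    MeasurableSet.iUnion fun h2 => MeasurableSet.iUnion fun hc => MeasurableSet.iUnion fun b =>
      MeasurableSet.iUnion fun b' => measurableSet_twiceMarkedCylinder _

theorem monotone_joined : Monotone (joined d 𝒟) := fun _ R' h =>
  Set.iUnion_subset fun P => Set.subset_iUnion
    (fun P : {P : TwiceMarkedPatch 𝒟 // P.size ≤ R' ∧ P.Ω = Set.univ} => P.1.cylinder d)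
    ⟨P.1, P.2.1.trans h, P.2.2⟩

theorem iUnion_joined : ⋃ R, joined d 𝒟 R = Set.univ := by
  refine Set.eq_univ_of_forall fun γ => ?_
  obtain ⟨T, x, y, rfl⟩ := γ.exists_mk
  obtain ⟨ρ, hρ⟩ := exists_vball T x.fst {y.fst}
  have hy := hρ y.fst (by simp)
  refine Set.mem_iUnion.2 ⟨_, Set.mem_iUnion.2
    ⟨⟨⟨ballPatch T x ρ Set.univ MeasurableSet.univ, starDart _ y hy⟩, le_rfl, rfl⟩, ?_⟩⟩
  exact Groupoid.mk_mem_cylinder.2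
    ⟨ballIncl T x ρ, starIncl_starDart x (mem_vball_self _ _), starIncl_starDart y hy, trivial⟩

/-- Measurable local sets form a π-system containing the generators, and on them the fibre measure
is a local, hence measurable, function. The π-system argument needs finite measures while fibres may
be infinite, so it is run on each `joined d 𝒟 R`, and these sets exhaust the groupoid. -/
theorem measurable_fibreMeasure : Measurable (fibreMeasure (d := d) (𝒟 := 𝒟)) := by
  have hR : ∀ R : ℕ, Measurable fun u : UnitSpace d 𝒟 => (fibreMeasure u).restrict (joined d 𝒟 R) := by
    intro R
    have hfin : ∀ u : UnitSpace d 𝒟, IsFiniteMeasure ((fibreMeasure u).restrict (joined d 𝒟 R)) :=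
      fun u => ⟨by
        rw [Measure.restrict_apply_univ]
        exact fibreMeasure_lt_top (measurableSet_joined R) (isLocalSet_joined R) u⟩
    refine Measurable.measure_of_isPiSystem
      (S := {E | MeasurableSet E ∧ ∃ ρ, IsLocalSet ρ E}) ?_ ?_ ?_ ?_
    · refine le_antisymm (MeasurableSpace.generateFrom_mono ?_)
        (MeasurableSpace.generateFrom_le fun E hE => hE.1)
      rintro _ ⟨P, rfl⟩
      exact ⟨measurableSet_twiceMarkedCylinder P, _, isLocalSet_cylinder P⟩
    · rintro E ⟨hE, ρ, h⟩ E' ⟨hE', ρ', h'⟩ -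
      exact ⟨hE.inter hE', _, h.inter h'⟩
    · rintro E ⟨hE, ρ, h⟩
      simp only [Measure.restrict_apply hE]
      exact (isLocal_fibreMeasure (hE.inter (measurableSet_joined R))
        (h.inter (isLocalSet_joined R))).measurable_fun
    · simp only [Measure.restrict_apply_univ]
      exact (isLocal_fibreMeasure (measurableSet_joined R) (isLocalSet_joined R)).measurable_fun
  refine Measure.measurable_of_measurable_coe _ fun E hE => ?_
  have : (fun u : UnitSpace d 𝒟 => fibreMeasure u E) =
      fun u => ⨆ R, (fibreMeasure u).restrict (joined d 𝒟 R) E := by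
    funext u
    simp only [Measure.restrict_apply hE]
    rw [← Monotone.measure_iUnion (fun _ _ h => Set.inter_subset_inter_right _ (monotone_joined h)),
      ← Set.inter_iUnion, iUnion_joined, Set.inter_univ]
  rw [this]
  exact Measurable.iSup fun R => (Measure.measurable_coe hE).comp (hR R)

end FibreMeasure

/-! ### The measure on the groupoid -/

section GroupoidMeasure

variable {d : ℕ} {𝒟 : Type*} [MeasurableSpace 𝒟] {ν : Measure (UnitSpace d 𝒟)}

theorem measurable_fibreMeasure_apply {E : Set (Groupoid d 𝒟)} (hE : MeasurableSet E) :
    Measurable fun u : UnitSpace d 𝒟 => fibreMeasure u E :=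
  (Measure.measurable_coe hE).comp measurable_fibreMeasure

theorem groupoidMeasure_apply {E : Set (Groupoid d 𝒟)} (hE : MeasurableSet E) :
    groupoidMeasure ν E = ∫⁻ u, fibreMeasure u E ∂ν :=
  Measure.bind_apply hE measurable_fibreMeasure.aemeasurable

theorem fibreMeasure_mk_eq_zero {T : DecoratedTriangulation d 𝒟} {x : T.S}
    {E : Set (Groupoid d 𝒟)} (hE : MeasurableSet E) :
    fibreMeasure (UnitSpace.mk T x) E = 0 ↔ ∀ y : T.S, Groupoid.mk T x y ∉ E := by
  rw [fibreMeasure_mk_apply T x hE, ENNReal.tsum_eq_zero]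
  simp

/-- Each fibre meets the diagonal in exactly one point. Consequently an element of `L²` has a
well-defined restriction to the units, up to `ν`-null sets. -/
theorem restrict_diagonal :
    (groupoidMeasure ν).restrict (diagonal d 𝒟) = ν.map UnitSpace.diag := by
  ext E hE
  rw [Measure.restrict_apply hE, Measure.map_apply measurable_diag hE,
    groupoidMeasure_apply (hE.inter measurableSet_diagonal),
    ← lintegral_indicator_one (measurable_diag hE)]
  refine lintegral_congr fun u => ?_
  obtain ⟨T, x, rfl⟩ := u.exists_mk
  rw [fibreMeasure_mk_apply T x (hE.inter measurableSet_diagonal), tsum_eq_single x]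
  · by_cases h : Groupoid.mk T x x ∈ E
    · have h' : UnitSpace.mk T x ∈ UnitSpace.diag ⁻¹' E := h
      rw [Set.indicator_of_mem (Set.mem_inter h (mk_mem_diagonal.2 rfl)), Set.indicator_of_mem h']
      rfl
    · have h' : UnitSpace.mk T x ∉ UnitSpace.diag ⁻¹' E := h
      rw [Set.indicator_of_notMem (fun h'' => h h''.1), Set.indicator_of_notMem h']
  · intro y hy
    exact Set.indicator_of_notMem (fun h => hy (mk_mem_diagonal.1 h.2).symm) _

theorem groupoidMeasure_diagonal : groupoidMeasure ν (diagonal d 𝒟) = ν Set.univ := by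
  have := congrArg (fun μ => μ Set.univ) (restrict_diagonal (ν := ν))
  simpa [Measure.map_apply measurable_diag MeasurableSet.univ] using this

/-- A null set for counting measure is empty, so by invariance under inversion `ν`-almost every `z`
has no `y` with `(y, z)` in the exceptional set `N`. The remaining `z` form the `ν`-null set `Z`;
elements with range in `Z` are null, and a second inversion makes those with source in `Z` null. -/
theorem IsTransverse.ae_forall_fibre (hν : IsTransverse ν) {p : Groupoid d 𝒟 → Prop}
    (hp : ∀ᵐ γ ∂groupoidMeasure ν, p γ) :
    ∀ᵐ γ ∂groupoidMeasure ν, ∀ (T : DecoratedTriangulation d 𝒟) (x z : T.S),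
      γ = Groupoid.mk T x z → ∀ y, p (Groupoid.mk T y z) := by
  obtain ⟨N, hpN, hN, hN0⟩ := exists_measurable_superset_of_null hp
  have hinv : ∀ {E : Set (Groupoid d 𝒟)}, MeasurableSet E →
      groupoidMeasure ν (Groupoid.inv ⁻¹' E) = groupoidMeasure ν E := fun hE => by
    rw [← Measure.map_apply measurable_groupoid_inv hE, hν]
  have hN' := measurable_groupoid_inv hN
  have hZ : MeasurableSet {u : UnitSpace d 𝒟 | fibreMeasure u (Groupoid.inv ⁻¹' N) ≠ 0} :=
    (measurable_fibreMeasure_apply hN')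
      (measurableSet_singleton (0 : ℝ≥0∞)).compl
  set Z := {u : UnitSpace d 𝒟 | fibreMeasure u (Groupoid.inv ⁻¹' N) ≠ 0} with hZdef
  have hZ0 : ν Z = 0 := by
    have h := hinv hN
    rw [hN0, groupoidMeasure_apply hN', lintegral_eq_zero_iff
      (measurable_fibreMeasure_apply hN')] at h
    exact h
  have hrZ := measurable_groupoid_range hZ
  have h0 : groupoidMeasure ν (Groupoid.inv ⁻¹' (Groupoid.range ⁻¹' Z)) = 0 := by
    rw [hinv hrZ, groupoidMeasure_apply hrZ, lintegral_eq_zero_iff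
      (measurable_fibreMeasure_apply hrZ)]
    have : ∀ᵐ u ∂ν, u ∉ Z := measure_eq_zero_iff_ae_notMem.1 hZ0
    filter_upwards [this] with u hu
    obtain ⟨T, x, rfl⟩ := u.exists_mk
    exact (fibreMeasure_mk_eq_zero hrZ).2 fun y => hu
  filter_upwards [measure_eq_zero_iff_ae_notMem.1 h0] with γ hγ
  rintro T x z rfl y
  have hz : UnitSpace.mk T z ∉ Z := hγ
  have hz0 : fibreMeasure (UnitSpace.mk T z) (Groupoid.inv ⁻¹' N) = 0 := by
    simpa [hZdef] using hz
  by_contra hpy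
  exact (fibreMeasure_mk_eq_zero hN').1 hz0 y (hpN hpy)

end GroupoidMeasure

/-! ### Powers of the kernel of a leafwise operator -/

section Powers

variable {d : ℕ} {𝒟 : Type*} [MeasurableSpace 𝒟]

theorem conv_mk (f φ : Groupoid d 𝒟 → ℂ) (T : DecoratedTriangulation d 𝒟) (x z : T.S) :
    conv f φ (Groupoid.mk T x z) = ∑' y : T.S, f (Groupoid.mk T x y) * φ (Groupoid.mk T y z) := rfl

theorem diagFun_mk (T : DecoratedTriangulation d 𝒟) (x y : T.S) :
    diagFun (Groupoid.mk T x y) = if x = y then 1 else 0 := by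
  classical
  rw [diagFun, Set.indicator_apply]
  simp [mk_mem_diagonal]

/-- The convolution powers of the kernel of a leafwise operator. -/
def LeafwiseOperator.kernelPow (F : LeafwiseOperator d 𝒟) : ℕ → Groupoid d 𝒟 → ℂ
  | 0 => diagFun
  | n + 1 => conv F.kernel (F.kernelPow n)

theorem delta_apply {T : DecoratedTriangulation d 𝒟} (x y : T.S) :
    delta y x = if x = y then (1 : ℂ) else 0 := by
  rw [delta, lp.single_apply]
  by_cases h : x = y
  · subst h; simp
  · simp [h]

/-- The vector `M (delta y)` is expanded in the basis `delta w`; both `L` and evaluation at `x` are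
continuous and pass through the sum. -/
theorem entry_mul {T : DecoratedTriangulation d 𝒟} (L M : LeafSpace T →L[ℂ] LeafSpace T)
    (x y : T.S) : entry (L * M) x y = ∑' w, entry L x w * entry M w y := by
  classical
  have h1 : HasSum (fun w => lp.single 2 w ((M (delta y)) w)) (M (delta y)) :=
    lp.hasSum_single (by simp) _
  have h2 := (h1.mapL L).mapL (lp.evalCLM ℂ (fun _ : T.S => ℂ) 2 x)
  have h3 : (fun w => entry L x w * entry M w y) = fun w =>
      lp.evalCLM ℂ (fun _ : T.S => ℂ) 2 x (L (lp.single 2 w ((M (delta y)) w))) := by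
    funext w
    have : (lp.single 2 w ((M (delta y)) w) : LeafSpace T) = (M (delta y)) w • delta w := by
      refine lp.ext (funext fun z => ?_)
      rw [lp.coeFn_smul, Pi.smul_apply, delta_apply, lp.single_apply]
      by_cases h : z = w
      · subst h; simp
      · simp [h]
    rw [this, map_smul, map_smul, smul_eq_mul, mul_comm]
    rfl
  rw [h3]
  exact h2.tsum_eq.symm

theorem LeafwiseOperator.entry_pow (F : LeafwiseOperator d 𝒟) (n : ℕ)
    (T : DecoratedTriangulation d 𝒟) (x y : T.S) :
    entry (F.op T ^ n) x y = F.kernelPow n (Groupoid.mk T x y) := by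
  classical
  induction n generalizing x with
  | zero =>
    rw [pow_zero, kernelPow, diagFun_mk]
    exact delta_apply x y
  | succ n ih =>
    rw [pow_succ', entry_mul, kernelPow, conv_mk]
    exact tsum_congr fun w => by rw [ih, F.kernel_mk]

theorem mem_ball_comm {T : DecoratedTriangulation d 𝒟} {x y : T.S} {r : ℕ} :
    y ∈ ball x r ↔ x ∈ ball y r := by
  rw [mem_ball_iff, mem_ball_iff, mem_vball_comm, mem_vball_comm (c := x.snd)]

theorem finite_ball {T : DecoratedTriangulation d 𝒟} (x : T.S) (r : ℕ) : (ball x r).Finite :=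
  (finite_tangentVectors T x.fst (1 + r)).subset fun _ ha =>
    ball_subset_vball (mem_vball_self _ _) (mem_vball_one_of_adj x.adj) ha

variable {F : LeafwiseOperator d 𝒟} {r : ℕ}

/-- The hopping range controls columns; symmetry of the relation `y ∈ ball x r` transfers this to
rows, so the sum is finite. -/
theorem LeafwiseOperator.HasHoppingRange.conv_mk (hF : F.HasHoppingRange r)
    (φ : Groupoid d 𝒟 → ℂ) (T : DecoratedTriangulation d 𝒟) (x z : T.S) :
    conv F.kernel φ (Groupoid.mk T x z) = ∑ y ∈ (finite_ball x r).toFinset,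
      F.kernel (Groupoid.mk T x y) * φ (Groupoid.mk T y z) := by
  rw [TriangulationSpace.conv_mk]
  refine tsum_eq_sum fun y hy => ?_
  rw [F.kernel_mk, hF.support T y x, zero_mul]
  rw [mem_ball_comm]
  simpa using hy

/-- Each factor of the kernel moves the first argument by at most `r`, so the induction replaces `k`
by `k + r` while spending one factor. The last `r` in the budget leaves room for the whole ball
around an intermediate point. -/
theorem LeafwiseOperator.HasHoppingRange.kernelPow_congr (hF : F.HasHoppingRange r)
    {T U : DecoratedTriangulation d 𝒟} {x : T.S} {y : U.S} {ρ : ℕ} {g : T.verts → U.verts}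
    (h : IsLocalIso x y ρ g) (n : ℕ) {k : ℕ} (hk : k + n * r + r ≤ ρ) {w a : T.S} {w' a' : U.S}
    (hw1 : w.fst ∈ vball (skeleton T.K) x.fst k) (hw2 : w.snd ∈ vball (skeleton T.K) x.fst k)
    (ha1 : a.fst ∈ vball (skeleton T.K) x.fst ρ) (ha2 : a.snd ∈ vball (skeleton T.K) x.fst ρ)
    (hw1' : w'.fst = g w.fst) (hw2' : w'.snd = g w.snd)
    (ha1' : a'.fst = g a.fst) (ha2' : a'.snd = g a.snd) :
    F.kernelPow n (Groupoid.mk U w' a') = F.kernelPow n (Groupoid.mk T w a) := by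
  classical
  have hinj : ∀ {b c : T.S} {b' c' : U.S}, b.fst ∈ vball (skeleton T.K) x.fst ρ →
      b.snd ∈ vball (skeleton T.K) x.fst ρ → c.fst ∈ vball (skeleton T.K) x.fst ρ →
      c.snd ∈ vball (skeleton T.K) x.fst ρ → b'.fst = g b.fst → b'.snd = g b.snd →
      c'.fst = g c.fst → c'.snd = g c.snd → b' = c' → b = c := by
    intro b c b' c' hb1 hb2 hc1 hc2 e1 e2 e3 e4 he
    have hinj := h.injOn.mono (vball_mono _ (Nat.le_succ ρ))
    exact ext_tangentVector (hinj hb1 hc1 (by rw [← e1, ← e3, he]))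
      (hinj hb2 hc2 (by rw [← e2, ← e4, he]))
  induction n generalizing k w w' with
  | zero =>
    have hkρ : k ≤ ρ := by omega
    simp only [kernelPow, diagFun_mk]
    refine if_congr ⟨hinj (vball_mono _ hkρ hw1) (vball_mono _ hkρ hw2) ha1 ha2 hw1' hw2' ha1' ha2',
      ?_⟩ rfl rfl
    rintro rfl
    exact ext_tangentVector (hw1'.trans ha1'.symm) (hw2'.trans ha2'.symm)
  | succ n ih =>
    have hk' : k + r + n * r + r ≤ ρ := by rw [Nat.succ_mul] at hk; omega
    have hkr : k + r ≤ ρ := by omega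
    have hkrr : (k + r) + r ≤ ρ := by omega
    have hb : ∀ b ∈ ball w r, b.fst ∈ vball (skeleton T.K) x.fst (k + r) ∧
      b.snd ∈ vball (skeleton T.K) x.fst (k + r) := fun b hb => ball_subset_vball hw1 hw2 hb
    have : Nonempty U.S := ⟨y⟩
    choose! m hm1 hm2 using fun (b : T.S) (hbw : b ∈ ball w r) =>
      h.exists_map (vball_mono _ hkr (hb b hbw).1)
    rw [kernelPow, hF.conv_mk, hF.conv_mk]
    symm
    have hmem : ∀ b ∈ ball w r, m b ∈ ball w' r := fun b hbw =>
      (h.mem_ball_iff hkr hw1 hw2 hw1' hw2' (vball_mono _ (by omega) (hb b hbw).1)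
        (vball_mono _ (by omega) (hb b hbw).2) (hm1 b hbw) (hm2 b hbw)).2 hbw
    refine Finset.sum_nbij m ?_ ?_ ?_ ?_
    · intro b hbw
      rw [Set.Finite.mem_toFinset] at hbw ⊢
      exact hmem b hbw
    · intro b hbw c hcw hbc
      rw [Set.Finite.coe_toFinset] at hbw hcw
      exact hinj (vball_mono _ hkr (hb b hbw).1) (vball_mono _ hkr (hb b hbw).2)
        (vball_mono _ hkr (hb c hcw).1) (vball_mono _ hkr (hb c hcw).2)
        (hm1 b hbw) (hm2 b hbw) (hm1 c hcw) (hm2 c hcw) hbc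
    · intro b' hb'
      rw [Set.Finite.coe_toFinset] at hb'
      obtain ⟨b, hbw, e1, e2⟩ := h.exists_lift hkr hw1 hw2 hw1' hw2' hb'
      refine ⟨b, by rwa [Set.Finite.coe_toFinset], ?_⟩
      exact ext_tangentVector ((hm1 b hbw).trans e1.symm) ((hm2 b hbw).trans e2.symm)
    · intro b hbw
      rw [Set.Finite.mem_toFinset] at hbw
      rw [ih hk' (hb b hbw).1 (hb b hbw).2 (hm1 b hbw) (hm2 b hbw), F.kernel_mk, F.kernel_mk]
      congr 1
      -- The locality hypothesis concerns the column of `b`, so the ball isomorphism is centred at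
      -- `b` rather than at `w`.
      exact (hF.local_eq T U b (m b) g
        (h.isBallIso hkrr (hb b hbw).1 (hb b hbw).2 (hm1 b hbw) (hm2 b hbw)) w
        (mem_ball_comm.1 hbw) w' (mem_ball_comm.1 (hmem b hbw)) hw1' hw2').symm

theorem LeafwiseOperator.HasHoppingRange.measurable_kernelPow_withDec (hF : F.HasHoppingRange r)
    (n : ℕ) (T : DecoratedTriangulation d 𝒟) (x z : T.S) :
    Measurable fun ω : T.S → 𝒟 => F.kernelPow n (Groupoid.mk (T.withDec ω) x z) := by
  classical
  induction n generalizing x with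
  | zero =>
    have : (fun ω : T.S → 𝒟 => F.kernelPow 0 (Groupoid.mk (T.withDec ω) x z)) =
        fun _ => if x = z then 1 else 0 := funext fun ω => diagFun_mk (T.withDec ω) x z
    rw [this]
    exact measurable_const
  | succ n ih =>
    have : (fun ω : T.S → 𝒟 => F.kernelPow (n + 1) (Groupoid.mk (T.withDec ω) x z)) =
        fun ω => ∑ y ∈ (finite_ball x r).toFinset, F.kernel (Groupoid.mk (T.withDec ω) x y) *
          F.kernelPow n (Groupoid.mk (T.withDec ω) y z) :=
      funext fun ω => hF.conv_mk _ (T.withDec ω) x z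
    rw [this]
    exact Finset.measurable_sum _ fun y _ =>
      (F.measurable_kernel.comp (measurable_groupoid_mk_withDec T x y)).mul (ih y)

/-- The summand `1` in the radius is the distance from the tail of `x`, where balls are centred, to
its head. -/
theorem LeafwiseOperator.HasHoppingRange.isLocal_kernelPow (hF : F.HasHoppingRange r) (n : ℕ) :
    IsLocal (1 + n * r + r) fun u : UnitSpace d 𝒟 => F.kernelPow n u.diag where
  congr T U x y g h := (hF.kernelPow_congr h n le_rfl (mem_vball_self _ _)
    (mem_vball_one_of_adj x.adj) (mem_vball_self _ _)
    (vball_mono _ (by omega) (mem_vball_one_of_adj x.adj)) h.map_fst.symm h.map_snd.symm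
    h.map_fst.symm h.map_snd.symm).symm
  measurable T x := hF.measurable_kernelPow_withDec n T x x

end Powers

/-! ### The diagonal function as a vector of `L²` -/

section DiagonalVector

variable {d : ℕ} {𝒟 : Type*} [MeasurableSpace 𝒟] {ν : Measure (UnitSpace d 𝒟)}

theorem eLpNorm_comp_diag_le {ψ : Groupoid d 𝒟 → ℂ} (hψ : StronglyMeasurable ψ) :
    eLpNorm (fun u : UnitSpace d 𝒟 => ψ u.diag) 2 ν ≤ eLpNorm ψ 2 (groupoidMeasure ν) := by
  have := eLpNorm_map_measure (μ := ν) (f := UnitSpace.diag) (g := ψ) (p := 2)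
    hψ.aestronglyMeasurable measurable_diag.aemeasurable
  rw [← restrict_diagonal] at this
  exact this.symm.trans_le (eLpNorm_mono_measure _ Measure.restrict_le_self)

theorem memLp_comp_diag (ψ : L2 ν) : MemLp (fun u : UnitSpace d 𝒟 => ψ u.diag) 2 ν :=
  ⟨((Lp.stronglyMeasurable ψ).comp_measurable measurable_diag).aestronglyMeasurable,
    (eLpNorm_comp_diag_le (Lp.stronglyMeasurable ψ)).trans_lt (Lp.eLpNorm_lt_top ψ)⟩

theorem ae_diag_of_ae {p : Groupoid d 𝒟 → Prop} (h : ∀ᵐ γ ∂groupoidMeasure ν, p γ) :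
    ∀ᵐ u ∂ν, p u.diag := by
  refine ae_of_ae_map measurable_diag.aemeasurable ?_
  rw [← restrict_diagonal]
  exact ae_restrict_of_ae h

variable [IsFiniteMeasure ν]

theorem integrable_comp_diag (ψ : L2 ν) : Integrable (fun u : UnitSpace d 𝒟 => ψ u.diag) ν :=
  (memLp_comp_diag ψ).integrable (by norm_num)

/-- Cauchy–Schwarz against the constant `1` on `E`, after restriction to the diagonal. The factor
`√(ν.real E)` later makes the contribution of an exceptional set small. -/
theorem setIntegral_norm_comp_diag_le (ψ : L2 ν) (E : Set (UnitSpace d 𝒟)) :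
    ∫ u in E, ‖ψ u.diag‖ ∂ν ≤ ‖ψ‖ * √(ν.real E) := by
  have hm := (memLp_comp_diag ψ).restrict E
  have h1 := eLpNorm_le_eLpNorm_mul_rpow_measure_univ (p := 1) (q := 2) (by norm_num) hm.1
  rw [Measure.restrict_apply_univ] at h1
  have h2 : eLpNorm (fun u : UnitSpace d 𝒟 => ψ u.diag) 2 (ν.restrict E) ≤
      eLpNorm ψ 2 (groupoidMeasure ν) :=
    (eLpNorm_mono_measure _ Measure.restrict_le_self).trans
      (eLpNorm_comp_diag_le (Lp.stronglyMeasurable ψ))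
  have h3 := h1.trans (mul_le_mul_left h2 _)
  have h4 := ENNReal.toReal_mono (ENNReal.mul_ne_top (Lp.eLpNorm_ne_top ψ)
    (ENNReal.rpow_ne_top_of_nonneg (by norm_num) (measure_ne_top ν E))) h3
  rw [ENNReal.toReal_mul, ← ENNReal.toReal_rpow, ← Lp.norm_def] at h4
  rw [integral_norm_eq_lintegral_enorm hm.1, ← eLpNorm_one_eq_lintegral_enorm]
  refine h4.trans_eq ?_
  rw [Real.sqrt_eq_rpow]
  norm_num [Measure.real]

theorem memLp_diagFun : MemLp (diagFun (d := d) (𝒟 := 𝒟)) 2 (groupoidMeasure ν) :=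
  memLp_indicator_const 2 measurableSet_diagonal 1
    (Or.inr (by rw [groupoidMeasure_diagonal]; exact measure_ne_top _ _))

/-- The diagonal function as an element of `L²`. -/
def diagVec (ν : Measure (UnitSpace d 𝒟)) [IsFiniteMeasure ν] : L2 ν :=
  memLp_diagFun.toLp diagFun

theorem norm_diagVec : ‖diagVec ν‖ = √(ν.real Set.univ) := by
  rw [diagVec, Lp.norm_toLp]
  have := eLpNorm_indicator_const (μ := groupoidMeasure ν) (c := (1 : ℂ)) (p := 2)
    (measurableSet_diagonal (d := d) (𝒟 := 𝒟)) (by norm_num) (by norm_num)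
  change (eLpNorm ((diagonal d 𝒟).indicator fun _ => (1 : ℂ)) 2 (groupoidMeasure ν)).toReal = _
  rw [this, groupoidMeasure_diagonal, Real.sqrt_eq_rpow]
  simp [Measure.real, ENNReal.toReal_rpow]

theorem diagonalEntry_eq (K : L2 ν →L[ℂ] L2 ν) (u : UnitSpace d 𝒟) :
    diagonalEntry ν K u = K (diagVec ν) u.diag := by
  rw [diagonalEntry, dif_pos memLp_diagFun]
  rfl

theorem setIntegral_norm_diagonal_le (K : L2 ν →L[ℂ] L2 ν) (E : Set (UnitSpace d 𝒟)) :
    ∫ u in E, ‖K (diagVec ν) u.diag‖ ∂ν ≤ ‖K‖ * √(ν.real Set.univ) * √(ν.real E) := by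
  refine (setIntegral_norm_comp_diag_le _ E).trans ?_
  gcongr
  exact (K.le_opNorm _).trans_eq (by rw [norm_diagVec])

variable {H : L2 ν →L[ℂ] L2 ν} {F : LeafwiseOperator d 𝒟}

/-- The convolution at `(x, z)` involves the values at all `(y, z)`, where the induction hypothesis
holds only almost everywhere. Transversality, through `ae_forall_fibre`, provides it for all `y` of
the leaf at once. -/
theorem IsLeafwise.pow_diagVec (hν : IsTransverse ν) (hF : IsLeafwise ν H F) (n : ℕ) :
    (H ^ n) (diagVec ν) =ᵐ[groupoidMeasure ν] F.kernelPow n := by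
  induction n with
  | zero => exact memLp_diagFun.coeFn_toLp
  | succ n ih =>
    have h1 := hF ((H ^ n) (diagVec ν))
    have h2 : (H ^ (n + 1)) (diagVec ν) = H ((H ^ n) (diagVec ν)) := by
      rw [pow_succ']; rfl
    rw [h2]
    filter_upwards [h1, hν.ae_forall_fibre ih] with γ h1 h3
    rw [h1]
    obtain ⟨T, x, z, rfl⟩ := γ.exists_mk
    rw [LeafwiseOperator.kernelPow, conv_mk, conv_mk]
    exact tsum_congr fun y => by rw [h3 T x z rfl y]

theorem IsLeafwise.ae_pow_diagVec (hν : IsTransverse ν) (hF : IsLeafwise ν H F) (n : ℕ) :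
    ∀ᵐ u ∂ν, (H ^ n) (diagVec ν) (UnitSpace.diag u) = F.kernelPow n u.diag :=
  ae_diag_of_ae (hF.pow_diagVec hν n)

end DiagonalVector

/-! ### Polynomial approximation with a controlled error at infinity -/

section Approximation

theorem Polynomial.abs_eval_le (p : Polynomial ℝ) {C t : ℝ} (hC : 0 < C) (ht : C ≤ |t|) :
    |p.eval t| ≤ (∑ i ∈ Finset.range (p.natDegree + 1), |p.coeff i| * C ^ i) *
      (|t| / C) ^ p.natDegree := by
  have hs : 1 ≤ |t| / C := (one_le_div hC).2 ht
  rw [Polynomial.eval_eq_sum_range, Finset.sum_mul]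
  refine (Finset.abs_sum_le_sum_abs _ _).trans (Finset.sum_le_sum fun i hi => ?_)
  rw [abs_mul, abs_pow, mul_assoc]
  gcongr
  calc |t| ^ i = C ^ i * (|t| / C) ^ i := by rw [← mul_pow, mul_div_cancel₀ _ hC.ne']
    _ ≤ _ := by
      gcongr
      exact Nat.lt_succ_iff.1 (Finset.mem_range.1 hi)

/-- Weierstrass approximation handles `|t| ≤ 2C`. Beyond that `|t| / C ≥ 2`, and a high even power
dominates both `φ` and `p`. The polynomial is fixed before `N`, so `N` can still be increased for
another purpose. -/
theorem exists_polynomial_approx {φ : ℝ → ℝ} (hφ : Continuous φ) {Φ : ℝ} (hΦ : ∀ t, |φ t| ≤ Φ)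
    {C ε : ℝ} (hC : 0 < C) (hε : 0 < ε) : ∃ (p : Polynomial ℝ) (N₀ : ℕ), ∀ N, N₀ ≤ N → ∀ t,
      |φ t - p.eval t| ≤ ε + ε * (t / C) ^ (2 * N) := by
  obtain ⟨p, hp⟩ := exists_polynomial_near_of_continuousOn (-(2 * C)) (2 * C) φ
    hφ.continuousOn ε hε
  set A := ∑ i ∈ Finset.range (p.natDegree + 1), |p.coeff i| * C ^ i with hA
  have hA0 : 0 ≤ A := Finset.sum_nonneg fun i _ => by positivity
  have hΦ0 : 0 ≤ Φ := (abs_nonneg _).trans (hΦ 0)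
  -- The factor `2 ^ M` absorbs the constant `(Φ + A) / ε`; for this `2 * N` has to exceed the
  -- degree of `p` by at least `M`.
  obtain ⟨M, hM⟩ := pow_unbounded_of_one_lt ((Φ + A) / ε) (one_lt_two (α := ℝ))
  refine ⟨p, p.natDegree + M, fun N hN t => ?_⟩
  have hpow : (t / C) ^ (2 * N) = (|t| / C) ^ (2 * N) := by
    rw [pow_mul, pow_mul, div_pow t, div_pow |t|, sq_abs]
  by_cases ht : |t| ≤ 2 * C
  · have h := hp t (abs_le.1 ht)
    rw [abs_sub_comm] at h
    have : 0 ≤ ε * (t / C) ^ (2 * N) := by rw [hpow]; positivity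
    linarith
  · push Not at ht
    have hs : 2 ≤ |t| / C := (le_div_iff₀ hC).2 ht.le
    have hs1 : 1 ≤ |t| / C := by linarith
    have h1 := Polynomial.abs_eval_le p hC (t := t) (by linarith)
    have h2 : |φ t - p.eval t| ≤ (Φ + A) * (|t| / C) ^ p.natDegree := by
      have h3 : Φ ≤ Φ * (|t| / C) ^ p.natDegree := le_mul_of_one_le_right hΦ0 (one_le_pow₀ hs1)
      calc |φ t - p.eval t| ≤ |φ t| + |p.eval t| := abs_sub _ _
        _ ≤ Φ * (|t| / C) ^ p.natDegree + A * (|t| / C) ^ p.natDegree :=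
            add_le_add ((hΦ t).trans h3) h1
        _ = _ := by ring
    have h4 : (Φ + A) * (|t| / C) ^ p.natDegree ≤ ε * (|t| / C) ^ (2 * N) := by
      have h5 : (2 : ℝ) ^ M ≤ (|t| / C) ^ (2 * N - p.natDegree) :=
        (pow_le_pow_left₀ (by norm_num) hs M).trans (pow_le_pow_right₀ hs1 (by omega))
      have h6 : Φ + A ≤ ε * (|t| / C) ^ (2 * N - p.natDegree) := by
        rw [div_lt_iff₀ hε] at hM
        nlinarith
      calc (Φ + A) * (|t| / C) ^ p.natDegree
          ≤ ε * (|t| / C) ^ (2 * N - p.natDegree) * (|t| / C) ^ p.natDegree := by gcongr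
        _ = ε * (|t| / C) ^ (2 * N) := by
            rw [mul_assoc, ← pow_add, Nat.sub_add_cancel (by omega)]
    rw [hpow]
    linarith

variable {E : Type*} [NormedAddCommGroup E] [InnerProductSpace ℂ E] [CompleteSpace E]

theorem re_inner_mono {A B : E →L[ℂ] E} (h : A ≤ B) (v : E) :
    (inner ℂ v (A v)).re ≤ (inner ℂ v (B v)).re := by
  have h1 := (ContinuousLinearMap.le_def A B).1 h
  have h2 := h1.re_inner_nonneg_right v
  rw [sub_apply, inner_sub_right, map_sub] at h2
  exact sub_nonneg.1 h2

theorem IsSelfAdjoint.inner_eq_re {A : E →L[ℂ] E} (h : IsSelfAdjoint A) (v : E) :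
    inner ℂ v (A v) = ((inner ℂ v (A v)).re : ℂ) := by
  refine (Complex.conj_eq_iff_re.1 ?_).symm
  rw [inner_conj_symm]
  exact h.isSymmetric v v

/-- The functional calculus turns the scalar bound on the whole line into operator inequalities `-Q
≤ φ(A) - p(A) ≤ Q` with `Q = ε + δ A ^ m`, which are then tested on `v`. No bound on `‖A‖` enters,
so the estimate applies on every leaf. -/
theorem norm_inner_cfc_sub_le {A : E →L[ℂ] E} (hA : IsSelfAdjoint A) {φ : ℝ → ℝ}
    (hφ : Continuous φ) (p : Polynomial ℝ) {ε δ : ℝ} {m : ℕ}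
    (h : ∀ t, |φ t - p.eval t| ≤ ε + δ * t ^ m) (v : E) :
    ‖inner ℂ v ((applyFun φ A - Polynomial.aeval A p) v)‖ ≤
      ε * ‖v‖ ^ 2 + δ * (inner ℂ v ((A ^ m) v)).re := by
  have hK : applyFun φ A - Polynomial.aeval A p = cfc (fun t => φ t - p.eval t) A := by
    rw [applyFun, ← cfc_polynomial p A, ← cfc_sub (fun t => φ t) (fun t => p.eval t) A]
  have hQ : cfc (fun t : ℝ => ε + δ * t ^ m) A = ε • (1 : E →L[ℂ] E) + δ • A ^ m := by
    rw [cfc_add .., cfc_const_mul .., cfc_pow_id .., cfc_const .., Algebra.algebraMap_eq_smul_one]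
  have hQv : (inner ℂ v ((ε • (1 : E →L[ℂ] E) + δ • A ^ m) v)).re =
      ε * ‖v‖ ^ 2 + δ * (inner ℂ v ((A ^ m) v)).re := by
    rw [add_apply, smul_apply,
      smul_apply, one_apply_eq_self, inner_add_right,
      inner_smul_right_eq_smul, inner_smul_right_eq_smul, inner_self_eq_norm_sq_to_K,
      Complex.add_re, Complex.real_smul, Complex.real_smul, Complex.re_ofReal_mul,
      Complex.re_ofReal_mul]
    norm_cast
  have hle : cfc (fun t => φ t - p.eval t) A ≤ ε • (1 : E →L[ℂ] E) + δ • A ^ m := by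
    rw [← hQ]
    exact cfc_mono fun t _ => (abs_le.1 (h t)).2
  have hge : -(ε • (1 : E →L[ℂ] E) + δ • A ^ m) ≤ cfc (fun t => φ t - p.eval t) A := by
    rw [← hQ, ← cfc_neg]
    exact cfc_mono fun t _ => (abs_le.1 (h t)).1
  have h1 := re_inner_mono hle v
  have h2 := re_inner_mono hge v
  rw [neg_apply, inner_neg_right, Complex.neg_re] at h2
  rw [hQv] at h1 h2
  rw [hK, IsSelfAdjoint.inner_eq_re (cfc_predicate _ A) v, Complex.norm_real, Real.norm_eq_abs]
  exact abs_le.2 ⟨h2, h1⟩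

theorem norm_applyFun_le {A : E →L[ℂ] E} {φ : ℝ → ℝ} {Φ : ℝ} (hΦ : ∀ t, |φ t| ≤ Φ) :
    ‖applyFun φ A‖ ≤ Φ :=
  norm_cfc_le ((abs_nonneg _).trans (hΦ 0)) fun t _ => hΦ t

theorem norm_applyFun_sub_aeval_le {A : E →L[ℂ] E} (hA : IsSelfAdjoint A) {φ : ℝ → ℝ}
    (hφ : Continuous φ) (p : Polynomial ℝ) {c : ℝ} (hc : 0 ≤ c)
    (h : ∀ t, |t| ≤ ‖A‖ → |φ t - p.eval t| ≤ c) : ‖applyFun φ A - Polynomial.aeval A p‖ ≤ c := by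
  have hK : applyFun φ A - Polynomial.aeval A p = cfc (fun t => φ t - p.eval t) A := by
    rw [applyFun, ← cfc_polynomial p A, ← cfc_sub (fun t => φ t) (fun t => p.eval t) A]
  rw [hK]
  refine norm_cfc_le hc fun t ht => h t ?_
  -- Bounding the spectrum by the norm uses `‖1‖ = 1`, hence a nontrivial space; on the zero space
  -- the spectrum is empty.
  cases subsingleton_or_nontrivial E with
  | inl _ =>
    have : Subsingleton (E →L[ℂ] E) := inferInstance
    simp at ht
  | inr _ => exact spectrum.norm_le_norm_of_mem ht

end Approximation

/-! ### Local traces -/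

section LocalTrace

variable {d : ℕ} {𝒟 : Type*} [MeasurableSpace 𝒟]

theorem inner_delta {T : DecoratedTriangulation d 𝒟} (x : T.S) (f : LeafSpace T) :
    inner ℂ (delta x) f = f x := by
  rw [delta, lp.inner_single_left]
  simp

theorem norm_delta {T : DecoratedTriangulation d 𝒟} (x : T.S) : ‖delta x‖ = 1 := by
  rw [delta, lp.norm_single (by norm_num)]
  simp

theorem entry_eq_inner {T : DecoratedTriangulation d 𝒟} (L : LeafSpace T →L[ℂ] LeafSpace T)
    (x y : T.S) : entry L x y = inner ℂ (delta x) (L (delta y)) := (inner_delta x _).symm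

/-- The value at the marked tangent vector of the `n`-th power of the operator. -/
def LeafwiseOperator.moment (F : LeafwiseOperator d 𝒟) (n : ℕ) (u : UnitSpace d 𝒟) : ℝ :=
  (F.kernelPow n u.diag).re

/-- The value at the marked tangent vector of a polynomial of the operator. -/
def LeafwiseOperator.polyMoment (F : LeafwiseOperator d 𝒟) (p : Polynomial ℝ)
    (u : UnitSpace d 𝒟) : ℝ :=
  ∑ i ∈ Finset.range (p.natDegree + 1), p.coeff i * F.moment i u

variable {F : LeafwiseOperator d 𝒟}

theorem LeafwiseOperator.ofReal_moment (hF : ∀ T, IsSelfAdjoint (F.op T)) (n : ℕ)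
    (u : UnitSpace d 𝒟) : (F.moment n u : ℂ) = F.kernelPow n u.diag := by
  obtain ⟨T, x, rfl⟩ := u.exists_mk
  change (((F.kernelPow n (Groupoid.mk T x x)).re : ℝ) : ℂ) = F.kernelPow n (Groupoid.mk T x x)
  rw [← F.entry_pow, entry_eq_inner]
  exact (IsSelfAdjoint.inner_eq_re ((hF T).pow n) _).symm

theorem LeafwiseOperator.ofReal_polyMoment (hF : ∀ T, IsSelfAdjoint (F.op T)) (p : Polynomial ℝ)
    (T : DecoratedTriangulation d 𝒟) (x : T.S) :
    (F.polyMoment p (UnitSpace.mk T x) : ℂ) = entry (Polynomial.aeval (F.op T) p) x x := by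
  rw [polyMoment, Polynomial.aeval_eq_sum_range, entry_eq_inner, sum_apply,
    inner_sum, Complex.ofReal_sum]
  refine Finset.sum_congr rfl fun i _ => ?_
  rw [smul_apply, inner_smul_right_eq_smul, ← entry_eq_inner, F.entry_pow,
    Complex.ofReal_mul, F.ofReal_moment hF, Complex.real_smul]
  rfl

theorem LeafwiseOperator.localTrace_eq (F : LeafwiseOperator d 𝒟) (φ : ℝ → ℝ)
    (u : UnitSpace d 𝒟) : ∃ T x, u = UnitSpace.mk T x ∧
      F.localTrace φ u = entry (applyFun φ (F.op T)) x x :=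
  ⟨(Quotient.out u).1, (Quotient.out u).2, (Quotient.out_eq u).symm, rfl⟩

theorem LeafwiseOperator.norm_localTrace_le (F : LeafwiseOperator d 𝒟) {φ : ℝ → ℝ} {Φ : ℝ}
    (hΦ : ∀ t, |φ t| ≤ Φ) (u : UnitSpace d 𝒟) : ‖F.localTrace φ u‖ ≤ Φ := by
  obtain ⟨T, x, -, h⟩ := F.localTrace_eq φ u
  rw [h, entry_eq_inner]
  refine (norm_inner_le_norm _ _).trans ?_
  rw [norm_delta, one_mul]
  refine (ContinuousLinearMap.le_opNorm _ _).trans ?_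
  rw [norm_delta, mul_one]
  exact norm_applyFun_le hΦ

theorem LeafwiseOperator.norm_localTrace_sub_le (hF : ∀ T, IsSelfAdjoint (F.op T)) {φ : ℝ → ℝ}
    (hφ : Continuous φ) (p : Polynomial ℝ) {ε δ : ℝ} {m : ℕ}
    (h : ∀ t, |φ t - p.eval t| ≤ ε + δ * t ^ m) (u : UnitSpace d 𝒟) :
    ‖F.localTrace φ u - F.polyMoment p u‖ ≤ ε + δ * F.moment m u := by
  obtain ⟨T, x, rfl, hu⟩ := F.localTrace_eq φ u
  have h1 := norm_inner_cfc_sub_le (hF T) hφ p h (delta x)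
  rw [sub_apply, inner_sub_right, ← entry_eq_inner, ← entry_eq_inner,
    ← entry_eq_inner, F.entry_pow, norm_delta, one_pow, mul_one] at h1
  rw [hu, F.ofReal_polyMoment hF]
  exact h1

/-- The constant is the operator norm on the leaf of `u`, with no uniformity in `u`; the pointwise
limit behind `measurable_localTrace` needs no more. -/
theorem LeafwiseOperator.exists_moment_le (F : LeafwiseOperator d 𝒟) (u : UnitSpace d 𝒟) :
    ∃ c : ℝ, 0 ≤ c ∧ ∀ n, |F.moment n u| ≤ c ^ n := by
  obtain ⟨T, x, rfl⟩ := u.exists_mk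
  refine ⟨‖F.op T‖, norm_nonneg _, fun n => ?_⟩
  change |(F.kernelPow n (Groupoid.mk T x x)).re| ≤ _
  refine (Complex.abs_re_le_norm _).trans ?_
  rw [← F.entry_pow, entry_eq_inner]
  refine (norm_inner_le_norm _ _).trans ?_
  rw [norm_delta, one_mul]
  refine (ContinuousLinearMap.le_opNorm _ _).trans ?_
  rw [norm_delta, mul_one]
  have : Nontrivial (LeafSpace T) :=
    ⟨delta x, 0, norm_ne_zero_iff.1 (by rw [norm_delta]; exact one_ne_zero)⟩
  exact norm_pow_le _ n

/-- For self-adjoint `A` the moment of order `2n` is `‖A ^ n δ_x‖ ^ 2`. Positivity is what Markov's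
inequality requires. -/
theorem LeafwiseOperator.moment_even_nonneg (hF : ∀ T, IsSelfAdjoint (F.op T)) (n : ℕ)
    (u : UnitSpace d 𝒟) : 0 ≤ F.moment (2 * n) u := by
  obtain ⟨T, x, rfl⟩ := u.exists_mk
  change 0 ≤ (F.kernelPow (2 * n) (Groupoid.mk T x x)).re
  rw [← F.entry_pow, entry_eq_inner, two_mul, pow_add]
  have h := ((hF T).pow n).isSymmetric (delta x) ((F.op T ^ n) (delta x))
  change 0 ≤ (inner ℂ (delta x) ((F.op T ^ n) ((F.op T ^ n) (delta x)))).re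
  rw [show inner ℂ (delta x) ((F.op T ^ n) ((F.op T ^ n) (delta x))) = _ from h.symm]
  exact inner_self_nonneg (𝕜 := ℂ)

end LocalTrace

/-! ### Convergence of integrals of local functions -/

section Convergence

variable {d : ℕ} {𝒟 : Type*} [MeasurableSpace 𝒟] {ν : Measure (UnitSpace d 𝒟)}
  {ν' : ℕ → Measure (UnitSpace d 𝒟)} [IsFiniteMeasure ν] [∀ n, IsFiniteMeasure (ν' n)]

theorem isLocal_const {X : Type*} [MeasurableSpace X] (c : X) :
    IsLocal 0 fun _ : UnitSpace d 𝒟 => c :=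
  ⟨fun _ _ _ _ _ _ => rfl, fun _ _ => measurable_const⟩

theorem IsLocal.tendsto_measureReal {X : Type*} [MeasurableSpace X] {ρ : ℕ}
    {f : UnitSpace d 𝒟 → X} (hf : IsLocal ρ f) (h : PatchConverges ν' ν) {B : Set X}
    (hB : MeasurableSet B) :
    Tendsto (fun n => (ν' n).real (f ⁻¹' B)) atTop (𝓝 (ν.real (f ⁻¹' B))) :=
  (ENNReal.tendsto_toReal (measure_ne_top ν _)).comp (hf.tendsto_measure h hB)

/-- A constant function is local, so the whole unit space is itself a finite disjoint union of
cylinders and no mass is lost in the limit. -/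
theorem PatchConverges.tendsto_univ (h : PatchConverges ν' ν) :
    Tendsto (fun n => (ν' n).real Set.univ) atTop (𝓝 (ν.real Set.univ)) :=
  (isLocal_const (0 : ℝ)).tendsto_measureReal h MeasurableSet.univ

/-- Adding `K` makes `f` nonnegative, and the layer-cake formula writes its integral as that of `μ
(f + K ≥ t)` over `0 < t ≤ 2K`. For each `t` this is the measure of a level set of a local function,
so it converges; the total masses are bounded and dominate. -/
theorem IsLocal.tendsto_integral {ρ : ℕ} {f : UnitSpace d 𝒟 → ℝ} (hf : IsLocal ρ f) {K : ℝ}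
    (hK : ∀ u, |f u| ≤ K) (h : PatchConverges ν' ν) :
    Tendsto (fun n => ∫ u, f u ∂ν' n) atTop (𝓝 (∫ u, f u ∂ν)) := by
  have hint : ∀ (μ : Measure (UnitSpace d 𝒟)) [IsFiniteMeasure μ], Integrable f μ := fun μ _ =>
    Integrable.of_bound hf.measurable_fun.aestronglyMeasurable K (ae_of_all _ hK)
  have hcake : ∀ (μ : Measure (UnitSpace d 𝒟)) [IsFiniteMeasure μ], ∫ u, f u ∂μ =
      (∫ t in Set.Ioc 0 (2 * K), μ.real ((fun u => f u + K) ⁻¹' Set.Ici t)) -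
        K * μ.real Set.univ := by
    intro μ _
    have h1 := ((hint μ).add (integrable_const K)).integral_eq_integral_Ioc_meas_le (M := 2 * K)
      (ae_of_all _ fun u => by
        have := (abs_le.1 (hK u)).1; simp only [Pi.zero_apply, Pi.add_apply]; linarith)
      (ae_of_all _ fun u => by
        have := (abs_le.1 (hK u)).2; simp only [Pi.add_apply]; linarith)
    rw [integral_add' (hint μ) (integrable_const K), integral_const, smul_eq_mul] at h1
    rw [eq_sub_iff_add_eq, mul_comm, h1]
    rfl
  rw [hcake ν]
  simp only [hcake]
  refine Tendsto.sub ?_ (h.tendsto_univ.const_mul K)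
  obtain ⟨c, hc⟩ := h.tendsto_univ.bddAbove_range
  refine tendsto_integral_of_dominated_convergence (fun _ => c) ?_ ?_ ?_ ?_
  · intro n
    refine (Antitone.measurable fun s t hst => ?_).aestronglyMeasurable
    exact measureReal_mono (Set.preimage_mono (Set.Ici_subset_Ici.2 hst))
  · exact integrable_const c
  · refine fun n => ae_of_all _ fun t => ?_
    rw [Real.norm_eq_abs, abs_of_nonneg measureReal_nonneg]
    exact (measureReal_mono (Set.subset_univ _)).trans (hc ⟨n, rfl⟩)
  · exact ae_of_all _ fun t =>
      (hf.comp (measurable_id.add_const K)).tendsto_measureReal h measurableSet_Ici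

end Convergence

/-! ### Moments -/

section Moments

variable {d : ℕ} {𝒟 : Type*} [MeasurableSpace 𝒟] {F : LeafwiseOperator d 𝒟} {r : ℕ}

/-- Truncating the index at `M` gives all entries a common radius. The sequence is then local as a
whole, and so is every measurable function of the moments up to order `M`. -/
theorem LeafwiseOperator.HasHoppingRange.isLocal_moments (hF : F.HasHoppingRange r) (M : ℕ) :
    IsLocal (1 + M * r + r) fun (u : UnitSpace d 𝒟) (i : ℕ) => F.moment (min i M) u :=
  IsLocal.pi fun i => ((hF.isLocal_kernelPow (min i M)).comp Complex.measurable_re).mono (by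
    have := Nat.mul_le_mul_right r (min_le_right i M)
    omega)

theorem LeafwiseOperator.HasHoppingRange.isLocal_polyMoment_indicator
    (hF : F.HasHoppingRange r) (p : Polynomial ℝ) (m : ℕ) (B : ℝ) :
    ∃ ρ, IsLocal ρ ({u | F.moment m u ≤ B}.indicator (F.polyMoment p)) := by
  set M := max p.natDegree m
  refine ⟨1 + M * r + r, ?_⟩
  have hmeas : Measurable ({v : ℕ → ℝ | v m ≤ B}.indicator fun v =>
      ∑ i ∈ Finset.range (p.natDegree + 1), p.coeff i * v i) :=
    Measurable.indicator (by fun_prop) (measurableSet_le (by fun_prop) measurable_const)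
  convert (hF.isLocal_moments M).comp hmeas using 1
  funext u
  have hm : min m M = m := min_eq_left (le_max_right _ _)
  have hp : F.polyMoment p u =
      ∑ i ∈ Finset.range (p.natDegree + 1), p.coeff i * F.moment (min i M) u := by
    refine Finset.sum_congr rfl fun i hi => ?_
    rw [min_eq_left ((Nat.lt_succ_iff.1 (Finset.mem_range.1 hi)).trans (le_max_left _ _))]
  by_cases h : F.moment m u ≤ B
  · rw [Set.indicator_of_mem (by exact h), Set.indicator_of_mem (by simpa [hm] using h), hp]
  · rw [Set.indicator_of_notMem (by exact h), Set.indicator_of_notMem (by simpa [hm] using h)]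

theorem LeafwiseOperator.HasHoppingRange.isLocal_moment (hF : F.HasHoppingRange r) (m : ℕ) :
    IsLocal (1 + m * r + r) (F.moment m) :=
  (hF.isLocal_kernelPow m).comp Complex.measurable_re

theorem LeafwiseOperator.HasHoppingRange.measurable_polyMoment (hF : F.HasHoppingRange r)
    (p : Polynomial ℝ) : Measurable (F.polyMoment p) :=
  Finset.measurable_sum _ fun i _ => (hF.isLocal_moment i).measurable_fun.const_mul _

theorem exists_polynomial_approx' {φ : ℝ → ℝ} (hφ : Continuous φ) {Φ : ℝ} (hΦ : ∀ t, |φ t| ≤ Φ)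
    {C ε : ℝ} (hC : 0 < C) (hε : 0 < ε) : ∃ (p : Polynomial ℝ) (N₀ : ℕ), ∀ N, N₀ ≤ N → ∀ t,
      |φ t - p.eval t| ≤ ε + ε / C ^ (2 * N) * t ^ (2 * N) := by
  obtain ⟨p, N₀, h⟩ := exists_polynomial_approx hφ hΦ hC hε
  refine ⟨p, N₀, fun N hN t => (h N hN t).trans_eq ?_⟩
  rw [div_pow]; ring

/-- The local trace is a pointwise limit of polynomial moments: the `j`-th approximation takes `C =
j + 1` and `ε = 1 / (j + 1)`, and once `j + 1` exceeds the growth rate of the moments at `u` the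
error is at most `2 / (j + 1)`. This also avoids any measurability question about `Quotient.out`. -/
theorem LeafwiseOperator.HasHoppingRange.measurable_localTrace (hF : F.HasHoppingRange r)
    (hsa : ∀ T, IsSelfAdjoint (F.op T)) {φ : ℝ → ℝ} (hφ : Continuous φ) {Φ : ℝ}
    (hΦ : ∀ t, |φ t| ≤ Φ) : Measurable (F.localTrace φ) := by
  choose p N₀ h using fun j : ℕ => exists_polynomial_approx' hφ hΦ (C := (j : ℝ) + 1)
    (ε := 1 / ((j : ℝ) + 1)) (by positivity) (by positivity)
  refine measurable_of_tendsto_metrizable (f := fun j u => (F.polyMoment (p j) u : ℂ))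
    (fun j => Complex.measurable_ofReal.comp (hF.measurable_polyMoment (p j))) ?_
  refine tendsto_pi_nhds.2 fun u => ?_
  obtain ⟨c, hc0, hc⟩ := F.exists_moment_le u
  have hlim : Tendsto (fun j : ℕ => 2 * (1 / ((j : ℝ) + 1))) atTop (𝓝 0) := by
    simpa using (tendsto_one_div_add_atTop_nhds_zero_nat (𝕜 := ℝ)).const_mul 2
  rw [tendsto_iff_norm_sub_tendsto_zero]
  refine squeeze_zero' (Eventually.of_forall fun _ => norm_nonneg _) ?_ hlim
  filter_upwards [eventually_ge_atTop ⌈c⌉₊] with j hj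
  have hcj : c ≤ (j : ℝ) + 1 := by
    have : (⌈c⌉₊ : ℝ) ≤ j := by exact_mod_cast hj
    linarith [Nat.le_ceil c]
  have h1 := F.norm_localTrace_sub_le hsa hφ (p j) (h j (N₀ j) le_rfl) u
  rw [norm_sub_rev]
  refine h1.trans ?_
  have h2 : F.moment (2 * N₀ j) u ≤ ((j : ℝ) + 1) ^ (2 * N₀ j) :=
    ((le_abs_self _).trans (hc _)).trans (pow_le_pow_left₀ hc0 hcj _)
  have h3 : 1 / ((j : ℝ) + 1) / ((j : ℝ) + 1) ^ (2 * N₀ j) * F.moment (2 * N₀ j) u ≤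
      1 / ((j : ℝ) + 1) := by
    rw [div_mul_eq_mul_div, div_le_iff₀ (by positivity)]
    gcongr
  linarith

end Moments

/-! ### Comparison with the operator on `L²` -/

section Comparison

variable {d : ℕ} {𝒟 : Type*} [MeasurableSpace 𝒟] {F : LeafwiseOperator d 𝒟} {r : ℕ}
  {ν : Measure (UnitSpace d 𝒟)} [IsFiniteMeasure ν] {H : L2 ν →L[ℂ] L2 ν}

theorem IsLeafwise.ae_aeval_diagVec (hν : IsTransverse ν) (hF : IsLeafwise ν H F)
    (hsa : ∀ T, IsSelfAdjoint (F.op T)) (p : Polynomial ℝ) :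
    ∀ᵐ u ∂ν, (Polynomial.aeval H p) (diagVec ν) (UnitSpace.diag u) = F.polyMoment p u := by
  have key : ∀ s : Finset ℕ, ∀ᵐ u ∂ν,
      (∑ i ∈ s, p.coeff i • H ^ i : L2 ν →L[ℂ] L2 ν) (diagVec ν) (UnitSpace.diag u) =
        ((∑ i ∈ s, p.coeff i * F.moment i u : ℝ) : ℂ) := by
    intro s
    induction s using Finset.induction_on with
    | empty =>
      filter_upwards [ae_diag_of_ae (Lp.coeFn_zero ℂ 2 (groupoidMeasure ν))] with u hu
      simpa using hu
    | insert i s hi ih =>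
      simp only [Finset.sum_insert hi]
      filter_upwards [ih, hF.ae_pow_diagVec hν i,
        ae_diag_of_ae (Lp.coeFn_smul (p.coeff i) ((H ^ i) (diagVec ν))),
        ae_diag_of_ae (Lp.coeFn_add (p.coeff i • (H ^ i) (diagVec ν))
          ((∑ i ∈ s, p.coeff i • H ^ i : L2 ν →L[ℂ] L2 ν) (diagVec ν)))] with u h1 h2 h3 h4
      rw [add_apply, smul_apply, h4, Pi.add_apply, h3, Pi.smul_apply, h1, h2,
        ← F.ofReal_moment hsa, Complex.ofReal_add, Complex.real_smul, Complex.ofReal_mul]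
  rw [Polynomial.aeval_eq_sum_range]
  exact key _

/-- Almost everywhere the moment is the real part of the diagonal value of `H ^ n` applied to the
diagonal function. Of the two factors `√(ν.real univ)`, one is the norm of that function and the
other comes from Cauchy–Schwarz. -/
theorem IsLeafwise.integral_moment_le (hν : IsTransverse ν) (hF : IsLeafwise ν H F) {n : ℕ}
    (hn : 0 < n) : Integrable (F.moment n) ν ∧ ∫ u, F.moment n u ∂ν ≤ ‖H‖ ^ n * ν.real Set.univ := by
  have hae : (fun u : UnitSpace d 𝒟 => ((H ^ n) (diagVec ν) u.diag).re) =ᵐ[ν] F.moment n := by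
    filter_upwards [hF.ae_pow_diagVec hν n] with u hu
    rw [hu]; rfl
  have hint := integrable_comp_diag ((H ^ n) (diagVec ν))
  refine ⟨hint.re.congr hae, ?_⟩
  rw [← integral_congr_ae hae]
  have h1 := setIntegral_norm_diagonal_le (H ^ n) (Set.univ : Set (UnitSpace d 𝒟))
  rw [setIntegral_univ, mul_assoc, Real.mul_self_sqrt measureReal_nonneg] at h1
  refine (integral_mono hint.re hint.norm fun u => Complex.re_le_norm _).trans (h1.trans ?_)
  gcongr
  exact norm_pow_le' H hn

/-- Markov's inequality for the even moment; the factor `2` in `2 * ‖H‖ ≤ C` produces geometric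
decay in `N`. -/
theorem IsLeafwise.measureReal_moment_gt_le (hν : IsTransverse ν) (hF : IsLeafwise ν H F)
    (hsa : ∀ T, IsSelfAdjoint (F.op T)) {N : ℕ} (hN : 0 < N) {C : ℝ} (hC : 0 < C)
    (hHC : 2 * ‖H‖ ≤ C) :
    ν.real {u | F.moment (2 * N) u ≤ C ^ (2 * N)}ᶜ ≤ (1 / 2) ^ (2 * N) * ν.real Set.univ := by
  obtain ⟨hint, hle⟩ := hF.integral_moment_le hν (n := 2 * N) (by omega)
  have h1 := mul_meas_ge_le_integral_of_nonneg
    (ae_of_all ν fun u => F.moment_even_nonneg hsa N u) hint (C ^ (2 * N))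
  have h2 : ν.real {u | F.moment (2 * N) u ≤ C ^ (2 * N)}ᶜ ≤
      ν.real {u | C ^ (2 * N) ≤ F.moment (2 * N) u} :=
    measureReal_mono fun u hu => (not_le.1 (show ¬ F.moment (2 * N) u ≤ C ^ (2 * N) from hu)).le
  have h3 : ‖H‖ ^ (2 * N) ≤ C ^ (2 * N) * (1 / 2) ^ (2 * N) := by
    rw [← mul_pow]
    exact pow_le_pow_left₀ (norm_nonneg _) (by linarith) _
  have h4 : C ^ (2 * N) * ν.real {u | F.moment (2 * N) u ≤ C ^ (2 * N)}ᶜ ≤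
      C ^ (2 * N) * ((1 / 2) ^ (2 * N) * ν.real Set.univ) :=
    calc _ ≤ C ^ (2 * N) * ν.real {u | C ^ (2 * N) ≤ F.moment (2 * N) u} := by gcongr
      _ ≤ ‖H‖ ^ (2 * N) * ν.real Set.univ := h1.trans hle
      _ ≤ C ^ (2 * N) * (1 / 2) ^ (2 * N) * ν.real Set.univ := by gcongr
      _ = _ := mul_assoc _ _ _
  exact le_of_mul_le_mul_left h4 (by positivity)

theorem integrable_diagonalEntry (K : L2 ν →L[ℂ] L2 ν) : Integrable (diagonalEntry ν K) ν := by
  rw [funext (diagonalEntry_eq K)]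
  exact integrable_comp_diag _

/-- On `G` the difference of the integrands is the diagonal entry of `φ(H) - p(H)`, an operator of
norm at most `c`. Off `G` only the entry of `φ(H)` remains. It is not bounded pointwise here but
through Cauchy–Schwarz, whence the square root of `ν.real Gᶜ`. -/
theorem IsLeafwise.norm_densityOfStates_sub_le (hν : IsTransverse ν) (hF : IsLeafwise ν H F)
    (hH : IsSelfAdjoint H) (hsa : ∀ T, IsSelfAdjoint (F.op T)) {φ : ℝ → ℝ} (hφ : Continuous φ)
    {Φ : ℝ} (hΦ : ∀ t, |φ t| ≤ Φ) (p : Polynomial ℝ) {c : ℝ} (hc : 0 ≤ c)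
    (hp : ∀ t, |t| ≤ ‖H‖ → |φ t - p.eval t| ≤ c) {G : Set (UnitSpace d 𝒟)} (hG : MeasurableSet G)
    (hGi : Integrable (G.indicator (F.polyMoment p)) ν) :
    ‖densityOfStates ν H φ - (∫ u, G.indicator (F.polyMoment p) u ∂ν : ℝ)‖ ≤
      c * ν.real Set.univ + Φ * √(ν.real Set.univ) * √(ν.real Gᶜ) := by
  have hD := integrable_diagonalEntry (applyFun φ H)
  have hD' := integrable_diagonalEntry (applyFun φ H - Polynomial.aeval H p)
  have hDiff : ∀ᵐ u ∂ν, diagonalEntry ν (applyFun φ H - Polynomial.aeval H p) u =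
      diagonalEntry ν (applyFun φ H) u - F.polyMoment p u := by
    filter_upwards [hF.ae_aeval_diagVec hν hsa p,
      ae_diag_of_ae (Lp.coeFn_sub (applyFun φ H (diagVec ν)) (Polynomial.aeval H p (diagVec ν)))]
      with u h1 h2
    rw [diagonalEntry_eq, diagonalEntry_eq, sub_apply, h2, Pi.sub_apply, h1]
  have hGi' : Integrable (fun u => ((G.indicator (F.polyMoment p) u : ℝ) : ℂ)) ν := hGi.ofReal
  rw [densityOfStates, trace, ← integral_complex_ofReal, ← integral_sub hD hGi']
  refine (norm_integral_le_integral_norm _).trans ?_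
  have hle : ∀ᵐ u ∂ν, ‖diagonalEntry ν (applyFun φ H) u - (G.indicator (F.polyMoment p) u : ℝ)‖ ≤
      ‖diagonalEntry ν (applyFun φ H - Polynomial.aeval H p) u‖ +
        Gᶜ.indicator (fun u => ‖diagonalEntry ν (applyFun φ H) u‖) u := by
    filter_upwards [hDiff] with u hu
    by_cases h : u ∈ G
    · rw [Set.indicator_of_mem h, Set.indicator_of_notMem (by simpa using h), hu, add_zero]
    · rw [Set.indicator_of_notMem h, Set.indicator_of_mem (by simpa using h)]
      simp
  refine (integral_mono_ae (hD.sub hGi').norm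
    (hD'.norm.add (hD.norm.indicator hG.compl)) hle).trans ?_
  rw [integral_add' hD'.norm (hD.norm.indicator hG.compl), integral_indicator hG.compl]
  simp only [diagonalEntry_eq]
  have h1 := setIntegral_norm_diagonal_le (applyFun φ H - Polynomial.aeval H p)
    (Set.univ : Set (UnitSpace d 𝒟))
  rw [setIntegral_univ, mul_assoc, Real.mul_self_sqrt measureReal_nonneg] at h1
  have h2 := setIntegral_norm_diagonal_le (applyFun φ H) Gᶜ
  have h3 := norm_applyFun_sub_aeval_le hH hφ p hc hp
  have h4 := norm_applyFun_le (A := H) hΦ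
  refine add_le_add (h1.trans ?_) (h2.trans ?_)
  · exact mul_le_mul_of_nonneg_right h3 measureReal_nonneg
  · gcongr

theorem LeafwiseOperator.norm_integral_localTrace_sub_le {μ : Measure (UnitSpace d 𝒟)}
    [IsFiniteMeasure μ] {φ : ℝ → ℝ} {Φ : ℝ} (hΦ : ∀ t, |φ t| ≤ Φ)
    (hlt : Integrable (F.localTrace φ) μ) {c : ℝ} (hc : 0 ≤ c)
    {G : Set (UnitSpace d 𝒟)} (hG : MeasurableSet G) {f : UnitSpace d 𝒟 → ℝ}
    (hf : ∀ u ∈ G, ‖F.localTrace φ u - f u‖ ≤ c) (hGi : Integrable (G.indicator f) μ) :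
    ‖∫ u, F.localTrace φ u ∂μ - (∫ u, G.indicator f u ∂μ : ℝ)‖ ≤
      c * μ.real Set.univ + Φ * μ.real Gᶜ := by
  have hGi' : Integrable (fun u => ((G.indicator f u : ℝ) : ℂ)) μ := hGi.ofReal
  rw [← integral_complex_ofReal, ← integral_sub hlt hGi']
  refine (norm_integral_le_integral_norm _).trans ?_
  have hi : Integrable (Gᶜ.indicator fun _ : UnitSpace d 𝒟 => Φ) μ :=
    (integrable_const Φ).indicator hG.compl
  refine (integral_mono (hlt.sub hGi').norm ((integrable_const c).add hi)
    fun u => ?_).trans_eq ?_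
  · by_cases h : u ∈ G
    · simpa [h] using hf u h
    · have := F.norm_localTrace_le hΦ u
      simp [h]
      linarith
  · rw [integral_add' (integrable_const c) hi, integral_indicator hG.compl]
    simp [mul_comm]

theorem LeafwiseOperator.HasHoppingRange.integrable_localTrace (hF : F.HasHoppingRange r)
    (hsa : ∀ T, IsSelfAdjoint (F.op T)) {φ : ℝ → ℝ} (hφ : Continuous φ) {Φ : ℝ}
    (hΦ : ∀ t, |φ t| ≤ Φ) (μ : Measure (UnitSpace d 𝒟)) [IsFiniteMeasure μ] :
    Integrable (F.localTrace φ) μ :=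
  Integrable.of_bound (hF.measurable_localTrace hsa hφ hΦ).aestronglyMeasurable Φ
    (ae_of_all _ (F.norm_localTrace_le hΦ))

/-- The comparison passes through the integral of the polynomial moment cut off to `G`, first for
`ν' n` and then for `ν`. The three steps contribute, in order, the leafwise error, the single `ε`
from convergence for a bounded local function, and the error on `L²`. -/
theorem IsLeafwise.eventually_norm_integral_sub_le (hν : IsTransverse ν) (hF : IsLeafwise ν H F)
    (hH : IsSelfAdjoint H) (hsa : ∀ T, IsSelfAdjoint (F.op T)) (hr : F.HasHoppingRange r)
    {ν' : ℕ → Measure (UnitSpace d 𝒟)} [∀ n, IsFiniteMeasure (ν' n)] (hconv : PatchConverges ν' ν)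
    {φ : ℝ → ℝ} (hφ : Continuous φ) {Φ : ℝ} (hΦ : ∀ t, |φ t| ≤ Φ) {ε : ℝ} (hε : 0 < ε) :
    ∀ᶠ n in atTop, ‖∫ u, F.localTrace φ u ∂ν' n - densityOfStates ν H φ‖ ≤
      2 * ε * (ν.real Set.univ + ε) + Φ * (ε * ν.real Set.univ + ε) + ε +
        (2 * ε * ν.real Set.univ + Φ * √(ν.real Set.univ) * √(ε * ν.real Set.univ)) := by
  have hΦ0 : 0 ≤ Φ := (abs_nonneg _).trans (hΦ 0)
  -- The added `1` keeps `C` positive when `H = 0`.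
  set C : ℝ := 2 * ‖H‖ + 1 with hCdef
  have hC : 0 < C := by positivity
  obtain ⟨p, N₀, hp⟩ := exists_polynomial_approx' hφ hΦ hC hε
  obtain ⟨N₁, hN₁⟩ := exists_pow_lt_of_lt_one hε (by norm_num : (1 / 2 : ℝ) < 1)
  set N := N₀ + N₁ + 1
  -- In `N`, the summand `N₀` serves the polynomial approximation, `N₁` the bound `(1 / 2) ^ (2 * N)
  -- ≤ ε`, and `1` makes the order positive for Markov's inequality.
  replace hp := hp N (by omega)
  have hhalf : (1 / 2 : ℝ) ^ (2 * N) ≤ ε :=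
    (pow_le_pow_of_le_one (by norm_num) (by norm_num) (by omega)).trans hN₁.le
  have hCN : 0 < C ^ (2 * N) := by positivity
  set G : Set (UnitSpace d 𝒟) := {u | F.moment (2 * N) u ≤ C ^ (2 * N)} with hGdef
  have hG : MeasurableSet G :=
    measurableSet_le (hr.isLocal_moment (2 * N)).measurable_fun measurable_const
  have hGc : ν.real Gᶜ ≤ ε * ν.real Set.univ :=
    (hF.measureReal_moment_gt_le hν hsa (by omega) hC (by linarith)).trans (by gcongr)
  have hfG : ∀ u ∈ G, ‖F.localTrace φ u - F.polyMoment p u‖ ≤ 2 * ε := fun u hu => by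
    refine (F.norm_localTrace_sub_le hsa hφ p hp u).trans ?_
    have : ε / C ^ (2 * N) * F.moment (2 * N) u ≤ ε := by
      rw [div_mul_eq_mul_div, div_le_iff₀ hCN]
      exact mul_le_mul_of_nonneg_left hu hε.le
    linarith
  obtain ⟨ρ, hloc⟩ := hr.isLocal_polyMoment_indicator p (2 * N) (C ^ (2 * N))
  -- The polynomial moment need not be bounded, but on `G` it is `2ε`-close to the local trace,
  -- which is at most `Φ`. The cut-off thus makes it a bounded local function.
  have hbd : ∀ u, |G.indicator (F.polyMoment p) u| ≤ Φ + 2 * ε := fun u => by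
    by_cases h : u ∈ G
    · rw [Set.indicator_of_mem h]
      have h1 := norm_sub_norm_le (F.polyMoment p u : ℂ) (F.localTrace φ u)
      rw [norm_sub_rev, Complex.norm_real, Real.norm_eq_abs] at h1
      linarith [hfG u h, F.norm_localTrace_le hΦ u]
    · rw [Set.indicator_of_notMem h, abs_zero]
      positivity
  have hGi : ∀ (μ : Measure (UnitSpace d 𝒟)) [IsFiniteMeasure μ],
      Integrable (G.indicator (F.polyMoment p)) μ := fun μ _ =>
    Integrable.of_bound hloc.measurable_fun.aestronglyMeasurable _ (ae_of_all _ hbd)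
  have hpH : ∀ t, |t| ≤ ‖H‖ → |φ t - p.eval t| ≤ 2 * ε := fun t ht => by
    refine (hp t).trans ?_
    have h1 : t ^ (2 * N) ≤ C ^ (2 * N) := by
      refine (le_abs_self _).trans ?_
      rw [abs_pow]
      exact pow_le_pow_left₀ (abs_nonneg t) (by linarith [norm_nonneg H]) _
    have : ε / C ^ (2 * N) * t ^ (2 * N) ≤ ε := by
      rw [div_mul_eq_mul_div, div_le_iff₀ hCN]
      exact mul_le_mul_of_nonneg_left h1 hε.le
    linarith
  have hκ := hF.norm_densityOfStates_sub_le hν hH hsa hφ hΦ p (by positivity) hpH hG (hGi ν)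
  have hlim := hloc.tendsto_integral hbd hconv
  -- As `Gᶜ` is a level set of a local function, its measure under `ν' n` converges and inherits the
  -- Markov bound available for `ν` only.
  have hlimG := ((hr.isLocal_moment (2 * N)).tendsto_measureReal hconv
    (measurableSet_Iic (a := C ^ (2 * N))).compl)
  filter_upwards [Metric.tendsto_nhds.1 hlim ε hε,
    hconv.tendsto_univ.eventually_le_const (lt_add_of_pos_right _ hε),
    hlimG.eventually_le_const (lt_add_of_pos_right _ hε)] with n h1 h2 h3
  have hν'G : (ν' n).real Gᶜ ≤ ε * ν.real Set.univ + ε := h3.trans (add_le_add_left hGc ε)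
  have h4 := F.norm_integral_localTrace_sub_le hΦ (hr.integrable_localTrace hsa hφ hΦ (ν' n))
    (by positivity) hG hfG (hGi (ν' n))
  have h5 : ‖((∫ u, G.indicator (F.polyMoment p) u ∂ν' n : ℝ) : ℂ) -
      (∫ u, G.indicator (F.polyMoment p) u ∂ν : ℝ)‖ ≤ ε := by
    rw [← Complex.ofReal_sub, Complex.norm_real]
    exact h1.le
  have h6 : ‖∫ u, F.localTrace φ u ∂ν' n - (∫ u, G.indicator (F.polyMoment p) u ∂ν' n : ℝ)‖ ≤
      2 * ε * (ν.real Set.univ + ε) + Φ * (ε * ν.real Set.univ + ε) :=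
    h4.trans (by gcongr)
  have h7 : ‖densityOfStates ν H φ - (∫ u, G.indicator (F.polyMoment p) u ∂ν : ℝ)‖ ≤
      2 * ε * ν.real Set.univ + Φ * √(ν.real Set.univ) * √(ε * ν.real Set.univ) :=
    hκ.trans (by gcongr)
  rw [norm_sub_rev] at h7
  refine (norm_sub_le_norm_sub_add_norm_sub _
    ((∫ u, G.indicator (F.polyMoment p) u ∂ν : ℝ) : ℂ) _).trans (add_le_add ?_ h7)
  exact (norm_sub_le_norm_sub_add_norm_sub _ _ _).trans (add_le_add h6 h5)

/-- The error bound is continuous in `ε` and vanishes at `ε = 0`. -/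
theorem IsLeafwise.tendsto_integral_localTrace (hν : IsTransverse ν) (hF : IsLeafwise ν H F)
    (hH : IsSelfAdjoint H) (hsa : ∀ T, IsSelfAdjoint (F.op T)) (hr : F.HasHoppingRange r)
    {ν' : ℕ → Measure (UnitSpace d 𝒟)} [∀ n, IsFiniteMeasure (ν' n)] (hconv : PatchConverges ν' ν)
    {φ : ℝ → ℝ} (hφ : Continuous φ) {Φ : ℝ} (hΦ : ∀ t, |φ t| ≤ Φ) :
    Tendsto (fun n => ∫ u, F.localTrace φ u ∂ν' n) atTop (𝓝 (densityOfStates ν H φ)) := by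
  set m := ν.real Set.univ
  have hcont : Continuous fun ε : ℝ => 2 * ε * (m + ε) + Φ * (ε * m + ε) + ε +
      (2 * ε * m + Φ * √m * √(ε * m)) := by fun_prop
  have h0 := hcont.tendsto 0
  simp only [mul_zero, zero_mul, add_zero, Real.sqrt_zero] at h0
  refine Metric.tendsto_nhds.2 fun η hη => ?_
  obtain ⟨ε, hεη, hε⟩ := (((h0.mono_left nhdsWithin_le_nhds).eventually_lt_const hη).and
    (self_mem_nhdsWithin (a := (0 : ℝ)) (s := Set.Ioi 0))).exists
  filter_upwards [hF.eventually_norm_integral_sub_le hν hH hsa hr hconv hφ hΦ hε] with n hn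
  rw [dist_eq_norm]
  exact hn.trans_lt hεη

end Comparison

end TriangulationSpace

end

theorem mainTheorem2 {d : ℕ} (hd : 6 < d)
    {𝒟 : Type*} [MetricSpace 𝒟] [CompactSpace 𝒟] [MeasurableSpace 𝒟] [BorelSpace 𝒟]
    (ν : Measure (TriangulationSpace.UnitSpace d 𝒟)) [IsFiniteMeasure ν]
    (hν : TriangulationSpace.IsTransverse ν)
    (ν' : ℕ → Measure (TriangulationSpace.UnitSpace d 𝒟)) [∀ n, IsFiniteMeasure (ν' n)]
    (hconv : TriangulationSpace.PatchConverges ν' ν)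
    (H : TriangulationSpace.L2 ν →L[ℂ] TriangulationSpace.L2 ν)
    (hH : H ∈ TriangulationSpace.WStar ν) (hsa : IsSelfAdjoint H)
    (F : TriangulationSpace.LeafwiseOperator d 𝒟)
    (hF : TriangulationSpace.IsLeafwise ν H F) (hFsa : ∀ T, IsSelfAdjoint (F.op T))
    (hrange : ∃ r : ℕ, F.HasHoppingRange r)
    (φ : ℝ → ℝ) (hφ : Continuous φ) (hφc : HasCompactSupport φ) :
    Integrable (TriangulationSpace.diagonalEntry ν (TriangulationSpace.applyFun φ H)) ν ∧
    (∀ n, Integrable (F.localTrace φ) (ν' n)) ∧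
    Tendsto (fun n => ∫ u, F.localTrace φ u ∂(ν' n)) atTop
      (𝓝 (TriangulationSpace.densityOfStates ν H φ)) := by
  obtain ⟨r, hr⟩ := hrange
  obtain ⟨Φ, hΦ⟩ := hφc.exists_bound_of_continuous hφ
  exact ⟨TriangulationSpace.integrable_diagonalEntry _,
    fun n => hr.integrable_localTrace hFsa hφ hΦ (ν' n),
    hF.tendsto_integral_localTrace hν hsa hFsa hr hconv hφ hΦ⟩
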